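/- Let $T\ge 1$. For each technology $i\in\{1,\dots,T\}$ let $\phi_i$ (the base stations of technology $i$) be a homogeneous Poisson point process on $\mathbb R^2$ of intensity $\lambda_i>0$, let $r^i_j$ be the distance from the origin (the user) to the $j$-th nearest point of $\phi_i$, and let $H^i_j$, $j\ge 1$, be exponential random variables with mean $\mu^{-1}$, $\mu>0$ (Rayleigh fading). All the processes $\phi_i$ and all the variables $H^i_j$ are jointly independent. Let $P_i>0$ be the transmit powers, let the noise vanish ($N_0^i=0$ for all $i$), and let the path loss be $l_i(r)=r^{-\alpha}$ for all $i$, where $\alpha>2$. Put $$\mathrm{SIR}^{i,j}=\frac{P_iH^i_j\,l_i(r^i_j)}{\sum_{k\ne j}P_iH^i_k\,l_i(r^i_k)} .$$ The max-ratio policy observes only the ratios $r^i_2/r^i_1$, $1\le i\le T$, and associates the user with the nearest base station ($j^*=1$) of a technology $i^*$ that maximizes $r^i_2/r^i_1$ (ties broken in any way that depends only on the ratios). Let $\beta_i>0$ be thresholds, and let $$\mathcal R^{cp}=\mathbb P\big[\mathrm{SIR}^{i^*,1}\ge\beta_{i^*}\big],\qquad \mathcal R^{r}=\mathbb E\big[\log_2(1+\mathrm{SIR}^{i^*,1})\big]$$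 be the coverage probability and the average achievable rate of this policy. For $y>0$ and $0<x\le 1$ let $$\varphi(\alpha,y,x)=\int_{y^{-2/\alpha}}^{\infty}\frac{du}{1+x^{-\alpha}u^{\alpha/2}} .$$ Then almost surely $0<\sum_{k\ge 2}P_iH^i_k\,l_i(r^i_k)<\infty$ for every $i$, the variable $\log_2(1+\mathrm{SIR}^{i^*,1})$ is integrable, and the following hold. (i) Coverage probability: $$\mathcal R^{cp}=\begin{cases}\displaystyle\sum_{i=1}^T\int_0^1\frac{2(T-1)\,x^3(1-x^2)^{T-2}}{1+\beta_i^{2/\alpha}\varphi(\alpha,\beta_i,x)}\,dx, & T\ge 2,\\[3mm] \displaystyle\frac{1}{1+\beta_1^{2/\alpha}\varphi(\alpha,\beta_1,1)}, & T=1.\end{cases}$$ (ii) Average achievable rate: $$\mathcal R^{r}=\begin{cases}\displaystyle\sum_{i=1}^T\int_0^1\int_0^\infty\frac{2(T-1)\,x^3(1-x^2)^{T-2}}{1+(2^t-1)^{2/\alpha}\varphi(\alpha,2^t-1,x)}\,dt\,dx, & T\ge 2,\\[3mm] \displaystyle\int_0^\infty\frac{1}{1+(2^t-1)^{2/\alpha}\varphi(\alpha,2^t-1,1)}\,dt,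 & T=1.\end{cases}$$ (iii) Conditional coverage: for every $i$ and every $0<x\le 1$, $$\mathbb P\Big[\mathrm{SIR}^{i,1}\ge\beta_i\;\Big|\;\frac{r^i_2}{r^i_1}\ge\frac1x\Big]=\frac{1}{1+\beta_i^{2/\alpha}\varphi(\alpha,\beta_i,x)} .$$ -/

import Mathlib

open MeasureTheory ProbabilityTheory
open scoped ENNReal NNReal

noncomputable section

namespace MaxRatio

/-- The plane in which the base stations (BSs) are placed, with its Euclidean distance. -/
abbrev Plane : Type := EuclideanSpace ℝ (Fin 2)

/-- `φ` is a Poisson point process on the plane with intensity measure `ν`: a random locally finite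
set of points whose counts on Borel sets of finite intensity are Poisson distributed and whose
counts on disjoint Borel sets are independent. -/
structure IsPoissonPointProcess {Ω : Type*} [MeasurableSpace Ω] (Pr : Measure Ω)
    (φ : Ω → Set Plane) (ν : Measure Plane) : Prop where
  locallyFinite : ∀ ω, ∀ R : ℝ, (φ ω ∩ Metric.closedBall 0 R).Finite
  measurable_count : ∀ B : Set Plane, MeasurableSet B →
    Measurable fun ω => (φ ω ∩ B).encard
  poisson_count : ∀ B : Set Plane, MeasurableSet B → ν B ≠ ∞ → ∀ n : ℕ,
    Pr {ω | (φ ω ∩ B).encard = n} = poissonMeasure (ν B).toNNReal {n}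
  indep_counts : ∀ (m : ℕ) (B : Fin m → Set Plane), (∀ k, MeasurableSet (B k)) →
    Pairwise (fun k l => Disjoint (B k) (B l)) →
    iIndepFun (fun k ω => (φ ω ∩ B k).encard) Pr

/-- The sigma-algebra generated by a point process, i.e. by all its counts on Borel sets. -/
@[reducible] def pointSigma {Ω : Type*} (φ : Ω → Set Plane) : MeasurableSpace Ω :=
  ⨆ B : {B : Set Plane // MeasurableSet B},
    MeasurableSpace.comap (fun ω => (φ ω ∩ B.1).encard) inferInstance

/-- The distance from the origin (the typical user) to the `(j+1)`-th closest point of `S`.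
Indices start at `0`: `nthDist S 0` is the distance to the nearest point (`r₁`) and
`nthDist S 1` the distance to the second nearest point (`r₂`). -/
def nthDist (S : Set Plane) (j : ℕ) : ℝ :=
  sInf {r : ℝ | 0 ≤ r ∧ ((j + 1 : ℕ) : ℕ∞) ≤ (S ∩ Metric.closedBall 0 r).encard}

/-- The stochastic network with `T` technologies: the BSs of technology `i` form a homogeneous
Poisson point process `φ i` of intensity `lam i`; `H i j` is the fading coefficient between the user
and the `(j+1)`-th nearest BS of technology `i`. The fading coefficients are exponential with
mean `1 / μ` (Rayleigh fading), and all the point processes and all the fading coefficients are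
jointly independent. -/
structure IsRayleighPoissonNetwork {Ω : Type*} [MeasurableSpace Ω] (Pr : Measure Ω) {T : ℕ}
    (φ : Fin T → Ω → Set Plane) (H : Fin T → ℕ → Ω → ℝ) (lam : Fin T → ℝ) (μ : ℝ) : Prop where
  poisson : ∀ i, IsPoissonPointProcess Pr (φ i) (ENNReal.ofReal (lam i) • volume)
  measurable_fading : ∀ i j, Measurable (H i j)
  fading_law : ∀ i j, Pr.map (H i j) = expMeasure μ
  indep : iIndep (Sum.elim (fun i : Fin T => pointSigma (φ i))
    (fun p : Fin T × ℕ => MeasurableSpace.comap (H p.1 p.2) inferInstance)) Pr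

section Network

variable {Ω : Type*} {T : ℕ} (φ : Fin T → Ω → Set Plane) (H : Fin T → ℕ → Ω → ℝ)
  (Pw N₀ : Fin T → ℝ) (l : Fin T → ℝ → ℝ)

/-- The power received by the user from the `(j+1)`-th nearest BS of technology `i`, with transmit
powers `Pw` and path-loss functions `l`. -/
def receivedPower (i : Fin T) (j : ℕ) (ω : Ω) : ℝ :=
  Pw i * H i j ω * l i (nthDist (φ i ω) j)

/-- The interference from all BSs of technology `i` other than the `(j+1)`-th nearest one. -/
def interference (i : Fin T) (j : ℕ) (ω : Ω) : ℝ :=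
  ∑' k : {k : ℕ // k ≠ j}, receivedPower φ H Pw l i k ω

/-- The signal to interference plus noise ratio, with noise powers `N₀`, when the user is served by
the `(j+1)`-th nearest BS of technology `i`. -/
def sinr (i : Fin T) (j : ℕ) (ω : Ω) : ℝ :=
  receivedPower φ H Pw l i j ω / (N₀ i + interference φ H Pw l i j ω)

/-- The ratio `r₂ / r₁` of technology `i`. -/
def distRatio (i : Fin T) (ω : Ω) : ℝ :=
  nthDist (φ i ω) 1 / nthDist (φ i ω) 0

/-- The information available to the max-ratio policy: the sigma-algebra generated by the ratios
`r₂ / r₁` of all technologies. -/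
@[reducible] def ratioInfo : MeasurableSpace Ω :=
  ⨆ i, MeasurableSpace.comap (distRatio φ i) inferInstance

/-- `π` (giving the technology and the index of the serving BS) is a max-ratio policy: it depends
only on the ratios, it chooses a technology whose ratio `r₂ / r₁` is largest (ties may be broken in
any way), and the nearest BS of that technology. -/
structure IsMaxRatioPolicy [MeasurableSpace Ω] (Pr : Measure Ω) (π : Ω → Fin T × ℕ) : Prop where
  measurable_info : Measurable[ratioInfo φ] π
  argmax : ∀ᵐ ω ∂Pr, ∀ i, distRatio φ i ω ≤ distRatio φ (π ω).1 ω
  nearest : ∀ᵐ ω ∂Pr, (π ω).2 = 0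

/-- The performance experienced by the user under the policy `π`, when `p i` is the performance
function of technology `i`. -/
def experienced (p : Fin T → ℝ → ℝ) (π : Ω → Fin T × ℕ) (ω : Ω) : ℝ :=
  p (π ω).1 (sinr φ H Pw N₀ l (π ω).1 (π ω).2 ω)

/-- The average performance of the policy `π`. -/
def performance [MeasurableSpace Ω] (Pr : Measure Ω) (p : Fin T → ℝ → ℝ)
    (π : Ω → Fin T × ℕ) : ℝ :=
  ∫ ω, experienced φ H Pw N₀ l p π ω ∂Pr

end Network

/-- The performance functions `x ↦ 1(x ≥ β i)`, giving the coverage probability. -/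
def coverageMetric {T : ℕ} (β : Fin T → ℝ) (i : Fin T) : ℝ → ℝ :=
  Set.indicator (Set.Ici (β i)) 1

/-- The performance functions `x ↦ log₂ (1 + x)`, giving the average achievable rate. -/
def rateMetric {T : ℕ} (_ : Fin T) (x : ℝ) : ℝ := Real.logb 2 (1 + x)

/-- The function `φ(α, y, x) = ∫_{u ≥ y^{-2/α}} 1 / (1 + x^{-α} u^{α/2}) du`. -/
def phi (α y x : ℝ) : ℝ :=
  ∫ u in Set.Ici (y ^ (-2 / α)), 1 / (1 + x ^ (-α) * u ^ (α / 2))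

end MaxRatio

end

/-! The whole theorem rests on one identity for a single technology: for `y ≥ 0` and `0 < x ≤ 1`,
the probability that `r₂ / r₁ ≥ 1 / x` and `SIR ≥ y` is `1 / D`, where `D = cellRate α y x = (1 + y
^ (2/α) φ(α, y, x)) / x ^ 2` (`IsRayleighCell.measure_le_ratio_fadingSum`).

With the nearest point serving, `SIR ≥ y` means `H₁ ≥ y ∑_{k ≥ 2} H_k (r₁ / r_k) ^ α`. Given the
distances, the exponential tail of `H₁` turns this probability into a Laplace transform of the other
fadings, which is the product over `k ≥ 2` of `1 / (1 + y (r₁ / r_k) ^ α)`. What remains is the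
expectation of this product on the event `r₁ / x < r₂`
(`IsPoissonPointProcess.integral_ratio_weight`).

Conditioning on `r₁` is replaced by a discretisation. On a cell `a < r₁ ≤ b`, put `b` in place of
`r₁` in the product and in the event. The event `a < r₁ ≤ b`, `b / x < r₂` says that one region is
empty and a disjoint one holds exactly one point, while the product only involves points farther
than `b / x`. The Laplace functional, jointly with these two counts, gives `K (b² - a²) exp (-K b²
D)` with `K = πλ`. For the grid `b² = (m + 1) h` these terms form a geometric series with sum `K h /
(exp (K h D) - 1)`, and `h → 0` gives `1 / D`. The intensity drops out here, and the power cancels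
in the SIR.

Taking `y = 0` shows that `r₁ / r₂` has distribution function `x²` on the unit interval. Dividing by
it gives the conditional coverage. The ratio has no atoms and technologies are independent, so ties
have probability zero and the policy selects technology `i` exactly on `bestSet φ i`, up to a null
set. The minimum of the `T - 1` other values `r₁ / r₂` has density `2 (T - 1) x (1 - x²) ^ (T - 2)`
and is independent of technology `i`. Integrating `1 / D` against this density gives the coverage
probability (`IsRayleighPoissonNetwork.measure_bestSet_sir`).

For the rate, the layer cake formula expresses the mean through the tail at `t`, which is the
coverage at threshold `2 ^ t - 1`. An exponential tail bound gives integrability, and Tonelli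
exchanges the two integrals. -/

namespace MaxRatio

open Filter Topology Set

/-! ### Point sets as counting measures -/

/-- The counting measure of a set of points of the plane. -/
noncomputable def pointMeasure (S : Set Plane) : Measure Plane := Measure.count.restrict S

/-- A set of points with finitely many points in every ball around the origin. -/
def LocallyFiniteSet (S : Set Plane) : Prop := ∀ R : ℝ, (S ∩ Metric.closedBall 0 R).Finite

theorem LocallyFiniteSet.countable {S : Set Plane} (hS : LocallyFiniteSet S) : S.Countable := by
  have h : S ⊆ ⋃ n : ℕ, S ∩ Metric.closedBall 0 (n : ℝ) := by
    intro z hz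
    obtain ⟨n, hn⟩ := exists_nat_ge ‖z‖
    exact mem_iUnion.2 ⟨n, hz, by simpa using hn⟩
  exact (countable_iUnion fun n : ℕ => (hS n).countable).mono h

theorem pointMeasure_apply {S : Set Plane} (hS : LocallyFiniteSet S) {B : Set Plane}
    (hB : MeasurableSet B) : pointMeasure S B = ((S ∩ B).encard : ℝ≥0∞) := by
  rw [pointMeasure, Measure.restrict_apply hB, inter_comm,
    Measure.count_apply (hS.countable.mono inter_subset_left).measurableSet]

theorem measurable_encard_pointSigma {Ω : Type*} (φ : Ω → Set Plane) {B : Set Plane} (hB : MeasurableSet B) :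
    Measurable[pointSigma φ] fun ω => (φ ω ∩ B).encard := by
  apply Measurable.of_comap_le
  exact le_iSup (fun B : {B : Set Plane // MeasurableSet B} =>
    MeasurableSpace.comap (fun ω => (φ ω ∩ B.1).encard) inferInstance) ⟨B, hB⟩

theorem measurable_pointMeasure_pointSigma {Ω : Type*} {φ : Ω → Set Plane}
    (hφ : ∀ ω, LocallyFiniteSet (φ ω)) :
    Measurable[pointSigma φ] fun ω => pointMeasure (φ ω) := by
  refine @Measure.measurable_of_measurable_coe _ _ _ (pointSigma φ) _ fun B hB => ?_
  simp_rw [fun ω => pointMeasure_apply (hφ ω) hB]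
  exact (Measurable.of_discrete (f := fun n : ℕ∞ => (n : ℝ≥0∞))).comp
    (measurable_encard_pointSigma φ hB)

/-! ### Counts, Campbell's formula and the Laplace functional of a Poisson process -/

section Poisson

variable {Ω : Type*} [MeasurableSpace Ω] {Pr : Measure Ω} {φ : Ω → Set Plane} {ν : Measure Plane}

theorem IsPoissonPointProcess.pointSigma_le (h : IsPoissonPointProcess Pr φ ν) :
    pointSigma φ ≤ ‹MeasurableSpace Ω› :=
  iSup_le fun B => (h.measurable_count B.1 B.2).comap_le

theorem IsPoissonPointProcess.locallyFiniteSet (h : IsPoissonPointProcess Pr φ ν) (ω : Ω) :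
    LocallyFiniteSet (φ ω) := h.locallyFinite ω

theorem IsPoissonPointProcess.measurable_pointMeasure (h : IsPoissonPointProcess Pr φ ν) :
    Measurable fun ω => pointMeasure (φ ω) :=
  (measurable_pointMeasure_pointSigma h.locallyFiniteSet).mono h.pointSigma_le le_rfl

/-- Counts live in `ℕ∞`, and the definition prescribes only the finite atoms. These already have
total mass one, so the mass at `⊤` is forced to be zero. -/
theorem IsPoissonPointProcess.map_count [IsProbabilityMeasure Pr]
    (h : IsPoissonPointProcess Pr φ ν) {B : Set Plane} (hB : MeasurableSet B) (hν : ν B ≠ ∞) :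
    Pr.map (fun ω => (φ ω ∩ B).encard) =
      (poissonMeasure (ν B).toNNReal).map (fun n : ℕ => (n : ℕ∞)) := by
  have hm := h.measurable_count B hB
  have hc : Measurable fun n : ℕ => (n : ℕ∞) := Measurable.of_discrete
  have h1 : ∀ n : ℕ, Pr.map (fun ω => (φ ω ∩ B).encard) {(n : ℕ∞)} =
      (poissonMeasure (ν B).toNNReal).map (fun n : ℕ => (n : ℕ∞)) {(n : ℕ∞)} := by
    intro n
    rw [Measure.map_apply hm (measurableSet_singleton _),
      Measure.map_apply hc (measurableSet_singleton _)]
    have e : (fun n : ℕ => (n : ℕ∞)) ⁻¹' {(n : ℕ∞)} = {n} := by ext; simp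
    rw [e, ← h.poisson_count B hB hν n]
    rfl
  have p1 : IsProbabilityMeasure (Pr.map (fun ω => (φ ω ∩ B).encard)) :=
    Measure.isProbabilityMeasure_map hm.aemeasurable
  have p2 : IsProbabilityMeasure ((poissonMeasure (ν B).toNNReal).map (fun n : ℕ => (n : ℕ∞))) :=
    Measure.isProbabilityMeasure_map hc.aemeasurable
  have hr : ∀ Q : Measure ℕ∞, Q (range fun n : ℕ => (n : ℕ∞)) = ∑' n : ℕ, Q {(n : ℕ∞)} := by
    intro Q
    rw [← iUnion_singleton_eq_range, measure_iUnion]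
    · intro a b hab
      simpa using hab
    · exact fun _ => measurableSet_singleton _
  have ht : ({⊤} : Set ℕ∞) = (range fun n : ℕ => (n : ℕ∞))ᶜ := by
    ext z; cases z <;> simp
  have hr' : Pr.map (fun ω => (φ ω ∩ B).encard) (range fun n : ℕ => (n : ℕ∞)) =
      (poissonMeasure (ν B).toNNReal).map (fun n : ℕ => (n : ℕ∞)) (range fun n : ℕ => (n : ℕ∞)) := by
    rw [hr, hr]; simp_rw [h1]
  refine Measure.ext_of_singleton fun z => ?_
  cases z with
  | coe n => exact h1 n
  | top => rw [ht, prob_compl_eq_one_sub .of_discrete, prob_compl_eq_one_sub .of_discrete, hr']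

theorem IsPoissonPointProcess.integral_count [IsProbabilityMeasure Pr]
    (h : IsPoissonPointProcess Pr φ ν) {B : Set Plane} (hB : MeasurableSet B) (hν : ν B ≠ ∞)
    (g : ℕ∞ → ℝ) :
    ∫ ω, g (φ ω ∩ B).encard ∂Pr =
      ∑' n : ℕ, Real.exp (-(ν B).toReal) * (ν B).toReal ^ n / n.factorial * g n := by
  have hm := h.measurable_count B hB
  rw [← integral_map (f := g) hm.aemeasurable (Measurable.of_discrete).aestronglyMeasurable,
    h.map_count hB hν, integral_map (Measurable.of_discrete).aemeasurable
      (Measurable.of_discrete).aestronglyMeasurable, integral_poissonMeasure]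
  rfl

theorem IsPoissonPointProcess.lintegral_count [IsProbabilityMeasure Pr]
    (h : IsPoissonPointProcess Pr φ ν) {B : Set Plane} (hB : MeasurableSet B) (hν : ν B ≠ ∞) :
    ∫⁻ ω, ((φ ω ∩ B).encard : ℝ≥0∞) ∂Pr = ν B := by
  have hm := h.measurable_count B hB
  rw [← lintegral_map (f := fun n : ℕ∞ => (n : ℝ≥0∞)) Measurable.of_discrete hm,
    h.map_count hB hν, lintegral_map Measurable.of_discrete Measurable.of_discrete]
  set r : ℝ := (ν B).toReal
  have hr0 : 0 ≤ r := ENNReal.toReal_nonneg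
  have e : ∀ n : ℕ, (poissonMeasure (ν B).toNNReal {n}) * (((n : ℕ∞) : ℝ≥0∞)) =
      ENNReal.ofReal (Real.exp (-r) * r ^ n / n.factorial * n) := by
    intro n
    rw [poissonMeasure_singleton, ENNReal.ofReal_mul (by positivity)]
    simp [r, ENNReal.coe_toNNReal_eq_toReal]
  rw [lintegral_countable']
  simp_rw [mul_comm _ (poissonMeasure _ _), e]
  -- The term `n = 0` vanishes, and `n / n! = 1 / (n - 1)!` turns the rest into `r` times the total
  -- Poisson mass.
  rw [tsum_eq_zero_add' ENNReal.summable]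
  have e2 : ∀ n : ℕ, Real.exp (-r) * r ^ (n + 1) / (n + 1).factorial * ((n + 1 : ℕ) : ℝ) =
      r * (Real.exp (-r) * r ^ n / n.factorial) := by
    intro n
    rw [Nat.factorial_succ]
    push_cast
    field_simp
    ring
  simp_rw [e2]
  have hs : HasSum (fun n : ℕ => r * (Real.exp (-r) * r ^ n / n.factorial)) (r * 1) :=
    (hasSum_one_poissonMeasure (ν B).toNNReal).mul_left r
  rw [← ENNReal.ofReal_tsum_of_nonneg (fun n => by positivity) hs.summable, hs.tsum_eq]
  simp [r, ENNReal.ofReal_toReal hν]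

/-- Mean counts determine the averaged measure on sets of finite intensity; exhausting by balls
extends this to all Borel sets. -/
theorem IsPoissonPointProcess.bind_pointMeasure [IsProbabilityMeasure Pr]
    [IsLocallyFiniteMeasure ν]
    (h : IsPoissonPointProcess Pr φ ν) : Pr.bind (fun ω => pointMeasure (φ ω)) = ν := by
  have hb : ∀ B, MeasurableSet B → ν B ≠ ∞ → Pr.bind (fun ω => pointMeasure (φ ω)) B = ν B := by
    intro B hB hν
    rw [Measure.bind_apply hB h.measurable_pointMeasure.aemeasurable]
    simp_rw [fun ω => pointMeasure_apply (h.locallyFiniteSet ω) hB]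
    exact h.lintegral_count hB hν
  ext B hB
  have hmono : Monotone fun n : ℕ => B ∩ Metric.closedBall 0 (n : ℝ) := fun a b hab =>
    inter_subset_inter_right _ (Metric.closedBall_subset_closedBall (by exact_mod_cast hab))
  have hU : ⋃ n : ℕ, B ∩ Metric.closedBall 0 (n : ℝ) = B := by
    rw [← inter_iUnion, Metric.iUnion_closedBall_nat, inter_univ]
  have t1 := tendsto_measure_iUnion_atTop (μ := ν) hmono
  have t2 := tendsto_measure_iUnion_atTop (μ := Pr.bind (fun ω => pointMeasure (φ ω))) hmono
  rw [hU] at t1 t2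
  refine tendsto_nhds_unique t2 (t1.congr fun n => (hb _ (hB.inter measurableSet_closedBall) ?_).symm)
  exact ((measure_mono inter_subset_right).trans_lt
    (isCompact_closedBall _ _).measure_lt_top).ne

/-- Campbell's formula. -/
theorem IsPoissonPointProcess.lintegral_lintegral [IsProbabilityMeasure Pr]
    [IsLocallyFiniteMeasure ν] (h : IsPoissonPointProcess Pr φ ν) {f : Plane → ℝ≥0∞}
    (hf : Measurable f) : ∫⁻ ω, ∫⁻ z, f z ∂pointMeasure (φ ω) ∂Pr = ∫⁻ z, f z ∂ν := by
  rw [← h.bind_pointMeasure, Measure.lintegral_bind h.measurable_pointMeasure.aemeasurable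
    hf.aemeasurable]

theorem IsPoissonPointProcess.iIndepFun_count
    (h : IsPoissonPointProcess Pr φ ν) {ι : Type*} [Fintype ι] (B : ι → Set Plane)
    (hB : ∀ k, MeasurableSet (B k)) (hd : Pairwise fun k l => Disjoint (B k) (B l)) :
    iIndepFun (fun k ω => (φ ω ∩ B k).encard) Pr := by
  have e := Fintype.equivFin ι
  have := h.indep_counts (Fintype.card ι) (B ∘ e.symm) (fun k => hB _)
    (fun k l hkl => hd (fun hh => hkl (e.symm.injective hh)))
  have h2 := this.precomp e.injective
  simpa [Function.comp_def] using h2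

/-- The level sets of `s` at nonzero values, together with `A` and `C`, are pairwise disjoint, so
their counts are independent and the expectation factorises. Each level contributes the Poisson
transform `E exp (-c N) = exp (-m (1 - exp (-c)))`. -/
theorem IsPoissonPointProcess.laplace_simpleFunc [IsProbabilityMeasure Pr]
    (h : IsPoissonPointProcess Pr φ ν) {A C : Set Plane} (hA : MeasurableSet A)
    (hC : MeasurableSet C) (hAC : Disjoint A C)
    (s : SimpleFunc Plane ℝ≥0∞) (hs : ∀ z, s z ≠ ∞) (hsν : ∫⁻ z, s z ∂ν ≠ ∞)
    (hs0 : ∀ z ∈ A ∪ C, s z = 0) :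
    ∫ ω, (if (φ ω ∩ A).encard = 0 then 1 else 0) * (if (φ ω ∩ C).encard = 1 then 1 else 0) *
        Real.exp (-(∫⁻ z, s z ∂pointMeasure (φ ω)).toReal) ∂Pr =
      Pr.real {ω | (φ ω ∩ A).encard = 0} * Pr.real {ω | (φ ω ∩ C).encard = 1} *
        Real.exp (-(∫⁻ z, ENNReal.ofReal (1 - Real.exp (-(s z).toReal)) ∂ν).toReal) := by
  -- The value `0` is left out: its level set contains `A ∪ C` and may have infinite intensity, but
  -- contributes nothing to the integral.
  let κ : Finset ℝ≥0∞ := s.range.filter (· ≠ 0)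
  have hκr : ∀ c : κ, c.1 ∈ s.range := fun c => (Finset.mem_filter.1 c.2).1
  have hκ0 : ∀ c : κ, c.1 ≠ 0 := fun c => (Finset.mem_filter.1 c.2).2
  have hκt : ∀ c : κ, c.1 ≠ ∞ := by
    intro c
    obtain ⟨z, hz⟩ := SimpleFunc.mem_range.1 (hκr c)
    rw [← hz]; exact hs z
  let B : κ ⊕ Bool → Set Plane := Sum.elim (fun c => s ⁻¹' {c.1}) (fun b => if b then C else A)
  let g : κ ⊕ Bool → ℕ∞ → ℝ := Sum.elim (fun c n => Real.exp (-(c.1 * (n : ℝ≥0∞)).toReal))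
    (fun b n => if n = (if b then 1 else 0) then 1 else 0)
  have hBm : ∀ k, MeasurableSet (B k) := by
    rintro (c | b)
    · exact s.measurableSet_preimage _
    · cases b <;> simpa [B]
  have hκd : ∀ c : κ, Disjoint (s ⁻¹' {c.1}) (A ∪ C) := by
    intro c
    rw [Set.disjoint_left]
    intro z hz hz2
    exact hκ0 c ((show s z = c.1 from hz).symm.trans (hs0 z hz2))
  have hBd : Pairwise fun k l => Disjoint (B k) (B l) := by
    rintro (c | b) (c' | b') hkl
    · refine Disjoint.preimage _ (Set.disjoint_singleton.2 fun hc => hkl ?_)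
      rw [Subtype.ext hc]
    · cases b'
      · exact (hκd c).mono_right subset_union_left
      · exact (hκd c).mono_right subset_union_right
    · cases b
      · exact ((hκd c').mono_right subset_union_left).symm
      · exact ((hκd c').mono_right subset_union_right).symm
    · cases b <;> cases b' <;> simp_all [B, disjoint_comm]
  have hνc : ∀ c : κ, ν (s ⁻¹' {c.1}) ≠ ∞ := by
    intro c hc
    apply hsν
    rw [SimpleFunc.lintegral_eq_lintegral, SimpleFunc.lintegral, ENNReal.sum_eq_top]
    exact ⟨c.1, hκr c, by rw [hc, ENNReal.mul_top (hκ0 c)]⟩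
  have hind := (h.iIndepFun_count B hBm hBd).comp g (fun _ => Measurable.of_discrete)
  have hprod := hind.integral_fun_prod_eq_prod_integral (fun k =>
    (Measurable.of_discrete.comp (h.measurable_count _ (hBm k))).aestronglyMeasurable)
  simp only [Function.comp_def, Fintype.prod_sum_type, Fintype.prod_bool] at hprod
  have hsum : ∀ (G : ℝ≥0∞ → ℝ≥0∞), G 0 = 0 → ∀ m : Measure Plane,
      ∫⁻ z, G (s z) ∂m = ∑ c : κ, G c.1 * m (s ⁻¹' {c.1}) := by
    intro G hG m
    have := SimpleFunc.map_lintegral (μ := m) G s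
    rw [← SimpleFunc.lintegral_eq_lintegral] at this
    simp only [SimpleFunc.coe_map, Function.comp_def] at this
    rw [this, Finset.sum_coe_sort (s.range.filter (· ≠ 0)) (fun c => G c * m (s ⁻¹' {c})),
      Finset.sum_filter]
    refine Finset.sum_congr rfl fun c _ => ?_
    by_cases hc : c = 0
    · simp [hc, hG]
    · simp [hc]
  -- Finite counts are needed to split `toReal` of the sum over levels into a sum of real numbers.
  have hfin : ∀ᵐ ω ∂Pr, ∀ c : κ, (φ ω ∩ s ⁻¹' {c.1}).encard ≠ ⊤ := by
    rw [ae_all_iff]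
    intro c
    have hm := h.measurable_count _ (s.measurableSet_preimage {c.1})
    have := ae_lt_top (f := fun ω => ((φ ω ∩ s ⁻¹' {c.1}).encard : ℝ≥0∞))
      ((Measurable.of_discrete (f := fun n : ℕ∞ => (n : ℝ≥0∞))).comp hm)
      (by rw [h.lintegral_count (s.measurableSet_preimage {c.1}) (hνc c)]; exact hνc c)
    filter_upwards [this] with ω hω
    simpa using hω.ne
  have hL : ∫ ω, (if (φ ω ∩ A).encard = 0 then 1 else 0) *
        (if (φ ω ∩ C).encard = 1 then 1 else 0) *
        Real.exp (-(∫⁻ z, s z ∂pointMeasure (φ ω)).toReal) ∂Pr =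
      ∫ ω, (∏ c : κ, g (Sum.inl c) (φ ω ∩ B (Sum.inl c)).encard) *
        (g (Sum.inr true) (φ ω ∩ B (Sum.inr true)).encard *
          g (Sum.inr false) (φ ω ∩ B (Sum.inr false)).encard) ∂Pr := by
    refine integral_congr_ae ?_
    filter_upwards [hfin] with ω hω
    rw [show ∫⁻ z, s z ∂pointMeasure (φ ω) = _ from hsum id rfl _, ENNReal.toReal_sum, ← Finset.sum_neg_distrib, Real.exp_sum]
    · simp_rw [fun c : κ => pointMeasure_apply (h.locallyFiniteSet ω)
        (s.measurableSet_preimage {c.1})]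
      simp only [g, B, Sum.elim_inl, Sum.elim_inr, id, if_true, Bool.false_eq_true, if_false]
      ring
    · intro c _
      rw [pointMeasure_apply (h.locallyFiniteSet ω) (s.measurableSet_preimage {c.1})]
      exact ENNReal.mul_ne_top (hκt c) (by simpa using hω c)
  rw [hL, hprod]
  have hind1 : ∀ (D : Set Plane) (k : ℕ∞), MeasurableSet D →
      ∫ ω, (if (φ ω ∩ D).encard = k then (1 : ℝ) else 0) ∂Pr =
        Pr.real {ω | (φ ω ∩ D).encard = k} := by
    intro D k hD
    have : (fun ω => if (φ ω ∩ D).encard = k then (1 : ℝ) else 0) =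
        indicator {ω | (φ ω ∩ D).encard = k} 1 := by
      ext ω; simp [indicator_apply]
    rw [this, integral_indicator_one]
    exact h.measurable_count D hD (measurableSet_singleton k)
  have hE : ∀ c : κ, ∫ ω, g (Sum.inl c) (φ ω ∩ B (Sum.inl c)).encard ∂Pr =
      Real.exp (-(ENNReal.ofReal (1 - Real.exp (-c.1.toReal)) * ν (s ⁻¹' {c.1})).toReal) := by
    intro c
    simp only [g, B, Sum.elim_inl]
    rw [h.integral_count (s.measurableSet_preimage {c.1}) (hνc c)
      (fun n => Real.exp (-(c.1 * (n : ℝ≥0∞)).toReal))]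
    have e : ∀ n : ℕ, Real.exp (-(ν (s ⁻¹' {c.1})).toReal) * (ν (s ⁻¹' {c.1})).toReal ^ n /
        n.factorial * Real.exp (-(c.1 * (((n : ℕ∞)) : ℝ≥0∞)).toReal) =
        Real.exp (-(ν (s ⁻¹' {c.1})).toReal) *
        (((ν (s ⁻¹' {c.1})).toReal * Real.exp (-c.1.toReal)) ^ n / n.factorial) := by
      intro n
      rw [mul_pow, ← Real.exp_nat_mul]
      simp only [ENNReal.toReal_mul, ENat.toENNReal_coe, ENNReal.toReal_natCast]
      rw [show -(c.1.toReal * (n : ℝ)) = n * -c.1.toReal by ring]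
      ring
    simp_rw [e]
    have hexp : ∀ x : ℝ, ∑' n : ℕ, x ^ n / n.factorial = Real.exp x := fun x => by
      rw [Real.exp_eq_exp_ℝ, NormedSpace.exp_eq_tsum_div]
    rw [tsum_mul_left, hexp, ← Real.exp_add, ENNReal.toReal_mul, ENNReal.toReal_ofReal]
    · congr 1; ring
    · rw [sub_nonneg, Real.exp_le_one_iff, neg_nonpos]; exact ENNReal.toReal_nonneg
  simp_rw [hE]
  simp only [g, B, Sum.elim_inr, if_true, Bool.false_eq_true, if_false]
  rw [hind1 C 1 hC, hind1 A 0 hA, ← Real.exp_sum,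
    hsum (fun c => ENNReal.ofReal (1 - Real.exp (-c.toReal))) (by simp),
    ENNReal.toReal_sum (fun c _ => ENNReal.mul_ne_top ENNReal.ofReal_ne_top (hνc c)),
    ← Finset.sum_neg_distrib]
  ring

/-- The Laplace functional of a Poisson process, jointly with the events that a set is empty and
that another one has exactly one point. -/
theorem IsPoissonPointProcess.laplace [IsProbabilityMeasure Pr] [IsLocallyFiniteMeasure ν]
    (h : IsPoissonPointProcess Pr φ ν) {A C : Set Plane} (hA : MeasurableSet A)
    (hC : MeasurableSet C) (hAC : Disjoint A C)
    {f : Plane → ℝ≥0∞} (hf : Measurable f) (hft : ∀ z, f z ≠ ∞) (hfν : ∫⁻ z, f z ∂ν ≠ ∞)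
    (hf0 : ∀ z ∈ A ∪ C, f z = 0) :
    ∫ ω, (if (φ ω ∩ A).encard = 0 then 1 else 0) * (if (φ ω ∩ C).encard = 1 then 1 else 0) *
        Real.exp (-(∫⁻ z, f z ∂pointMeasure (φ ω)).toReal) ∂Pr =
      Pr.real {ω | (φ ω ∩ A).encard = 0} * Pr.real {ω | (φ ω ∩ C).encard = 1} *
        Real.exp (-(∫⁻ z, ENNReal.ofReal (1 - Real.exp (-(f z).toReal)) ∂ν).toReal) := by
  have hle : ∀ n z, SimpleFunc.eapprox f n z ≤ f z := fun n z => by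
    rw [← SimpleFunc.iSup_eapprox_apply hf z]
    exact le_iSup (fun n => SimpleFunc.eapprox f n z) n
  have hmono : ∀ z, Monotone fun n => SimpleFunc.eapprox f n z :=
    fun z a b hab => SimpleFunc.monotone_eapprox f hab z
  have htend : ∀ z, Tendsto (fun n => SimpleFunc.eapprox f n z) atTop (𝓝 (f z)) := fun z => by
    have := tendsto_atTop_iSup (hmono z)
    rwa [SimpleFunc.iSup_eapprox_apply hf z] at this
  -- Simple functions below `f` inherit its vanishing on `A ∪ C` and its finite intensity integral.
  -- The left side then passes to the limit by dominated convergence, the exponent on the right by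
  -- monotone convergence.
  have key : ∀ n, _ := fun n => h.laplace_simpleFunc hA hC hAC (SimpleFunc.eapprox f n)
    (fun z => ((hle n z).trans_lt (hft z).lt_top).ne)
    ((lintegral_mono (hle n)).trans_lt hfν.lt_top).ne
    (fun z hz => le_antisymm ((hle n z).trans_eq (hf0 z hz)) zero_le)
  have hfin : ∀ᵐ ω ∂Pr, ∫⁻ z, f z ∂pointMeasure (φ ω) < ∞ :=
    ae_lt_top ((Measure.measurable_lintegral hf).comp h.measurable_pointMeasure)
      (by rw [h.lintegral_lintegral hf]; exact hfν)
  have hmind : ∀ (D : Set Plane) (k : ℕ∞), MeasurableSet D →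
      Measurable fun ω => (if (φ ω ∩ D).encard = k then (1 : ℝ) else 0) := fun D k hD =>
    Measurable.ite (h.measurable_count D hD (measurableSet_singleton k)) measurable_const
      measurable_const
  have hnorm : ∀ (p q : Prop) [Decidable p] [Decidable q] (x : ℝ≥0∞),
      ‖(if p then (1 : ℝ) else 0) * (if q then (1 : ℝ) else 0) * Real.exp (-x.toReal)‖ ≤ 1 := by
    intro p q _ _ x
    have : Real.exp (-x.toReal) ≤ 1 :=
      Real.exp_le_one_iff.2 (neg_nonpos.2 ENNReal.toReal_nonneg)
    have h0 := Real.exp_pos (-x.toReal)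
    split_ifs <;> simp [this]
  have hLt := tendsto_integral_of_dominated_convergence (μ := Pr)
    (F := fun n ω => (if (φ ω ∩ A).encard = 0 then (1 : ℝ) else 0) *
      (if (φ ω ∩ C).encard = 1 then (1 : ℝ) else 0) *
        Real.exp (-(∫⁻ z, SimpleFunc.eapprox f n z ∂pointMeasure (φ ω)).toReal))
    (f := fun ω => (if (φ ω ∩ A).encard = 0 then (1 : ℝ) else 0) *
      (if (φ ω ∩ C).encard = 1 then (1 : ℝ) else 0) *
        Real.exp (-(∫⁻ z, f z ∂pointMeasure (φ ω)).toReal)) (fun _ => 1)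
    (fun n => (((hmind A 0 hA).mul (hmind C 1 hC)).mul (Real.measurable_exp.comp
      ((Measure.measurable_lintegral (SimpleFunc.eapprox f n).measurable).comp
        h.measurable_pointMeasure).ennreal_toReal.neg)).aestronglyMeasurable)
    (integrable_const _) (fun n => ae_of_all _ fun ω => hnorm _ _ _) (by
      filter_upwards [hfin] with ω hω
      refine Tendsto.const_mul _ ((Real.continuous_exp.tendsto _).comp (Tendsto.neg ?_))
      refine (ENNReal.tendsto_toReal hω.ne).comp ?_
      exact lintegral_tendsto_of_tendsto_of_monotone
        (fun n => (SimpleFunc.eapprox f n).measurable.aemeasurable)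
        (ae_of_all _ hmono) (ae_of_all _ htend))
  refine tendsto_nhds_unique (hLt.congr key) (Tendsto.const_mul _
    ((Real.continuous_exp.tendsto _).comp (Tendsto.neg ((ENNReal.tendsto_toReal ?_).comp
      (lintegral_tendsto_of_tendsto_of_monotone (fun n => ?_) (ae_of_all _ fun z => ?_)
        (ae_of_all _ fun z => ?_))))))
  -- The limiting exponent is finite because `1 - exp (-t) ≤ t`.
  · refine ((lintegral_mono fun z => ?_).trans_lt hfν.lt_top).ne
    refine ENNReal.ofReal_le_of_le_toReal ?_
    linarith [Real.add_one_le_exp (-(f z).toReal)]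
  · exact (measurable_const.sub (Real.measurable_exp.comp
      (SimpleFunc.eapprox f n).measurable.ennreal_toReal.neg)).ennreal_ofReal.aemeasurable
  · intro a b hab
    refine ENNReal.ofReal_le_ofReal (sub_le_sub_left (Real.exp_le_exp.2 (neg_le_neg ?_)) _)
    exact ENNReal.toReal_mono ((hle b z).trans_lt (hft z).lt_top).ne (hmono z hab)
  · refine ENNReal.tendsto_ofReal (Tendsto.const_sub _ ((Real.continuous_exp.tendsto _).comp
      (Tendsto.neg ((ENNReal.tendsto_toReal (hft z)).comp (htend z)))))

end Poisson

/-! ### Ordered distances to the origin -/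

section NthDist

variable {S : Set Plane}

theorem tendsto_pointMeasure_closedBall (S : Set Plane) :
    Tendsto (fun n : ℕ => pointMeasure S (Metric.closedBall 0 n)) atTop
      (𝓝 (pointMeasure S univ)) := by
  have hmono : Monotone fun n : ℕ => Metric.closedBall (0 : Plane) (n : ℝ) := fun a b hab =>
    Metric.closedBall_subset_closedBall (by exact_mod_cast hab)
  have := tendsto_measure_iUnion_atTop (μ := pointMeasure S) hmono
  rwa [Metric.iUnion_closedBall_nat] at this

theorem pointMeasure_closedBall (hS : LocallyFiniteSet S) (r : ℝ) :
    pointMeasure S (Metric.closedBall 0 r) = ((S ∩ Metric.closedBall 0 r).encard : ℝ≥0∞) :=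
  pointMeasure_apply hS measurableSet_closedBall

theorem pointMeasure_closedBall_lt_top (hS : LocallyFiniteSet S) (r : ℝ) :
    pointMeasure S (Metric.closedBall 0 r) < ∞ := by
  rw [pointMeasure_closedBall hS]
  simpa using (hS r).encard_lt_top

/-- The infimum defining `nthDist` is over a nonempty set, by continuity from below of the counting
measure along growing balls. -/
theorem exists_le_encard_closedBall (hS : LocallyFiniteSet S) {n : ℕ} (hn : (n : ℕ∞) ≤ S.encard) :
    ∃ r : ℝ, 0 ≤ r ∧ (n : ℕ∞) ≤ (S ∩ Metric.closedBall 0 r).encard := by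
  rcases Nat.eq_zero_or_pos n with rfl | hpos
  · exact ⟨0, le_rfl, by simp⟩
  -- A strict bound by `n - 1` is an open condition, so it already holds for some ball; for integer
  -- counts it means at least `n`.
  have h1 : ((n - 1 : ℕ) : ℝ≥0∞) < pointMeasure S univ := by
    rw [pointMeasure_apply hS MeasurableSet.univ, inter_univ]
    have : ((n - 1 : ℕ) : ℕ∞) < S.encard := lt_of_lt_of_le (by exact_mod_cast (by omega)) hn
    exact_mod_cast ENat.toENNReal_lt.2 this
  obtain ⟨k, hk⟩ := ((tendsto_pointMeasure_closedBall S).eventually_const_lt h1).exists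
  refine ⟨k, k.cast_nonneg, ?_⟩
  rw [pointMeasure_closedBall hS] at hk
  have hk' : ((n - 1 : ℕ) : ℕ∞) < (S ∩ Metric.closedBall 0 (k : ℝ)).encard := by
    rw [← ENat.toENNReal_lt]; exact_mod_cast hk
  have := Order.add_one_le_of_lt hk'
  refine le_trans (le_of_eq ?_) this
  exact_mod_cast (by omega : n = n - 1 + 1)

theorem nthDist_nonneg (S : Set Plane) (j : ℕ) : 0 ≤ nthDist S j :=
  Real.sInf_nonneg fun _ hr => hr.1

/-- The infimum is attained: closed balls of radius decreasing to `r` intersect in the ball of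
radius `r`, and their counts are finite, so continuity from above applies. -/
theorem nthDist_le_iff (hS : LocallyFiniteSet S) {j : ℕ} (hj : ((j + 1 : ℕ) : ℕ∞) ≤ S.encard)
    {r : ℝ} (hr : 0 ≤ r) :
    nthDist S j ≤ r ↔ ((j + 1 : ℕ) : ℕ∞) ≤ (S ∩ Metric.closedBall 0 r).encard := by
  constructor
  · intro h
    have hlt : ∀ n : ℕ, ((j + 1 : ℕ) : ℝ≥0∞) ≤
        pointMeasure S (Metric.closedBall 0 (r + 1 / ((n : ℝ) + 1))) := by
      intro n
      have hpos : (0 : ℝ) < 1 / ((n : ℝ) + 1) := by positivity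
      obtain ⟨r', ⟨_, hr'⟩, hlt⟩ := exists_lt_of_csInf_lt (exists_le_encard_closedBall hS hj)
        (lt_of_le_of_lt h (lt_add_of_pos_right r hpos))
      rw [pointMeasure_closedBall hS]
      have h3 := hr'.trans (encard_le_encard (inter_subset_inter_right S
        (Metric.closedBall_subset_closedBall hlt.le)))
      exact_mod_cast ENat.toENNReal_le.2 h3
    have hanti : Antitone fun n : ℕ => Metric.closedBall (0 : Plane) (r + 1 / ((n : ℝ) + 1)) :=
      fun a b hab => Metric.closedBall_subset_closedBall
        (add_le_add_right (Nat.one_div_le_one_div hab) r)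
    have hI : ⋂ n : ℕ, Metric.closedBall (0 : Plane) (r + 1 / ((n : ℝ) + 1)) =
        Metric.closedBall 0 r := by
      ext z
      simp only [mem_iInter, Metric.mem_closedBall]
      refine ⟨fun hz => ?_, fun hz n => hz.trans (le_add_of_nonneg_right (by positivity))⟩
      have := tendsto_one_div_add_atTop_nhds_zero_nat (𝕜 := ℝ)
      have h2 := this.const_add r
      rw [add_zero] at h2
      exact ge_of_tendsto' h2 hz
    have ht := tendsto_measure_iInter_atTop (μ := pointMeasure S)
      (fun n : ℕ => (measurableSet_closedBall (x := (0 : Plane))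
        (ε := r + 1 / ((n : ℝ) + 1))).nullMeasurableSet) hanti
      ⟨0, (pointMeasure_closedBall_lt_top hS _).ne⟩
    rw [hI] at ht
    have := ge_of_tendsto' ht hlt
    rw [pointMeasure_closedBall hS] at this
    rw [← ENat.toENNReal_le]
    exact_mod_cast this
  · intro h
    exact csInf_le ⟨0, fun _ h => h.1⟩ ⟨hr, h⟩

theorem nthDist_mono (hS : LocallyFiniteSet S) (hi : S.encard = ⊤) : Monotone (nthDist S) := by
  intro a b hab
  have h1 := (nthDist_le_iff hS (j := b) (by simp [hi]) (nthDist_nonneg S b)).1 le_rfl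
  exact (nthDist_le_iff hS (by simp [hi]) (nthDist_nonneg S b)).2
    (le_trans (by exact_mod_cast (by omega)) h1)

/-- Both measures give `Iic r` the number of points within distance `r`, and these numbers are
finite. This turns sums over points into sums over ranks, with multiplicity when several points are
equidistant. -/
theorem map_norm_pointMeasure (hS : LocallyFiniteSet S) (hi : S.encard = ⊤) :
    (pointMeasure S).map norm = Measure.sum fun j => Measure.dirac (nthDist S j) := by
  have hL : ∀ r : ℝ, (pointMeasure S).map norm (Iic r) = pointMeasure S (Metric.closedBall 0 r) := by
    intro r
    rw [Measure.map_apply measurable_norm measurableSet_Iic]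
    congr 1
    ext z; simp
  have hR : ∀ r : ℝ, (Measure.sum fun j => Measure.dirac (nthDist S j)) (Iic r) =
      pointMeasure S (Metric.closedBall 0 r) := by
    intro r
    rw [Measure.sum_apply _ measurableSet_Iic]
    rcases lt_or_ge r 0 with hr | hr
    · rw [Metric.closedBall_eq_empty.2 hr, measure_empty, ENNReal.tsum_eq_zero]
      intro j
      rw [Measure.dirac_apply' _ measurableSet_Iic, indicator_of_notMem]
      exact fun h => absurd (lt_of_le_of_lt h hr) (not_lt.2 (nthDist_nonneg S j))
    · rw [pointMeasure_closedBall hS]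
      obtain ⟨N, hN⟩ := ENat.ne_top_iff_exists.1 (hS r).encard_lt_top.ne
      rw [← hN]
      have : ∀ j, Measure.dirac (nthDist S j) (Iic r) = if j < N then (1 : ℝ≥0∞) else 0 := by
        intro j
        rw [Measure.dirac_apply' _ measurableSet_Iic, indicator_apply]
        refine if_congr ?_ rfl rfl
        rw [mem_Iic, nthDist_le_iff hS (by simp [hi]) hr, ← hN]
        exact_mod_cast Nat.succ_le_iff
      simp_rw [this]
      rw [tsum_eq_sum (s := Finset.range N) (by intro j hj; simpa using hj)]
      rw [Finset.sum_congr rfl (fun j hj => if_pos (Finset.mem_range.1 hj))]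
      simp
  have hfin : ∀ r : ℝ, (pointMeasure S).map norm (Iic r) < ∞ := fun r => by
    rw [hL]; exact pointMeasure_closedBall_lt_top hS r
  have : IsLocallyFiniteMeasure ((pointMeasure S).map norm) :=
    ⟨fun x => ⟨Iic (x + 1), Iic_mem_nhds (by linarith), hfin _⟩⟩
  refine Measure.ext_of_Ioc _ _ fun a b hab => ?_
  rw [← Iic_sdiff_Iic, measure_sdiff (Iic_subset_Iic.2 hab.le)
    measurableSet_Iic.nullMeasurableSet (hfin a).ne, measure_sdiff (Iic_subset_Iic.2 hab.le)
    measurableSet_Iic.nullMeasurableSet (by rw [hR, ← hL]; exact (hfin a).ne), hL, hL, hR, hR]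

theorem lintegral_norm_pointMeasure (hS : LocallyFiniteSet S) (hi : S.encard = ⊤) {f : ℝ → ℝ≥0∞}
    (hf : Measurable f) : ∫⁻ z, f ‖z‖ ∂pointMeasure S = ∑' j, f (nthDist S j) := by
  rw [← lintegral_map hf measurable_norm, map_norm_pointMeasure hS hi, lintegral_sum_measure]
  simp [lintegral_dirac' _ hf]

end NthDist

theorem measurable_nthDist_pointSigma {Ω : Type*} {φ : Ω → Set Plane}
    (hφ : ∀ ω, LocallyFiniteSet (φ ω)) (j : ℕ) :
    Measurable[pointSigma φ] fun ω => nthDist (φ ω) j := by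
  let : MeasurableSpace Ω := pointSigma φ
  refine measurable_of_Iic fun r => ?_
  rcases lt_or_ge r 0 with hr | hr
  · convert @MeasurableSet.empty _ (pointSigma φ)
    ext ω
    simpa using hr.trans_le (nthDist_nonneg (φ ω) j)
  -- The second set accounts for configurations with fewer than `j + 1` points, where the infimum of
  -- the empty set takes its default value `0`.
  · have e : (fun ω => nthDist (φ ω) j) ⁻¹' Iic r =
        (fun ω => (φ ω ∩ Metric.closedBall 0 r).encard) ⁻¹' Ici ((j + 1 : ℕ) : ℕ∞) ∪
        (fun ω => (φ ω ∩ univ).encard) ⁻¹' Iio ((j + 1 : ℕ) : ℕ∞) := by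
      ext ω
      simp only [mem_preimage, mem_Iic, mem_union, mem_Ici, mem_Iio, inter_univ]
      rcases lt_or_ge (φ ω).encard ((j + 1 : ℕ) : ℕ∞) with h | h
      · refine iff_of_true ?_ (Or.inr h)
        have : {r : ℝ | 0 ≤ r ∧ ((j + 1 : ℕ) : ℕ∞) ≤ (φ ω ∩ Metric.closedBall 0 r).encard} = ∅ := by
          ext r
          simp only [mem_ofPred_eq, mem_empty_iff_false, iff_false, not_and, not_le]
          exact fun _ => (encard_le_encard inter_subset_left).trans_lt h
        rw [nthDist, this, Real.sInf_empty]
        exact hr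
      · rw [nthDist_le_iff (hφ ω) h hr]
        exact ⟨Or.inl, fun hh => hh.resolve_right (not_lt.2 h)⟩
    rw [e]
    exact (measurable_encard_pointSigma φ measurableSet_closedBall .of_discrete).union
      (measurable_encard_pointSigma φ MeasurableSet.univ .of_discrete)

/-! ### Homogeneous processes: infinitely many points, summable path losses -/

/-- The intensity measure of a homogeneous point process. -/
noncomputable abbrev homIntensity (lam : ℝ) : Measure Plane := ENNReal.ofReal lam • volume

instance (lam : ℝ) : IsLocallyFiniteMeasure (homIntensity lam) :=
  ⟨fun x => ⟨Metric.closedBall x 1, Metric.closedBall_mem_nhds x one_pos, by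
    rw [homIntensity, Measure.smul_apply, smul_eq_mul]
    exact ENNReal.mul_lt_top ENNReal.ofReal_lt_top
      (isCompact_closedBall x 1).measure_lt_top⟩⟩

theorem homIntensity_closedBall {lam : ℝ} (hlam : 0 ≤ lam) {r : ℝ} (hr : 0 ≤ r) :
    homIntensity lam (Metric.closedBall 0 r) = ENNReal.ofReal (Real.pi * lam * r ^ 2) := by
  rw [homIntensity, Measure.smul_apply, smul_eq_mul, EuclideanSpace.volume_closedBall_fin_two,
    ← ENNReal.ofReal_pow hr, ← ENNReal.ofReal_mul (by positivity), ← ENNReal.ofReal_mul hlam]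
  congr 1; ring

section Homogeneous

variable {Ω : Type*} [MeasurableSpace Ω] {Pr : Measure Ω} {φ : Ω → Set Plane} {lam : ℝ}

/-- If the total count is `m`, then all large balls contain exactly `m` points, and the Poisson
probability of that tends to zero as the ball grows. -/
theorem IsPoissonPointProcess.ae_infinite (hlam : 0 < lam)
    (h : IsPoissonPointProcess Pr φ (homIntensity lam)) : ∀ᵐ ω ∂Pr, (φ ω).encard = ⊤ := by
  have key : ∀ m : ℕ, ∀ᵐ ω ∂Pr, (φ ω).encard ≠ m := by
    intro m
    have hlim : Tendsto (fun n : ℕ => Pr {ω | (φ ω ∩ Metric.closedBall 0 (n : ℝ)).encard = m})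
        atTop (𝓝 0) := by
      have e : ∀ n : ℕ, Pr {ω | (φ ω ∩ Metric.closedBall 0 (n : ℝ)).encard = m} =
          ENNReal.ofReal ((Real.pi * lam * (n : ℝ) ^ 2) ^ m *
            Real.exp (-(Real.pi * lam * (n : ℝ) ^ 2)) / m.factorial) := by
        intro n
        have hb := homIntensity_closedBall hlam.le (r := n) n.cast_nonneg
        rw [h.poisson_count _ measurableSet_closedBall (by rw [hb]; exact ENNReal.ofReal_ne_top),
          poissonMeasure_singleton, hb]
        have hp : 0 ≤ Real.pi * lam * (n : ℝ) ^ 2 := by positivity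
        congr 1
        rw [ENNReal.ofReal, ENNReal.toNNReal_coe, Real.coe_toNNReal _ hp]
        ring
      simp_rw [e]
      rw [← ENNReal.ofReal_zero]
      refine ENNReal.tendsto_ofReal ?_
      have t1 : Tendsto (fun n : ℕ => Real.pi * lam * (n : ℝ) ^ 2) atTop atTop := by
        refine Tendsto.const_mul_atTop (by positivity) ?_
        exact (tendsto_pow_atTop two_ne_zero).comp tendsto_natCast_atTop_atTop
      have t2 := ((Real.tendsto_pow_mul_exp_neg_atTop_nhds_zero m).comp t1).div_const
        (m.factorial : ℝ)
      rw [zero_div] at t2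
      exact t2
    have hsub : {ω | (φ ω).encard = m} ⊆
        ⋃ k : ℕ, ⋂ n ≥ k, {ω | (φ ω ∩ Metric.closedBall 0 (n : ℝ)).encard = m} := by
      intro ω hω
      obtain ⟨r, hr0, hr⟩ := exists_le_encard_closedBall (h.locallyFiniteSet ω)
        (n := m) (le_of_eq (Eq.symm hω))
      obtain ⟨k, hk⟩ := exists_nat_ge r
      refine mem_iUnion.2 ⟨k, mem_iInter₂.2 fun n hn => le_antisymm ?_ ?_⟩
      · exact (encard_le_encard inter_subset_left).trans_eq hω
      · exact hr.trans (encard_le_encard (inter_subset_inter_right _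
          (Metric.closedBall_subset_closedBall (hk.trans (by exact_mod_cast hn)))))
    have hz : Pr {ω | (φ ω).encard = m} = 0 := by
      refine measure_mono_null hsub (measure_iUnion_null fun k => ?_)
      refine le_antisymm (ge_of_tendsto hlim ?_) zero_le
      filter_upwards [eventually_ge_atTop k] with n hn
      exact measure_mono (iInter₂_subset n hn)
    rw [ae_iff]
    simpa using hz
  filter_upwards [ae_all_iff.2 key] with ω hω
  by_contra hne
  obtain ⟨m, hm⟩ := ENat.ne_top_iff_exists.1 hne
  exact hω m hm.symm

variable [IsProbabilityMeasure Pr]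

theorem IsPoissonPointProcess.ae_nthDist_pos (hlam : 0 < lam)
    (h : IsPoissonPointProcess Pr φ (homIntensity lam)) : ∀ᵐ ω ∂Pr, 0 < nthDist (φ ω) 0 := by
  have hb : homIntensity lam (Metric.closedBall 0 0) = 0 := by
    rw [homIntensity_closedBall hlam.le le_rfl]; simp
  have h0 := h.lintegral_count (B := Metric.closedBall 0 0) measurableSet_closedBall (by simp)
  have hm : Measurable fun ω => ((φ ω ∩ Metric.closedBall 0 0).encard : ℝ≥0∞) :=
    (Measurable.of_discrete (f := fun n : ℕ∞ => (n : ℝ≥0∞))).comp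
      (h.measurable_count _ measurableSet_closedBall)
  rw [hb, lintegral_eq_zero_iff hm] at h0
  filter_upwards [h0, h.ae_infinite hlam] with ω hω hinf
  by_contra hn
  rw [not_lt, nthDist_le_iff (h.locallyFiniteSet ω) (by simp [hinf]) le_rfl] at hn
  have : (φ ω ∩ Metric.closedBall 0 0).encard = 0 := by simpa using hω
  rw [this] at hn
  simp at hn

/-- The exponent exceeds the dimension of the plane. The shift by `1` removes the singularity at the
origin, where `‖z‖ ^ (-α)` is not integrable. -/
theorem lintegral_one_add_norm_homIntensity {α : ℝ} (hα : 2 < α) :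
    ∫⁻ z, ENNReal.ofReal ((1 + ‖z‖) ^ (-α)) ∂homIntensity lam < ∞ := by
  rw [lintegral_smul_measure, smul_eq_mul]
  refine ENNReal.mul_lt_top ENNReal.ofReal_lt_top ?_
  exact (integrable_one_add_norm (E := Plane) (μ := volume) (r := α)
    (by simpa using hα)).lintegral_lt_top

/-- Almost surely, the path losses `(1 + r_k)^{-α}` have a finite sum; moreover the expectation
of the sum is finite. -/
theorem IsPoissonPointProcess.lintegral_tsum_one_add_nthDist {α : ℝ} (hα : 2 < α) (hlam : 0 < lam)
    (h : IsPoissonPointProcess Pr φ (homIntensity lam)) :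
    ∫⁻ ω, ∑' k, ENNReal.ofReal ((1 + nthDist (φ ω) k) ^ (-α)) ∂Pr < ∞ := by
  have hm : Measurable fun r : ℝ => ENNReal.ofReal ((1 + r) ^ (-α)) := by fun_prop
  refine lt_of_eq_of_lt ?_ (lintegral_one_add_norm_homIntensity (lam := lam) hα)
  refine Eq.trans ?_ (h.lintegral_lintegral (hm.comp measurable_norm))
  refine lintegral_congr_ae ?_
  filter_upwards [h.ae_infinite hlam] with ω hω
  exact (lintegral_norm_pointMeasure (h.locallyFiniteSet ω) hω hm).symm

/-- Undoes the shift by `1`: since `r₀ ≤ r_k`, one has `1 / r_k ≤ (1 + 1 / r₀) / (1 + r_k)`. -/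
theorem summable_of_one_add {r : ℕ → ℝ} {α : ℝ} (hα : 0 ≤ α) (h0 : 0 < r 0) (hr : Monotone r)
    {a : ℕ → ℝ} (ha : ∀ k, 0 ≤ a k) (hs : Summable fun k => a k * (1 + r k) ^ (-α)) :
    Summable fun k => a k * r k ^ (-α) := by
  refine Summable.of_nonneg_of_le (fun k => ?_) (fun k => ?_) (hs.mul_left ((1 + 1 / r 0) ^ α))
  · exact mul_nonneg (ha k) (Real.rpow_nonneg (h0.le.trans (hr (zero_le))) _)
  · have hk : r 0 ≤ r k := hr zero_le
    have hk0 : 0 < r k := h0.trans_le hk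
    rw [mul_left_comm]
    refine mul_le_mul_of_nonneg_left ?_ (ha k)
    rw [Real.rpow_neg hk0.le, Real.rpow_neg (by positivity), ← div_eq_mul_inv,
      ← Real.div_rpow (by positivity) (by positivity), ← Real.inv_rpow hk0.le]
    refine Real.rpow_le_rpow (by positivity) ?_ hα
    rw [le_div_iff₀ (by positivity)]
    have : r 0 * (1 / r 0) = 1 := by field_simp
    have h2 : (r k)⁻¹ * r k = 1 := inv_mul_cancel₀ hk0.ne'
    have h3 : (r k)⁻¹ ≤ 1 / r 0 := by rw [one_div]; exact inv_anti₀ h0 hk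
    nlinarith

theorem IsPoissonPointProcess.ae_summable_nthDist {α : ℝ} (hα : 2 < α) (hlam : 0 < lam)
    (h : IsPoissonPointProcess Pr φ (homIntensity lam)) :
    ∀ᵐ ω ∂Pr, Summable fun k => nthDist (φ ω) k ^ (-α) := by
  have hm : Measurable fun ω => ∑' k, ENNReal.ofReal ((1 + nthDist (φ ω) k) ^ (-α)) := by
    refine Measurable.tsum fun k => ?_
    have := (measurable_nthDist_pointSigma h.locallyFiniteSet k).mono h.pointSigma_le le_rfl
    fun_prop
  filter_upwards [ae_lt_top hm (h.lintegral_tsum_one_add_nthDist hα hlam).ne,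
    h.ae_infinite hlam, h.ae_nthDist_pos hlam] with ω hω hinf hpos
  have hs := ENNReal.summable_toReal hω.ne
  have : Summable fun k => (1 : ℝ) * (1 + nthDist (φ ω) k) ^ (-α) := by
    refine hs.congr fun k => ?_
    rw [ENNReal.toReal_ofReal, one_mul]
    have := nthDist_nonneg (φ ω) k
    positivity
  simpa using summable_of_one_add (by linarith) hpos
    (nthDist_mono (h.locallyFiniteSet ω) hinf) (fun _ => zero_le_one) this

end Homogeneous

/-! ### The Laplace exponent of the far points -/

theorem phi_nonneg {α y x : ℝ} (hy : 0 ≤ y) (hx : 0 ≤ x) : 0 ≤ phi α y x := by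
  refine setIntegral_nonneg measurableSet_Ici fun u hu => ?_
  have hu0 : 0 ≤ u := (Real.rpow_nonneg hy _).trans hu
  positivity

/-- The interference exponent of the points beyond distance `b / x`, when `b` is the distance to
the nearest point. -/
noncomputable def farLog (α y x b r : ℝ) : ℝ :=
  if b / x < r then Real.log (1 + y * (b / r) ^ α) else 0

section Analytic

variable {α y x b : ℝ}

theorem measurable_farLog (α y x b : ℝ) : Measurable (farLog α y x b) := by
  unfold farLog
  refine Measurable.ite (measurableSet_lt measurable_const measurable_id) ?_ measurable_const
  fun_prop

theorem farLog_nonneg (hy : 0 ≤ y) (hb : 0 < b) (hx : 0 < x) (r : ℝ) :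
    0 ≤ farLog α y x b r := by
  unfold farLog
  split_ifs with h
  · have : 0 < r := (div_pos hb hx).trans h
    exact Real.log_nonneg (le_add_of_nonneg_right (by positivity))
  · exact le_rfl

/-- Combines `log (1 + t) ≤ t` with `1 / r ≤ (1 + x / b) / (1 + r)`, valid beyond `b / x`, to get an
integrable majorant. -/
theorem farLog_le (hα : 2 < α) (hy : 0 ≤ y) (hb : 0 < b) (hx : 0 < x) {r : ℝ} (hr : 0 ≤ r) :
    farLog α y x b r ≤ y * b ^ α * (1 + x / b) ^ α * (1 + r) ^ (-α) := by
  unfold farLog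
  split_ifs with h
  · have hr0 : 0 < r := (div_pos hb hx).trans h
    have h1 : Real.log (1 + y * (b / r) ^ α) ≤ y * (b / r) ^ α := by
      have := Real.log_le_sub_one_of_pos (show 0 < 1 + y * (b / r) ^ α by positivity)
      linarith
    refine h1.trans ?_
    rw [mul_assoc, mul_assoc]
    refine mul_le_mul_of_nonneg_left ?_ hy
    rw [Real.rpow_neg (by positivity), ← div_eq_mul_inv, ← Real.div_rpow (by positivity)
      (by positivity), ← Real.mul_rpow hb.le (by positivity)]
    refine Real.rpow_le_rpow (by positivity) ?_ (by linarith)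
    rw [div_eq_mul_inv]
    refine mul_le_mul_of_nonneg_left ?_ hb.le
    rw [inv_eq_one_div, div_le_div_iff₀ hr0 (by positivity)]
    have : b < x * r := by rwa [div_lt_iff₀' hx] at h
    have : 1 ≤ x / b * r := by
      rw [div_mul_eq_mul_div, le_div_iff₀ hb]; linarith
    linarith
  · positivity

theorem one_sub_exp_neg_farLog (hy : 0 ≤ y) (hb : 0 < b) (hx : 0 < x) (r : ℝ) :
    1 - Real.exp (-farLog α y x b r) =
      if b / x < r then 1 - 1 / (1 + y * (b / r) ^ α) else 0 := by
  unfold farLog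
  split_ifs with h
  · have : 0 < r := (div_pos hb hx).trans h
    rw [Real.exp_neg, Real.exp_log (by positivity), one_div]
  · simp

theorem integral_radial_eq_phi (hα : 2 < α) (hy : 0 < y) (hb : 0 < b) (hx : 0 < x) :
    ∫ r in Ioi (0 : ℝ), r * (if b / x < r then 1 - 1 / (1 + y * (b / r) ^ α) else 0) =
      b ^ 2 * y ^ (2 / α) / (2 * x ^ 2) * phi α y x := by
  have hα0 : 0 < α := by linarith
  -- The substitution is `u = c r²`: this `c` sends `r = b / x` to `y ^ (-2/α)` and makes `x ^ (-α)
  -- u ^ (α/2)` the inverse of `y (b / r) ^ α`.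
  set c : ℝ := x ^ 2 / (b ^ 2 * y ^ (2 / α)) with hc
  have hyα : 0 < y ^ (2 / α) := Real.rpow_pos_of_pos hy _
  have hc0 : 0 < c := by positivity
  set L : ℝ := y ^ (-2 / α) with hLdef
  have hL0 : 0 < L := Real.rpow_pos_of_pos hy _
  have hLy : L = (y ^ (2 / α))⁻¹ := by rw [hLdef, neg_div, Real.rpow_neg hy.le]
  let G : ℝ → ℝ := indicator (Ioi L) fun u => 1 / (1 + x ^ (-α) * u ^ (α / 2))
  have h1 : ∀ r ∈ Ioi (0 : ℝ), r * (if b / x < r then 1 - 1 / (1 + y * (b / r) ^ α) else 0) =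
      (1 / 2) * ((|2| * r ^ ((2 : ℝ) - 1)) • G (c * r ^ (2 : ℝ))) := by
    intro r hr
    have hr0 : 0 < r := hr
    have e1 : r ^ ((2 : ℝ) - 1) = r := by norm_num
    have e2 : r ^ (2 : ℝ) = r ^ 2 := by norm_cast
    have hiff : b / x < r ↔ L < c * r ^ 2 := by
      rw [hLy, hc, div_lt_iff₀ hx, div_mul_eq_mul_div, lt_div_iff₀ (by positivity)]
      rw [show (y ^ (2 / α))⁻¹ * (b ^ 2 * y ^ (2 / α)) = b ^ 2 by field_simp]
      rw [show x ^ 2 * r ^ 2 = (r * x) ^ 2 by ring]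
      exact (pow_lt_pow_iff_left₀ hb.le (by positivity) two_ne_zero).symm
    rw [e1, e2]
    simp only [G, indicator_apply, mem_Ioi, hiff, abs_two, smul_eq_mul]
    split_ifs with h
    · have hp : x ^ (-α) * (c * r ^ 2) ^ (α / 2) = (y * (b / r) ^ α)⁻¹ := by
        have hcr : c * r ^ 2 = (x * r / b) ^ 2 * (y ^ (2 / α))⁻¹ := by
          rw [hc]; field_simp
        rw [hcr, Real.mul_rpow (by positivity) (by positivity), Real.inv_rpow hyα.le,
          ← Real.rpow_mul hy.le, show 2 / α * (α / 2) = 1 by field_simp, Real.rpow_one,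
          ← Real.rpow_natCast (x * r / b) 2, ← Real.rpow_mul (by positivity),
          show ((2 : ℕ) : ℝ) * (α / 2) = α by push_cast; ring,
          Real.div_rpow (by positivity) hb.le, Real.mul_rpow hx.le hr0.le,
          Real.rpow_neg hx.le, Real.div_rpow hb.le hr0.le]
        have := (Real.rpow_pos_of_pos hx α).ne'
        have := (Real.rpow_pos_of_pos hb α).ne'
        have := (Real.rpow_pos_of_pos hr0 α).ne'
        field_simp
      rw [hp]
      have : 0 < y * (b / r) ^ α := by positivity
      field_simp
      ring
    · simp
  rw [setIntegral_congr_fun measurableSet_Ioi h1, integral_const_mul,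
    integral_comp_rpow_Ioi (fun v => G (c * v)) two_ne_zero, integral_comp_mul_left_Ioi G 0 hc0,
    mul_zero, smul_eq_mul]
  have h2 : ∫ u in Ioi (0 : ℝ), G u = phi α y x := by
    rw [phi, integral_Ici_eq_integral_Ioi, setIntegral_indicator measurableSet_Ioi,
      Ioi_inter_Ioi, sup_of_le_right hL0.le]
  rw [h2, hc]
  field_simp

theorem lintegral_one_sub_exp_farLog {lam : ℝ} (hlam : 0 ≤ lam) (hα : 2 < α) (hy : 0 ≤ y)
    (hb : 0 < b) (hx : 0 < x) :
    (∫⁻ z, ENNReal.ofReal (1 - Real.exp (-(ENNReal.ofReal (farLog α y x b ‖z‖)).toReal))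
      ∂homIntensity lam).toReal =
      Real.pi * lam * b ^ 2 * (y ^ (2 / α) * phi α y x / x ^ 2) := by
  simp_rw [fun z : Plane => ENNReal.toReal_ofReal (farLog_nonneg (α := α) hy hb hx ‖z‖)]
  rw [← integral_eq_lintegral_of_nonneg_ae]
  · rw [integral_smul_measure, ENNReal.toReal_ofReal hlam]
    simp_rw [fun z : Plane => one_sub_exp_neg_farLog (α := α) hy hb hx ‖z‖]
    rw [integral_fun_norm_addHaar volume
      (fun r => if b / x < r then 1 - 1 / (1 + y * (b / r) ^ α) else 0)]
    have hv : (volume : Measure Plane).real (Metric.ball 0 1) = Real.pi := by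
      rw [Measure.real, EuclideanSpace.volume_ball_fin_two]
      simp [Real.pi_nonneg]
    simp only [hv, finrank_euclideanSpace, Fintype.card_fin, smul_eq_mul, Nat.add_one_sub_one,
      pow_one, nsmul_eq_mul]
    -- At `y = 0` the factor `y ^ (2/α)` vanishes, whatever value `phi` takes there.
    rcases hy.eq_or_lt with rfl | hy
    · have : (0 : ℝ) ^ (2 / α) = 0 := Real.zero_rpow (by positivity)
      simp [this]
    · rw [integral_radial_eq_phi hα hy hb hx]
      field_simp
      push_cast
      ring
  · refine ae_of_all _ fun z => ?_
    rw [Pi.zero_apply, sub_nonneg, Real.exp_le_one_iff, neg_nonpos]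
    exact farLog_nonneg hy hb hx _
  · exact (measurable_const.sub (Real.measurable_exp.comp
      ((measurable_farLog α y x b).comp measurable_norm).neg)).aestronglyMeasurable

theorem lintegral_farLog_lt_top {lam : ℝ} (hα : 2 < α) (hy : 0 ≤ y) (hb : 0 < b) (hx : 0 < x) :
    ∫⁻ z, ENNReal.ofReal (farLog α y x b ‖z‖) ∂homIntensity lam < ∞ := by
  have h1 : ∀ z : Plane, ENNReal.ofReal (farLog α y x b ‖z‖) ≤
      ENNReal.ofReal (y * b ^ α * (1 + x / b) ^ α) * ENNReal.ofReal ((1 + ‖z‖) ^ (-α)) := by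
    intro z
    rw [← ENNReal.ofReal_mul (by positivity)]
    exact ENNReal.ofReal_le_ofReal (farLog_le hα hy hb hx (norm_nonneg z))
  refine (lintegral_mono h1).trans_lt ?_
  rw [lintegral_const_mul' _ _ ENNReal.ofReal_ne_top]
  exact ENNReal.mul_lt_top ENNReal.ofReal_lt_top (lintegral_one_add_norm_homIntensity hα)

end Analytic

/-! ### Discretising the nearest distance -/

/-- The sum `∑_{k ≥ 2} log (1 + y (b / r_k) ^ α)`. -/
noncomputable def logSum (α y b : ℝ) (S : Set Plane) : ℝ :=
  ∑' k, Real.log (1 + y * (b / nthDist S (k + 1)) ^ α)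

theorem logSum_nonneg {α y b : ℝ} (hy : 0 ≤ y) (hb : 0 ≤ b) (S : Set Plane) :
    0 ≤ logSum α y b S :=
  tsum_nonneg fun _ => Real.log_nonneg (le_add_of_nonneg_right (mul_nonneg hy
    (Real.rpow_nonneg (div_nonneg hb (nthDist_nonneg S _)) _)))

/-- In terms of the counts in three concentric balls, both sides say that radius `a` holds no point
and radii `b` and `b / x` hold one each. -/
theorem cell_iff {S : Set Plane} (hS : LocallyFiniteSet S) (hi : S.encard = ⊤) {a b x : ℝ}
    (ha : 0 ≤ a) (hab : a < b) (hx : 0 < x) (hx1 : x ≤ 1) :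
    ((S ∩ (Metric.closedBall 0 a ∪ Metric.closedBall 0 (b / x) \ Metric.closedBall 0 b)).encard = 0 ∧
      (S ∩ (Metric.closedBall 0 b \ Metric.closedBall 0 a)).encard = 1) ↔
    a < nthDist S 0 ∧ nthDist S 0 ≤ b ∧ b / x < nthDist S 1 := by
  have hb : 0 ≤ b := ha.trans hab.le
  have hbx : b ≤ b / x := by
    rw [le_div_iff₀ hx]; nlinarith
  rw [← not_le, ← not_le, nthDist_le_iff hS (by simp [hi]) ha, nthDist_le_iff hS (by simp [hi]) hb,
    nthDist_le_iff hS (by simp [hi]) (hb.trans hbx)]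
  have sub : ∀ {s t : ℝ}, s ≤ t →
      (S ∩ (Metric.closedBall 0 t \ Metric.closedBall 0 s)).encard +
        (S ∩ Metric.closedBall 0 s).encard = (S ∩ Metric.closedBall 0 t).encard := by
    intro s t hst
    rw [← encard_sdiff_add_encard_of_subset
      (inter_subset_inter_right S (Metric.closedBall_subset_closedBall hst))]
    congr 2
    ext z; simp only [mem_inter_iff, Set.mem_sdiff]; tauto
  have e1 := sub hab.le
  have e2 := sub hbx
  have e3 : (S ∩ (Metric.closedBall 0 a ∪ Metric.closedBall 0 (b / x) \ Metric.closedBall 0 b)).encard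
      = (S ∩ Metric.closedBall 0 a).encard +
        (S ∩ (Metric.closedBall 0 (b / x) \ Metric.closedBall 0 b)).encard := by
    rw [inter_union_distrib_left, encard_union_eq]
    refine Disjoint.inter_left' _ (Disjoint.inter_right' _ ?_)
    exact (disjoint_sdiff_right).mono_left (Metric.closedBall_subset_closedBall hab.le)
  rw [e3]
  have fin : ∀ s : Set Plane, ∀ t, s ⊆ Metric.closedBall 0 t → ∃ n : ℕ, (S ∩ s).encard = n := by
    intro s t hst
    obtain ⟨n, hn⟩ := ENat.ne_top_iff_exists.1
      ((hS t).subset (inter_subset_inter_right S hst)).encard_lt_top.ne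
    exact ⟨n, hn.symm⟩
  obtain ⟨na, hna⟩ := fin (Metric.closedBall 0 a) _ subset_rfl
  obtain ⟨nb, hnb⟩ := fin (Metric.closedBall 0 b) _ subset_rfl
  obtain ⟨nc, hnc⟩ := fin (Metric.closedBall 0 (b / x)) _ subset_rfl
  obtain ⟨n1, hn1⟩ := fin (Metric.closedBall 0 b \ Metric.closedBall 0 a) _ sdiff_subset
  obtain ⟨n2, hn2⟩ := fin (Metric.closedBall 0 (b / x) \ Metric.closedBall 0 b) _ sdiff_subset
  rw [hna, hnb, hn1] at e1
  rw [hnb, hnc, hn2] at e2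
  rw [hna, hnb, hnc, hn1, hn2]
  norm_cast at *
  omega


/-- The rate of the exponential law which the squared nearest distance follows (up to a
factor `π λ`) under the weight of the max-ratio event and the interference. -/
noncomputable def cellRate (α y x : ℝ) : ℝ := (1 + y ^ (2 / α) * phi α y x) / x ^ 2

theorem cellRate_pos {α y x : ℝ} (hy : 0 ≤ y) (hx : 0 < x) : 0 < cellRate α y x := by
  have := phi_nonneg (α := α) hy hx.le
  unfold cellRate
  positivity

/-- The weight `exp (-∑_{k ≥ 2} log (1 + y (b / r_k) ^ α))` on the event `a < r₁ ≤ b`,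
`b / x < r₂`. -/
noncomputable def cellWeight (α y x a b : ℝ) (S : Set Plane) : ℝ :=
  if a < nthDist S 0 ∧ nthDist S 0 ≤ b ∧ b / x < nthDist S 1 then
    Real.exp (-logSum α y b S) else 0

section Homogeneous

variable {Ω : Type*} [MeasurableSpace Ω] {Pr : Measure Ω}
  {φ : Ω → Set Plane} {lam α y x : ℝ}

theorem IsPoissonPointProcess.measurable_nthDist
    (h : IsPoissonPointProcess Pr φ (homIntensity lam)) (j : ℕ) :
    Measurable fun ω => nthDist (φ ω) j :=
  (measurable_nthDist_pointSigma h.locallyFiniteSet j).mono h.pointSigma_le le_rfl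

theorem IsPoissonPointProcess.measurable_logSum
    (h : IsPoissonPointProcess Pr φ (homIntensity lam)) (α y : ℝ) {b : Ω → ℝ} (hb : Measurable b) :
    Measurable fun ω => logSum α y (b ω) (φ ω) := by
  refine Measurable.tsum fun k => ?_
  have := h.measurable_nthDist (k + 1)
  fun_prop

theorem IsPoissonPointProcess.real_count_eq {ν : Measure Plane} (h : IsPoissonPointProcess Pr φ ν)
    {B : Set Plane} (hB : MeasurableSet B) {m : ℝ} (hm : 0 ≤ m) (hν : ν B = ENNReal.ofReal m)
    (n : ℕ) : Pr.real {ω | (φ ω ∩ B).encard = n} = Real.exp (-m) * m ^ n / n.factorial := by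
  have e : (ν B).toNNReal = m.toNNReal := by rw [hν]; exact ENNReal.toNNReal_coe _
  rw [Measure.real, h.poisson_count B hB (by rw [hν]; exact ENNReal.ofReal_ne_top) n, e,
    ← Measure.real, poissonMeasure_real_singleton, Real.coe_toNNReal _ hm]

variable [IsProbabilityMeasure Pr]

/-- On the cell event exactly the nearest point lies within `b / x`, so the weight is a Laplace
functional of the points beyond. The two counted regions have total area `π b² / x²`; the void terms
and the Laplace exponent add up to `πλ b²` times `cellRate`. -/
theorem IsPoissonPointProcess.integral_cellWeight (hlam : 0 < lam) (hα : 2 < α)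
    (hy : 0 ≤ y) (hx : 0 < x) (hx1 : x ≤ 1)
    (h : IsPoissonPointProcess Pr φ (homIntensity lam)) {a b : ℝ} (ha : 0 ≤ a) (hab : a < b) :
    ∫ ω, cellWeight α y x a b (φ ω) ∂Pr =
      Real.pi * lam * (b ^ 2 - a ^ 2) * Real.exp (-(Real.pi * lam * b ^ 2 * cellRate α y x)) := by
  have hb : 0 < b := ha.trans_lt hab
  have hbx : b ≤ b / x := by
    rw [le_div_iff₀ hx]; nlinarith
  set A : Set Plane :=
    Metric.closedBall 0 a ∪ Metric.closedBall 0 (b / x) \ Metric.closedBall 0 b with hAdef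
  set C : Set Plane := Metric.closedBall 0 b \ Metric.closedBall 0 a with hCdef
  have hA : MeasurableSet A :=
    measurableSet_closedBall.union (measurableSet_closedBall.diff measurableSet_closedBall)
  have hC : MeasurableSet C := measurableSet_closedBall.diff measurableSet_closedBall
  have hAC : Disjoint A C := by
    rw [hAdef, hCdef, disjoint_union_left]
    exact ⟨disjoint_sdiff_right, (disjoint_sdiff_left).mono_right sdiff_subset⟩
  have hmeas : Measurable fun r => ENNReal.ofReal (farLog α y x b r) :=
    (measurable_farLog α y x b).ennreal_ofReal
  have hACle : ∀ z ∈ A ∪ C, ‖z‖ ≤ b / x := by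
    rintro z ((hz | hz) | hz)
    · exact (mem_closedBall_zero_iff.1 hz).trans (hab.le.trans hbx)
    · exact mem_closedBall_zero_iff.1 hz.1
    · exact (mem_closedBall_zero_iff.1 hz.1).trans hbx
  have key := h.laplace hA hC hAC (f := fun z => ENNReal.ofReal (farLog α y x b ‖z‖))
    (hmeas.comp measurable_norm) (fun _ => ENNReal.ofReal_ne_top)
    (lintegral_farLog_lt_top hα hy hb hx).ne
    (fun z hz => by
      have := hACle z hz
      simp [farLog, not_lt.2 this])
  rw [lintegral_one_sub_exp_farLog hlam.le hα hy hb hx] at key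
  refine Eq.trans (Eq.trans (integral_congr_ae ?_) key) ?_
  · filter_upwards [h.ae_infinite hlam] with ω hω
    have hS := h.locallyFiniteSet ω
    have hiff := cell_iff hS hω ha hab hx hx1
    rw [lintegral_norm_pointMeasure hS hω hmeas, cellWeight]
    by_cases hc : a < nthDist (φ ω) 0 ∧ nthDist (φ ω) 0 ≤ b ∧ b / x < nthDist (φ ω) 1
    · have hc' := hiff.2 hc
      rw [if_pos hc, if_pos hc'.1, if_pos hc'.2, one_mul, one_mul]
      rw [ENNReal.tsum_toReal_eq (fun _ => ENNReal.ofReal_ne_top)]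
      congr 2
      simp_rw [ENNReal.toReal_ofReal (farLog_nonneg (α := α) hy hb hx _)]
      have h0 : farLog α y x b (nthDist (φ ω) 0) = 0 := by
        rw [farLog, if_neg (not_lt.2 (hc.2.1.trans hbx))]
      have hk : ∀ k, farLog α y x b (nthDist (φ ω) (k + 1)) =
          Real.log (1 + y * (b / nthDist (φ ω) (k + 1)) ^ α) := by
        intro k
        rw [farLog, if_pos (hc.2.2.trans_le (nthDist_mono hS hω (by omega)))]
      rw [logSum]
      -- The nearest point contributes zero, so the two series differ by an index shift; without
      -- summability both take the default value `0`.
      by_cases hs : Summable fun k => farLog α y x b (nthDist (φ ω) k)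
      · rw [hs.tsum_eq_zero_add, h0, zero_add]
        simp_rw [hk]
      · rw [tsum_eq_zero_of_not_summable hs, tsum_eq_zero_of_not_summable]
        rw [← summable_nat_add_iff 1] at hs
        simpa [hk] using hs
    · rw [if_neg hc]
      by_cases h1 : (φ ω ∩ A).encard = 0
      · rw [if_neg (fun h2 => hc (hiff.1 ⟨h1, h2⟩))]; simp
      · rw [if_neg h1]; simp
  have hd : ∀ {s t : ℝ}, 0 ≤ s → s ≤ t → homIntensity lam (Metric.closedBall 0 t \
      Metric.closedBall 0 s) = ENNReal.ofReal (Real.pi * lam * (t ^ 2 - s ^ 2)) := by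
    intro s t hs hst
    rw [measure_sdiff (Metric.closedBall_subset_closedBall hst)
      measurableSet_closedBall.nullMeasurableSet (isCompact_closedBall _ _).measure_lt_top.ne,
      homIntensity_closedBall hlam.le (hs.trans hst), homIntensity_closedBall hlam.le hs,
      ← ENNReal.ofReal_sub _ (by positivity)]
    congr 1; ring
  have hνC := hd ha hab.le
  have hνA : homIntensity lam A =
      ENNReal.ofReal (Real.pi * lam * (a ^ 2 + ((b / x) ^ 2 - b ^ 2))) := by
    rw [hAdef, measure_union (disjoint_sdiff_right.mono_left
      (Metric.closedBall_subset_closedBall hab.le))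
      (measurableSet_closedBall.diff measurableSet_closedBall), hd hb.le hbx,
      homIntensity_closedBall hlam.le ha, ← ENNReal.ofReal_add (by positivity)]
    · congr 1; ring
    · have : b ^ 2 ≤ (b / x) ^ 2 := by gcongr
      have := sub_nonneg.2 this
      positivity
  have hpA : Pr.real {ω | (φ ω ∩ A).encard = 0} =
      Real.exp (-(Real.pi * lam * (a ^ 2 + ((b / x) ^ 2 - b ^ 2)))) := by
    have hn : 0 ≤ Real.pi * lam * (a ^ 2 + ((b / x) ^ 2 - b ^ 2)) := by
      have : b ^ 2 ≤ (b / x) ^ 2 := by gcongr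
      have := sub_nonneg.2 this
      positivity
    have := h.real_count_eq hA hn hνA 0
    simpa using this
  have hpC : Pr.real {ω | (φ ω ∩ C).encard = 1} =
      Real.exp (-(Real.pi * lam * (b ^ 2 - a ^ 2))) * (Real.pi * lam * (b ^ 2 - a ^ 2)) := by
    have hn : 0 ≤ Real.pi * lam * (b ^ 2 - a ^ 2) := by
      have : a ^ 2 ≤ b ^ 2 := by gcongr
      have := sub_nonneg.2 this
      positivity
    have := h.real_count_eq hC hn hνC 1
    simpa using this
  rw [hpA, hpC]
  rw [show ∀ p q r s : ℝ, p * (q * r) * s = r * (p * q * s) by intros; ring, ← Real.exp_add,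
    ← Real.exp_add]
  congr 2
  rw [cellRate]
  field_simp
  ring

/-- Dominated convergence for series: for `b ≤ B` the terms are at most `y B ^ α r_k ^ (-α)`. -/
theorem tendsto_logSum {S : Set Plane} (hS : LocallyFiniteSet S) (hi : S.encard = ⊤)
    (h0 : 0 < nthDist S 0) (hα : 0 < α) (hy : 0 ≤ y)
    (hs : Summable fun k => nthDist S k ^ (-α)) {b : ℕ → ℝ} {c B : ℝ} (hb0 : ∀ n, 0 ≤ b n)
    (hbB : ∀ n, b n ≤ B) (hb : Tendsto b atTop (𝓝 c)) :
    Tendsto (fun n => logSum α y (b n) S) atTop (𝓝 (logSum α y c S)) := by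
  have hc : 0 ≤ c := ge_of_tendsto' hb hb0
  have hpos : ∀ k, 0 < nthDist S k := fun k => h0.trans_le (nthDist_mono hS hi zero_le)
  refine tendsto_tsum_of_dominated_convergence
    (bound := fun k => y * B ^ α * nthDist S (k + 1) ^ (-α)) ?_ (fun k => ?_) ?_
  · exact ((summable_nat_add_iff 1).2 hs).mul_left _
  · have hcont : ContinuousAt (fun t : ℝ => Real.log (1 + y * (t / nthDist S (k + 1)) ^ α)) c := by
      have : 0 < 1 + y * (c / nthDist S (k + 1)) ^ α := by
        have := hpos (k + 1)
        positivity
      refine ContinuousAt.log ?_ this.ne'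
      refine continuousAt_const.add (continuousAt_const.mul ?_)
      exact (continuousAt_id.div_const _).rpow_const (Or.inr hα.le)
    exact hcont.tendsto.comp hb
  · refine Eventually.of_forall fun n k => ?_
    have hp := hpos (k + 1)
    have hbn := hb0 n
    rw [Real.norm_of_nonneg (Real.log_nonneg (le_add_of_nonneg_right (by positivity)))]
    have h1 := Real.log_le_sub_one_of_pos
      (show 0 < 1 + y * (b n / nthDist S (k + 1)) ^ α by positivity)
    have h2 : (b n / nthDist S (k + 1)) ^ α ≤ B ^ α * nthDist S (k + 1) ^ (-α) := by
      rw [Real.div_rpow hbn hp.le, Real.rpow_neg hp.le, div_eq_mul_inv]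
      have := hbB n
      gcongr
    have := mul_le_mul_of_nonneg_left h2 hy
    linarith

/-- The smallest number of the form `√(m h)` that is at least `r`. -/
noncomputable def gridCeil (h r : ℝ) : ℝ := √(⌈r ^ 2 / h⌉₊ * h)

theorem le_gridCeil {h r : ℝ} (hh : 0 < h) : r ≤ gridCeil h r := by
  refine Real.le_sqrt_of_sq_le ?_
  rw [← div_le_iff₀ hh]
  exact Nat.le_ceil _

theorem gridCeil_sq_le {h r : ℝ} (hh : 0 < h) : gridCeil h r ^ 2 ≤ r ^ 2 + h := by
  rw [gridCeil, Real.sq_sqrt (by positivity)]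
  have := (Nat.ceil_lt_add_one (show 0 ≤ r ^ 2 / h by positivity)).le
  have h2 := mul_le_mul_of_nonneg_right this hh.le
  rwa [add_mul, div_mul_cancel₀ _ hh.ne', one_mul] at h2

theorem gridCeil_le {h r : ℝ} (hh : 0 < h) : gridCeil h r ≤ √(r ^ 2 + h) :=
  Real.le_sqrt_of_sq_le (gridCeil_sq_le hh)

theorem grid_cell_iff {h r : ℝ} (hh : 0 < h) (hr : 0 < r) (m : ℕ) :
    (√(m * h) < r ∧ r ≤ √((m + 1 : ℕ) * h)) ↔ ⌈r ^ 2 / h⌉₊ = m + 1 := by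
  rw [Nat.ceil_eq_iff (by omega), Real.sqrt_lt' hr, Real.le_sqrt' hr, lt_div_iff₀ hh,
    div_le_iff₀ hh]
  simp

/-- The weight in terms of the nearest distance rounded up to a grid of mesh `h`. -/
noncomputable def gridWeight (α y x h : ℝ) (S : Set Plane) : ℝ :=
  if gridCeil h (nthDist S 0) / x < nthDist S 1 then
    Real.exp (-logSum α y (gridCeil h (nthDist S 0)) S) else 0

/-- A positive nearest distance lies in exactly one cell of the grid, and the upper end of that cell
is its rounded value. -/
theorem tsum_cellWeight {S : Set Plane} {h : ℝ} (hh : 0 < h) (h0 : 0 < nthDist S 0) :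
    ∑' m : ℕ, cellWeight α y x √(m * h) √((m + 1 : ℕ) * h) S = gridWeight α y x h S := by
  obtain ⟨m, hm⟩ := Nat.exists_eq_succ_of_ne_zero
    (Nat.ceil_pos.2 (show 0 < nthDist S 0 ^ 2 / h by positivity)).ne'
  rw [tsum_eq_single m]
  · have hc := (grid_cell_iff hh h0 m).2 hm
    simp only [cellWeight, gridWeight, gridCeil, hm, hc, true_and, Nat.succ_eq_add_one]
  · intro k hk
    rw [cellWeight, if_neg]
    rintro ⟨h1, h2, -⟩
    have := (grid_cell_iff hh h0 k).1 ⟨h1, h2⟩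
    omega

theorem IsPoissonPointProcess.integrable_cellWeight (hy : 0 ≤ y)
    (h : IsPoissonPointProcess Pr φ (homIntensity lam)) {a b : ℝ} (hb : 0 ≤ b) :
    Integrable (fun ω => cellWeight α y x a b (φ ω)) Pr := by
  have m0 := h.measurable_nthDist 0
  have m1 := h.measurable_nthDist 1
  refine Integrable.of_bound (C := 1) (Measurable.aestronglyMeasurable ?_) (ae_of_all _ fun ω => ?_)
  · refine Measurable.ite ?_ (Real.measurable_exp.comp
      (h.measurable_logSum α y measurable_const).neg) measurable_const
    exact (measurableSet_lt measurable_const m0).inter ((measurableSet_le m0 measurable_const).inter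
      (measurableSet_lt measurable_const m1))
  · have := Real.exp_le_one_iff.2 (neg_nonpos.2 (logSum_nonneg (α := α) hy hb (φ ω)))
    have h0 := Real.exp_pos (-logSum α y b (φ ω))
    rw [cellWeight]
    split_ifs <;> simp [this]

theorem cellWeight_nonneg (a b : ℝ) (S : Set Plane) : 0 ≤ cellWeight α y x a b S := by
  rw [cellWeight]
  split_ifs <;> positivity

/-- In the variable `r₁²` the grid is uniform, so the cell integrals form a geometric series with
ratio `exp (-πλ t D)`, where `D` is `cellRate α y x`. -/
theorem IsPoissonPointProcess.integral_gridWeight (hlam : 0 < lam) (hα : 2 < α)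
    (hy : 0 ≤ y) (hx : 0 < x) (hx1 : x ≤ 1)
    (h : IsPoissonPointProcess Pr φ (homIntensity lam)) {t : ℝ} (ht : 0 < t) :
    ∫ ω, gridWeight α y x t (φ ω) ∂Pr =
      Real.pi * lam * t / (Real.exp (Real.pi * lam * t * cellRate α y x) - 1) := by
  have hD := cellRate_pos (α := α) hy hx
  set q : ℝ := Real.exp (-(Real.pi * lam * t * cellRate α y x)) with hq
  have hq0 : 0 < q := Real.exp_pos _
  have hq1 : q < 1 := by
    rw [hq, Real.exp_lt_one_iff, neg_lt_zero]; positivity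
  have hI : ∀ m : ℕ, ∫ ω, cellWeight α y x √(m * t) √((m + 1 : ℕ) * t) (φ ω) ∂Pr =
      Real.pi * lam * t * q * q ^ m := by
    intro m
    rw [h.integral_cellWeight hlam hα hy hx hx1 (Real.sqrt_nonneg _)
      (Real.sqrt_lt_sqrt (by positivity) (mul_lt_mul_of_pos_right (by simp) ht)),
      Real.sq_sqrt (by positivity), Real.sq_sqrt (by positivity), mul_assoc _ q, ← pow_succ', hq,
      ← Real.exp_nat_mul]
    congr 2
    · push_cast; ring
    · push_cast; ring
  have hsum : HasSum (fun m : ℕ => Real.pi * lam * t * q * q ^ m)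
      (Real.pi * lam * t * q * (1 - q)⁻¹) :=
    (hasSum_geometric_of_lt_one hq0.le hq1).mul_left _
  have hs := hasSum_integral_of_summable_integral_norm (μ := Pr)
    (F := fun (m : ℕ) ω => cellWeight α y x √(m * t) √((m + 1 : ℕ) * t) (φ ω))
    (fun m => h.integrable_cellWeight hy (Real.sqrt_nonneg _)) (by
      simp_rw [fun (m : ℕ) ω => Real.norm_of_nonneg
        (cellWeight_nonneg (α := α) (y := y) (x := x) √(m * t) √((m + 1 : ℕ) * t) (φ ω)), hI]
      exact hsum.summable)
  have e : ∫ ω, gridWeight α y x t (φ ω) ∂Pr =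
      ∫ ω, ∑' m : ℕ, cellWeight α y x √(m * t) √((m + 1 : ℕ) * t) (φ ω) ∂Pr := by
    refine integral_congr_ae ?_
    filter_upwards [h.ae_nthDist_pos hlam] with ω hω
    exact (tsum_cellWeight ht hω).symm
  rw [e]
  simp_rw [hI] at hs
  rw [hs.unique hsum]
  have : Real.exp (Real.pi * lam * t * cellRate α y x) = q⁻¹ := by rw [hq, Real.exp_neg, inv_inv]
  rw [this]
  have : 1 - q ≠ 0 := by linarith
  have : q⁻¹ - 1 ≠ 0 := by
    have := (one_lt_inv₀ hq0).2 hq1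
    linarith
  field_simp

/-- The probability generating functional of the interferers seen from the nearest point, on the
event that the second nearest distance exceeds the nearest one by a factor more than `1 / x`. -/
theorem IsPoissonPointProcess.integral_ratio_weight (hlam : 0 < lam) (hα : 2 < α)
    (hy : 0 ≤ y) (hx : 0 < x) (hx1 : x ≤ 1)
    (h : IsPoissonPointProcess Pr φ (homIntensity lam)) :
    ∫ ω, (if nthDist (φ ω) 0 / x < nthDist (φ ω) 1 then
      Real.exp (-logSum α y (nthDist (φ ω) 0) (φ ω)) else 0) ∂Pr = (cellRate α y x)⁻¹ := by
  have hD := cellRate_pos (α := α) hy hx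
  let t : ℕ → ℝ := fun n => 1 / ((n : ℝ) + 1)
  have ht0 : ∀ n, 0 < t n := fun n => by positivity
  have ht1 : ∀ n, t n ≤ 1 := fun n => by
    simp only [t]; rw [div_le_one (by positivity)]; linarith [(n.cast_nonneg : (0 : ℝ) ≤ n)]
  have htl : Tendsto t atTop (𝓝 0) := tendsto_one_div_add_atTop_nhds_zero_nat
  have hgl : ∀ r : ℝ, 0 ≤ r → Tendsto (fun n => gridCeil (t n) r) atTop (𝓝 r) := by
    intro r hr
    have h1 : Tendsto (fun n => √(r ^ 2 + t n)) atTop (𝓝 √(r ^ 2 + 0)) :=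
      (Real.continuous_sqrt.tendsto _).comp (htl.const_add _)
    rw [add_zero, Real.sqrt_sq hr] at h1
    exact tendsto_of_tendsto_of_tendsto_of_le_of_le tendsto_const_nhds h1
      (fun n => le_gridCeil (ht0 n)) (fun n => gridCeil_le (ht0 n))
  have m0 := h.measurable_nthDist 0
  have m1 := h.measurable_nthDist 1
  have hlim := tendsto_integral_of_dominated_convergence (μ := Pr)
    (F := fun n ω => gridWeight α y x (t n) (φ ω))
    (f := fun ω => if nthDist (φ ω) 0 / x < nthDist (φ ω) 1 then
      Real.exp (-logSum α y (nthDist (φ ω) 0) (φ ω)) else 0) (fun _ => 1)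
    (fun n => by
      have mg : Measurable fun ω => gridCeil (t n) (nthDist (φ ω) 0) := by
        unfold gridCeil
        exact Real.continuous_sqrt.measurable.comp ((Measurable.of_discrete.comp
          (Nat.measurable_ceil.comp ((m0.pow_const 2).div_const _))).mul_const _)
      refine (Measurable.ite (measurableSet_lt (mg.div_const _) m1) ?_
        measurable_const).aestronglyMeasurable
      exact Real.measurable_exp.comp (h.measurable_logSum α y mg).neg)
    (integrable_const _) (fun n => ae_of_all _ fun ω => by
      have := Real.exp_le_one_iff.2 (neg_nonpos.2 (logSum_nonneg (α := α) hy
        (Real.sqrt_nonneg (⌈nthDist (φ ω) 0 ^ 2 / t n⌉₊ * t n)) (φ ω)))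
      rw [gridWeight]
      split_ifs
      · simpa [gridCeil] using this
      · simp)
    (by
      filter_upwards [h.ae_infinite hlam, h.ae_nthDist_pos hlam,
        h.ae_summable_nthDist hα hlam] with ω hi hpos hs
      have hS := h.locallyFiniteSet ω
      have hg := hgl _ hpos.le
      split_ifs with hc
      · have hev : ∀ᶠ n in atTop, gridCeil (t n) (nthDist (φ ω) 0) / x < nthDist (φ ω) 1 :=
          (hg.div_const x).eventually_lt_const hc
        refine Tendsto.congr' (f₁ := fun n =>
          Real.exp (-logSum α y (gridCeil (t n) (nthDist (φ ω) 0)) (φ ω))) ?_ ?_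
        · filter_upwards [hev] with n hn
          rw [gridWeight, if_pos hn]
        · refine (Real.continuous_exp.tendsto _).comp (Tendsto.neg ?_)
          refine tendsto_logSum hS hi hpos (by linarith) hy hs (B := √(nthDist (φ ω) 0 ^ 2 + 1))
            (fun n => Real.sqrt_nonneg _) (fun n => ?_) hg
          exact (gridCeil_le (ht0 n)).trans (Real.sqrt_le_sqrt (add_le_add_right (ht1 n) _))
      -- Rounding up preserves the failure of the strict inequality, so the boundary case `r₁ / x =
      -- r₂` needs no separate argument.
      · refine tendsto_const_nhds.congr fun n => ?_
        rw [gridWeight, if_neg]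
        rw [not_lt] at hc ⊢
        exact hc.trans (div_le_div_of_nonneg_right (le_gridCeil (ht0 n)) hx.le))
  simp_rw [fun n => h.integral_gridWeight hlam hα hy hx hx1 (ht0 n)] at hlim
  refine tendsto_nhds_unique hlim ?_
  set K := Real.pi * lam with hK
  have hK0 : 0 < K := by positivity
  -- The integral at mesh `t` is the inverse of a difference quotient of `s ↦ exp (s D)` at `0`,
  -- with `D` the rate and increment `πλ t`; hence the limit `1 / D`.
  have hder : HasDerivAt (fun s : ℝ => Real.exp (s * cellRate α y x)) (cellRate α y x) 0 := by
    have := ((hasDerivAt_id (0 : ℝ)).mul_const (cellRate α y x)).exp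
    simpa using this
  have hslope := hder.tendsto_slope
  have hT : Tendsto (fun n => K * t n) atTop (𝓝[≠] 0) := by
    rw [tendsto_nhdsWithin_iff]
    refine ⟨by simpa using htl.const_mul K, Eventually.of_forall fun n => ?_⟩
    exact (mul_pos hK0 (ht0 n)).ne'
  refine ((hslope.comp hT).inv₀ hD.ne').congr fun n => ?_
  simp [slope_def_field, inv_div]

end Homogeneous

/-! ### The exponential law: Laplace transform, tail, mean -/

section Exponential

variable {μ : ℝ}

theorem lintegral_expMeasure {f : ℝ → ℝ≥0∞} (hf : Measurable f) :
    ∫⁻ t, f t ∂expMeasure μ = ∫⁻ t in Ioi 0, ENNReal.ofReal (μ * Real.exp (-(μ * t))) * f t := by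
  have hm : Measurable (exponentialPDF μ) := (measurable_exponentialPDFReal μ).ennreal_ofReal
  have e : expMeasure μ = volume.withDensity (exponentialPDF μ) := rfl
  rw [e, lintegral_withDensity_eq_lintegral_mul _ hm hf, setLIntegral_congr Ioi_ae_eq_Ici,
    ← lintegral_indicator measurableSet_Ici]
  congr 1
  ext t
  by_cases ht : 0 ≤ t
  · rw [indicator_of_mem (mem_Ici.2 ht), Pi.mul_apply, exponentialPDF_of_nonneg ht]
  · rw [indicator_of_notMem (by simpa using ht), Pi.mul_apply,
      exponentialPDF_of_neg (not_le.1 ht), zero_mul]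

theorem lintegral_Ioi_exp (hμ : 0 ≤ μ) {a : ℝ} (ha : 0 < a) (c : ℝ) :
    ∫⁻ t in Ioi c, ENNReal.ofReal (μ * Real.exp (-(a * t))) =
      ENNReal.ofReal (μ / a * Real.exp (-(a * c))) := by
  have hi := (integrableOn_exp_mul_Ioi (neg_lt_zero.2 ha) c).const_mul μ
  have := ofReal_integral_eq_lintegral_ofReal hi (ae_of_all _ fun t => by positivity)
  simp only [neg_mul] at this
  rw [← this]
  have h2 := integral_exp_mul_Ioi (neg_lt_zero.2 ha) c
  simp only [neg_mul] at h2
  rw [integral_const_mul, h2]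
  congr 1
  field_simp

theorem lintegral_exp_neg_mul_expMeasure (hμ : 0 < μ) {c : ℝ} (hc : 0 ≤ c) :
    ∫⁻ t, ENNReal.ofReal (Real.exp (-(μ * (t * c)))) ∂expMeasure μ =
      ENNReal.ofReal (1 / (1 + c)) := by
  rw [lintegral_expMeasure (by fun_prop)]
  have e : ∀ t : ℝ, ENNReal.ofReal (μ * Real.exp (-(μ * t))) *
      ENNReal.ofReal (Real.exp (-(μ * (t * c)))) =
      ENNReal.ofReal (μ * Real.exp (-(μ * (1 + c) * t))) := by
    intro t
    rw [← ENNReal.ofReal_mul (by positivity), mul_assoc, ← Real.exp_add]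
    congr 3; ring
  simp_rw [e]
  rw [lintegral_Ioi_exp hμ.le (by positivity)]
  congr 1
  simp only [mul_zero, neg_zero, Real.exp_zero, mul_one]
  field_simp

theorem lintegral_indicator_le_expMeasure (hμ : 0 < μ) {c : ℝ} (hc : 0 ≤ c) :
    ∫⁻ t, (Ici c).indicator 1 t ∂expMeasure μ = ENNReal.ofReal (Real.exp (-(μ * c))) := by
  rw [lintegral_expMeasure (measurable_one.indicator measurableSet_Ici)]
  have e : ∀ t : ℝ, ENNReal.ofReal (μ * Real.exp (-(μ * t))) * (Ici c).indicator 1 t =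
      (Ici c).indicator (fun t => ENNReal.ofReal (μ * Real.exp (-(μ * t)))) t := by
    intro t
    by_cases ht : t ∈ Ici c <;> simp [ht]
  simp_rw [e]
  rw [setLIntegral_indicator measurableSet_Ici, setLIntegral_congr
    ((Ioi_ae_eq_Ici.symm).inter (ae_eq_refl (Ioi (0 : ℝ)))), Ioi_inter_Ioi, sup_of_le_left hc,
    lintegral_Ioi_exp hμ.le hμ, div_self hμ.ne', one_mul]

theorem lintegral_ofReal_expMeasure_lt_top (hμ : 0 < μ) :
    ∫⁻ t, ENNReal.ofReal t ∂expMeasure μ < ∞ := by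
  rw [lintegral_expMeasure ENNReal.measurable_ofReal]
  have h := integrableOn_rpow_mul_exp_neg_mul_rpow (p := 1) (s := 1) (b := μ) (by norm_num)
    one_pos hμ
  have := (h.const_mul μ).lintegral_lt_top
  refine lt_of_le_of_lt (setLIntegral_mono_ae (by fun_prop) (ae_of_all _ fun t ht => ?_)) this
  rw [← ENNReal.ofReal_mul (by positivity)]
  refine ENNReal.ofReal_le_ofReal (le_of_eq ?_)
  simp only [Real.rpow_one]
  rw [neg_mul]
  ring

theorem expMeasure_Iic_zero (μ : ℝ) : expMeasure μ (Iic 0) = 0 := by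
  rw [← lintegral_indicator_one measurableSet_Iic,
    lintegral_expMeasure (measurable_one.indicator measurableSet_Iic),
    setLIntegral_congr_fun (g := fun _ => 0) measurableSet_Ioi]
  · simp
  · intro t ht
    simp only [indicator_of_notMem (show t ∉ Iic 0 from fun h => not_le.2 (mem_Ioi.1 ht) h), mul_zero]

end Exponential

/-! ### Integrating out an independent fading variable -/

section Independence

variable {Ω : Type*} {m : MeasurableSpace Ω} [mΩ : MeasurableSpace Ω] {Pr : Measure Ω}

theorem indepFun_of_indep {β γ : Type*} [MeasurableSpace β] [MeasurableSpace γ] {X : Ω → β}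
    {Z : Ω → γ} (h : Indep (MeasurableSpace.comap X inferInstance) m Pr)
    (hZ : Measurable[m] Z) : IndepFun X Z Pr :=
  (IndepFun_iff_Indep X Z Pr).2 (indep_of_indep_of_le_right h hZ.comap_le)

variable [IsProbabilityMeasure Pr]

/-- Integrating out one of two independent random elements. -/
theorem lintegral_of_indep {β γ : Type*} [MeasurableSpace β] [MeasurableSpace γ] {X : Ω → β}
    {Z : Ω → γ} (hX : Measurable X) (hZ : Measurable Z) (hXZ : IndepFun X Z Pr)
    {G : β → γ → ℝ≥0∞} (hG : Measurable (Function.uncurry G)) :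
    ∫⁻ ω, G (X ω) (Z ω) ∂Pr = ∫⁻ ω, ∫⁻ t, G t (Z ω) ∂(Pr.map X) ∂Pr := by
  have := (indepFun_iff_map_prod_eq_prod_map_map hX.aemeasurable hZ.aemeasurable).1 hXZ
  have p1 : IsProbabilityMeasure (Pr.map X) := Measure.isProbabilityMeasure_map hX.aemeasurable
  have p2 : IsProbabilityMeasure (Pr.map Z) := Measure.isProbabilityMeasure_map hZ.aemeasurable
  have h1 : ∫⁻ ω, G (X ω) (Z ω) ∂Pr =
      ∫⁻ p, Function.uncurry G p ∂(Pr.map fun ω => (X ω, Z ω)) := by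
    rw [lintegral_map hG (hX.prodMk hZ)]; rfl
  rw [h1, this, lintegral_prod_symm _ hG.aemeasurable, lintegral_map _ hZ]
  · rfl
  · exact hG.lintegral_prod_left'

variable {μ : ℝ} {X c : Ω → ℝ} {V : Ω → ℝ≥0∞}

/-- With `V` and `c` frozen, the Laplace transform of the exponential law at `μ c` is `1 / (1 + c)`,
free of `μ`. The sigma-algebra `m` carries everything independent of `X`. -/
theorem lintegral_mul_exp_of_indep (hμ : 0 < μ) (hm : m ≤ mΩ) (hX : Measurable X)
    (hlaw : Pr.map X = expMeasure μ)
    (h : Indep (MeasurableSpace.comap X inferInstance) m Pr) (hV : Measurable[m] V)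
    (hc : Measurable[m] c) (hc0 : ∀ ω, 0 ≤ c ω) :
    ∫⁻ ω, V ω * ENNReal.ofReal (Real.exp (-(μ * (X ω * c ω)))) ∂Pr =
      ∫⁻ ω, V ω * ENNReal.ofReal (1 / (1 + c ω)) ∂Pr := by
  have hZ : Measurable[m] fun ω => (V ω, c ω) := hV.prodMk hc
  have := lintegral_of_indep (Pr := Pr) hX (hZ.mono hm le_rfl) (indepFun_of_indep h hZ)
    (G := fun t p => p.1 * ENNReal.ofReal (Real.exp (-(μ * (t * p.2)))))
    (by unfold Function.uncurry; fun_prop)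
  rw [this, hlaw]
  refine lintegral_congr fun ω => ?_
  rw [lintegral_const_mul _ (by fun_prop), lintegral_exp_neg_mul_expMeasure hμ (hc0 ω)]

theorem lintegral_mul_indicator_of_indep (hμ : 0 < μ) (hm : m ≤ mΩ) (hX : Measurable X)
    (hlaw : Pr.map X = expMeasure μ)
    (h : Indep (MeasurableSpace.comap X inferInstance) m Pr) (hV : Measurable[m] V)
    (hc : Measurable[m] c) (hc0 : ∀ᵐ ω ∂Pr, 0 ≤ c ω) :
    ∫⁻ ω, V ω * (Ici (c ω)).indicator 1 (X ω) ∂Pr =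
      ∫⁻ ω, V ω * ENNReal.ofReal (Real.exp (-(μ * c ω))) ∂Pr := by
  have hZ : Measurable[m] fun ω => (V ω, c ω) := hV.prodMk hc
  have hG : Measurable (Function.uncurry fun (t : ℝ) (p : ℝ≥0∞ × ℝ) =>
      p.1 * (Ici p.2).indicator (1 : ℝ → ℝ≥0∞) t) := by
    have : (Function.uncurry fun (t : ℝ) (p : ℝ≥0∞ × ℝ) =>
      p.1 * (Ici p.2).indicator (1 : ℝ → ℝ≥0∞) t) =
      {q : ℝ × (ℝ≥0∞ × ℝ) | q.2.2 ≤ q.1}.indicator fun q => q.2.1 := by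
      ext ⟨t, p⟩
      simp [indicator_apply]
    rw [this]
    exact Measurable.indicator (by fun_prop) (measurableSet_le (by fun_prop) (by fun_prop))
  have := lintegral_of_indep (Pr := Pr) hX (hZ.mono hm le_rfl) (indepFun_of_indep h hZ) hG
  rw [this, hlaw]
  refine lintegral_congr_ae ?_
  filter_upwards [hc0] with ω hω
  rw [lintegral_const_mul _ (measurable_one.indicator measurableSet_Ici),
    lintegral_indicator_le_expMeasure hμ hω]

theorem lintegral_mul_ofReal_of_indep (hm : m ≤ mΩ) (hX : Measurable X)
    (hlaw : Pr.map X = expMeasure μ)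
    (h : Indep (MeasurableSpace.comap X inferInstance) m Pr) (hV : Measurable[m] V) :
    ∫⁻ ω, V ω * ENNReal.ofReal (X ω) ∂Pr =
      (∫⁻ t, ENNReal.ofReal t ∂expMeasure μ) * ∫⁻ ω, V ω ∂Pr := by
  have := lintegral_of_indep (Pr := Pr) hX (hV.mono hm le_rfl) (indepFun_of_indep h hV)
    (G := fun t v => v * ENNReal.ofReal t) (by unfold Function.uncurry; fun_prop)
  rw [this, hlaw, ← lintegral_const_mul _ (hV.mono hm le_rfl)]
  refine lintegral_congr fun ω => ?_
  rw [lintegral_const_mul _ ENNReal.measurable_ofReal, mul_comm]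

end Independence

/-! ### One technology with Rayleigh fading -/

/-- One technology: a homogeneous Poisson process with independent Rayleigh fading. -/
structure IsRayleighCell {Ω : Type*} [MeasurableSpace Ω] (Pr : Measure Ω)
    (φ : Ω → Set Plane) (H : ℕ → Ω → ℝ) (lam μ : ℝ) : Prop where
  lam_pos : 0 < lam
  rate_pos : 0 < μ
  poisson : IsPoissonPointProcess Pr φ (homIntensity lam)
  measurable_fading : ∀ j, Measurable (H j)
  fading_law : ∀ j, Pr.map (H j) = expMeasure μ
  indep : ∀ j, Indep (MeasurableSpace.comap (H j) inferInstance)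
    (pointSigma φ ⊔ ⨆ k ∈ {k | k ≠ j}, MeasurableSpace.comap (H k) inferInstance) Pr

section Cell

variable {Ω : Type*} [mΩ : MeasurableSpace Ω] {Pr : Measure Ω}
  {φ : Ω → Set Plane} {H : ℕ → Ω → ℝ} {lam μ α y x : ℝ}

theorem IsRayleighCell.ae_fading_pos (h : IsRayleighCell Pr φ H lam μ) :
    ∀ᵐ ω ∂Pr, ∀ k, 0 < H k ω := by
  rw [ae_all_iff]
  intro k
  rw [ae_iff]
  have := expMeasure_Iic_zero μ
  rw [← h.fading_law k, Measure.map_apply (h.measurable_fading k) measurableSet_Iic] at this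
  simpa [preimage, Iic] using this

theorem IsRayleighCell.sigma_le (h : IsRayleighCell Pr φ H lam μ) (j : ℕ) :
    pointSigma φ ⊔ ⨆ k ∈ {k | k ≠ j}, MeasurableSpace.comap (H k) inferInstance ≤ mΩ :=
  sup_le h.poisson.pointSigma_le (iSup₂_le fun k _ => (h.measurable_fading k).comap_le)

variable [IsProbabilityMeasure Pr]

/-- The fadings have finite mean and are independent of the process, so the shifted series `∑ H_k (1
+ r_k) ^ (-α)` has finite expectation. -/
theorem IsRayleighCell.ae_summable_received (h : IsRayleighCell Pr φ H lam μ) (hα : 2 < α) :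
    ∀ᵐ ω ∂Pr, Summable fun k => H k ω * nthDist (φ ω) k ^ (-α) := by
  have hp := h.poisson
  have hmp : ∀ k, Measurable[pointSigma φ] fun ω =>
      ENNReal.ofReal ((1 + nthDist (φ ω) k) ^ (-α)) := fun k =>
    (show Measurable fun r : ℝ => ENNReal.ofReal ((1 + r) ^ (-α)) by fun_prop).comp
      (measurable_nthDist_pointSigma hp.locallyFiniteSet k)
  have hm : ∀ k, Measurable fun ω =>
      ENNReal.ofReal ((1 + nthDist (φ ω) k) ^ (-α)) * ENNReal.ofReal (H k ω) := fun k =>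
    ((hmp k).mono hp.pointSigma_le le_rfl).mul (h.measurable_fading k).ennreal_ofReal
  have hfin : ∫⁻ ω, ∑' k, ENNReal.ofReal ((1 + nthDist (φ ω) k) ^ (-α)) *
      ENNReal.ofReal (H k ω) ∂Pr < ∞ := by
    rw [lintegral_tsum fun k => (hm k).aemeasurable]
    simp_rw [fun k => lintegral_mul_ofReal_of_indep (h.sigma_le k) (h.measurable_fading k)
      (h.fading_law k) (h.indep k) ((hmp k).mono le_sup_left le_rfl)]
    rw [ENNReal.tsum_mul_left, ← lintegral_tsum
      fun k => ((hmp k).mono hp.pointSigma_le le_rfl).aemeasurable]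
    exact ENNReal.mul_lt_top (lintegral_ofReal_expMeasure_lt_top h.rate_pos)
      (hp.lintegral_tsum_one_add_nthDist hα h.lam_pos)
  filter_upwards [ae_lt_top (Measurable.tsum hm) hfin.ne, h.ae_fading_pos,
    hp.ae_infinite h.lam_pos, hp.ae_nthDist_pos h.lam_pos] with ω hω hH hinf hpos
  refine summable_of_one_add (by linarith) hpos (nthDist_mono (hp.locallyFiniteSet ω) hinf)
    (fun k => (hH k).le) ((ENNReal.summable_toReal hω.ne).congr fun k => ?_)
  have := nthDist_nonneg (φ ω) k
  rw [← ENNReal.ofReal_mul (by positivity), ENNReal.toReal_ofReal, mul_comm]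
  exact mul_nonneg (by positivity) (hH k).le

/-- Fadings are integrated out one at a time. The induction keeps `V` arbitrary so that each factor
`1 / (1 + c)`, a function of the process alone, can be absorbed into it. -/
theorem IsRayleighCell.lintegral_prod_exp (h : IsRayleighCell Pr φ H lam μ) {c : ℕ → Ω → ℝ}
    (hc : ∀ k, Measurable[pointSigma φ] (c k)) (hc0 : ∀ k ω, 0 ≤ c k ω) (n : ℕ) :
    ∀ {V : Ω → ℝ≥0∞}, Measurable[pointSigma φ] V →
    ∫⁻ ω, V ω * ∏ k ∈ Finset.range n,
        ENNReal.ofReal (Real.exp (-(μ * (H (k + 1) ω * c k ω)))) ∂Pr =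
      ∫⁻ ω, V ω * ∏ k ∈ Finset.range n, ENNReal.ofReal (1 / (1 + c k ω)) ∂Pr := by
  induction n with
  | zero => intro V _; simp
  | succ n ih =>
    intro V hV
    have e1 := lintegral_mul_exp_of_indep h.rate_pos (h.sigma_le (n + 1))
      (h.measurable_fading (n + 1)) (h.fading_law _) (h.indep (n + 1)) (c := c n)
      (V := fun ω => V ω * ∏ k ∈ Finset.range n,
        ENNReal.ofReal (Real.exp (-(μ * (H (k + 1) ω * c k ω))))) (by
        refine (hV.mono le_sup_left le_rfl).mul ?_
        refine Finset.measurable_fun_prod _ fun k hk => ?_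
        have hHk : Measurable[pointSigma φ ⊔ ⨆ k ∈ {k | k ≠ n + 1},
            MeasurableSpace.comap (H k) inferInstance] (H (k + 1)) := by
          refine Measurable.of_comap_le (le_sup_of_le_right ?_)
          refine le_iSup₂_of_le (k + 1) ?_ le_rfl
          have := Finset.mem_range.1 hk
          simp only [mem_ofPred_eq]
          omega
        exact (show Measurable fun t : ℝ => ENNReal.ofReal (Real.exp (-(μ * t))) by
          fun_prop).comp (hHk.mul ((hc k).mono le_sup_left le_rfl)))
      ((hc n).mono le_sup_left le_rfl) (hc0 n)
    have e2 := ih (V := fun ω => V ω * ENNReal.ofReal (1 / (1 + c n ω)))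
      (hV.mul ((show Measurable fun t : ℝ => ENNReal.ofReal (1 / (1 + t)) by fun_prop).comp (hc n)))
    simp_rw [Finset.prod_range_succ]
    refine Eq.trans (lintegral_congr fun ω => ?_) (e1.trans (Eq.trans (lintegral_congr fun ω => ?_)
      (e2.trans (lintegral_congr fun ω => ?_)))) <;> ring

end Cell

/-- The interference from the points other than the nearest one, relative to the path loss of the
nearest one and multiplied by `y`. -/
noncomputable def fadingSum (α y : ℝ) (S : Set Plane) (h : ℕ → ℝ) : ℝ :=
  ∑' k, h (k + 1) * (y * (nthDist S 0 / nthDist S (k + 1)) ^ α)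

theorem measurable_fadingSum {Ω : Type*} {m : MeasurableSpace Ω} {φ : Ω → Set Plane}
    {H : ℕ → Ω → ℝ} (α y : ℝ)
    (hφ : ∀ j, Measurable[m] fun ω => nthDist (φ ω) j)
    (hH : ∀ k, Measurable[m] (H (k + 1))) :
    Measurable[m] fun ω => fadingSum α y (φ ω) fun k => H k ω := by
  refine Measurable.tsum fun k => ?_
  have h0 := hφ 0
  have h1 := hφ (k + 1)
  have h2 := hH k
  fun_prop

section Cell

variable {Ω : Type*} [mΩ : MeasurableSpace Ω] {Pr : Measure Ω}
  {φ : Ω → Set Plane} {H : ℕ → Ω → ℝ} {lam μ α y x : ℝ}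

theorem IsRayleighCell.measurable_nthDist (h : IsRayleighCell Pr φ H lam μ) (j : ℕ) :
    Measurable fun ω => nthDist (φ ω) j := h.poisson.measurable_nthDist j

variable [IsProbabilityMeasure Pr]

theorem IsRayleighCell.ae_regular (h : IsRayleighCell Pr φ H lam μ) (hα : 2 < α) :
    ∀ᵐ ω ∂Pr, (∀ k, 0 < H k ω) ∧ (∀ k, 0 < nthDist (φ ω) k) ∧
      (Summable fun k => H k ω * nthDist (φ ω) k ^ (-α)) ∧
      Summable fun k => nthDist (φ ω) k ^ (-α) := by
  filter_upwards [h.ae_fading_pos, h.ae_summable_received hα, h.poisson.ae_infinite h.lam_pos,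
    h.poisson.ae_nthDist_pos h.lam_pos, h.poisson.ae_summable_nthDist hα h.lam_pos]
    with ω h1 h2 h3 h4 h5
  exact ⟨h1, fun k => h4.trans_le (nthDist_mono (h.poisson.locallyFiniteSet ω) h3 zero_le), h2, h5⟩

/-- The probability that the fading of the nearest point dominates the interference and that the
ratio of the two smallest distances exceeds `1 / x`. -/
theorem IsRayleighCell.measure_ratio_fadingSum (h : IsRayleighCell Pr φ H lam μ) (hα : 2 < α)
    (hy : 0 ≤ y) (hx : 0 < x) (hx1 : x ≤ 1) :
    Pr {ω | nthDist (φ ω) 0 / x < nthDist (φ ω) 1 ∧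
      fadingSum α y (φ ω) (fun k => H k ω) ≤ H 0 ω} = ENNReal.ofReal (cellRate α y x)⁻¹ := by
  have hlf := h.poisson.locallyFiniteSet
  have hr := fun j => measurable_nthDist_pointSigma hlf j
  have hr' := fun j => h.measurable_nthDist j
  let c : ℕ → Ω → ℝ := fun k ω => y * (nthDist (φ ω) 0 / nthDist (φ ω) (k + 1)) ^ α
  have hc : ∀ k, Measurable[pointSigma φ] (c k) := fun k =>
    (show Measurable fun p : ℝ × ℝ => y * (p.1 / p.2) ^ α by fun_prop).comp
      ((hr 0).prodMk (hr (k + 1)))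
  have hc0 : ∀ k ω, 0 ≤ c k ω := fun k ω => mul_nonneg hy
    (Real.rpow_nonneg (div_nonneg (nthDist_nonneg _ _) (nthDist_nonneg _ _)) _)
  let E : Set Ω := {ω | nthDist (φ ω) 0 / x < nthDist (φ ω) 1}
  have hE : MeasurableSet[pointSigma φ] E :=
    (show MeasurableSet {p : ℝ × ℝ | p.1 / x < p.2} from
      measurableSet_lt (by fun_prop) (by fun_prop)).preimage ((hr 0).prodMk (hr 1))
  have hE' : MeasurableSet E := h.poisson.pointSigma_le _ hE
  let V : Ω → ℝ≥0∞ := E.indicator 1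
  have hV : Measurable[pointSigma φ] V := measurable_const.indicator hE
  have hV' : Measurable V := measurable_one.indicator hE'
  have hV1 : ∀ ω, V ω ≤ 1 := fun ω => indicator_le_self' (fun _ _ => zero_le) ω
  let Z : Ω → ℝ := fun ω => fadingSum α y (φ ω) fun k => H k ω
  have hZ : Measurable[pointSigma φ ⊔ ⨆ k ∈ {k | k ≠ 0},
      MeasurableSpace.comap (H k) inferInstance] Z := by
    refine measurable_fadingSum α y (fun j => (hr j).mono le_sup_left le_rfl) fun k => ?_
    refine Measurable.of_comap_le (le_sup_of_le_right ?_)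
    exact le_iSup₂_of_le (k + 1) (Nat.succ_ne_zero k) le_rfl
  have hZ' : Measurable Z := hZ.mono (h.sigma_le 0) le_rfl
  have hsum : ∀ᵐ ω ∂Pr, (∀ k, 0 < H k ω) ∧ (Summable fun k => H (k + 1) ω * c k ω) ∧
      Summable fun k => c k ω := by
    filter_upwards [h.ae_regular hα] with ω ⟨hH, hpos, hs1, hs2⟩
    have e : ∀ k, c k ω = y * nthDist (φ ω) 0 ^ α * nthDist (φ ω) (k + 1) ^ (-α) := by
      intro k
      simp only [c]
      rw [Real.div_rpow (hpos 0).le (hpos _).le, Real.rpow_neg (hpos _).le, mul_assoc,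
        div_eq_mul_inv]
    refine ⟨hH, ?_, ?_⟩
    · refine (((summable_nat_add_iff 1).2 hs1).mul_left (y * nthDist (φ ω) 0 ^ α)).congr
        fun k => ?_
      rw [e]; ring
    · exact (((summable_nat_add_iff 1).2 hs2).mul_left (y * nthDist (φ ω) 0 ^ α)).congr
        fun k => (e k).symm
  have s1 : Pr {ω | nthDist (φ ω) 0 / x < nthDist (φ ω) 1 ∧ Z ω ≤ H 0 ω} =
      ∫⁻ ω, V ω * (Ici (Z ω)).indicator 1 (H 0 ω) ∂Pr := by
    rw [← lintegral_indicator_one]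
    · refine lintegral_congr fun ω => ?_
      by_cases h1 : ω ∈ E <;> by_cases h2 : Z ω ≤ H 0 ω
      · simp [V, indicator, h2, show nthDist (φ ω) 0 / x < nthDist (φ ω) 1 from h1, E]
      · simp [V, indicator, h2]
      · simp [V, indicator, show ¬ nthDist (φ ω) 0 / x < nthDist (φ ω) 1 from h1, E]
      · simp [V, indicator, h2]
    · exact hE'.inter (measurableSet_le hZ' (h.measurable_fading 0))
  have s2 := lintegral_mul_indicator_of_indep h.rate_pos (h.sigma_le 0) (h.measurable_fading 0)
    (h.fading_law 0) (h.indep 0) (hV.mono le_sup_left le_rfl) hZ (by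
      filter_upwards [hsum] with ω hω
      exact tsum_nonneg fun k => mul_nonneg (hω.1 _).le (hc0 k ω))
  -- Finite products approximate both the fading weight here and the distance weight in `s4`. Their
  -- integrals agree for every `n` by `lintegral_prod_exp`, so the limits agree.
  have s3 : Tendsto (fun n => ∫⁻ ω, V ω * ∏ k ∈ Finset.range n,
      ENNReal.ofReal (Real.exp (-(μ * (H (k + 1) ω * c k ω)))) ∂Pr) atTop
      (𝓝 (∫⁻ ω, V ω * ENNReal.ofReal (Real.exp (-(μ * Z ω))) ∂Pr)) := by
    refine tendsto_lintegral_of_dominated_convergence' (fun _ => 1) (fun n => ?_) (fun n => ?_)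
      (by simp) ?_
    · refine (hV'.mul (Finset.measurable_fun_prod _ fun k _ => ?_)).aemeasurable
      have := h.measurable_fading (k + 1)
      have := (hc k).mono h.poisson.pointSigma_le le_rfl
      fun_prop
    · filter_upwards [hsum] with ω hω
      refine mul_le_one' (hV1 ω) (Finset.prod_le_one' fun k _ => ?_)
      rw [ENNReal.ofReal_le_one, Real.exp_le_one_iff, neg_nonpos]
      exact mul_nonneg h.rate_pos.le (mul_nonneg (hω.1 _).le (hc0 k ω))
    · filter_upwards [hsum] with ω hω
      refine ENNReal.Tendsto.const_mul ?_ (Or.inr ((hV1 ω).trans_lt ENNReal.one_lt_top).ne)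
      simp_rw [fun n => (ENNReal.ofReal_prod_of_nonneg (s := Finset.range n)
        (fun k _ => (Real.exp_pos (-(μ * (H (k + 1) ω * c k ω)))).le)).symm, ← Real.exp_sum,
        Finset.sum_neg_distrib, ← Finset.mul_sum]
      refine ENNReal.tendsto_ofReal ((Real.continuous_exp.tendsto _).comp
        (Tendsto.neg (Tendsto.const_mul μ ?_)))
      exact hω.2.1.hasSum.tendsto_sum_nat
  have s4 : Tendsto (fun n => ∫⁻ ω, V ω * ∏ k ∈ Finset.range n,
      ENNReal.ofReal (1 / (1 + c k ω)) ∂Pr) atTop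
      (𝓝 (∫⁻ ω, V ω * ENNReal.ofReal
        (Real.exp (-logSum α y (nthDist (φ ω) 0) (φ ω))) ∂Pr)) := by
    refine tendsto_lintegral_of_dominated_convergence' (fun _ => 1) (fun n => ?_) (fun n => ?_)
      (by simp) ?_
    · refine (hV'.mul (Finset.measurable_fun_prod _ fun k _ => ?_)).aemeasurable
      have := (hc k).mono h.poisson.pointSigma_le le_rfl
      fun_prop
    · refine ae_of_all _ fun ω => mul_le_one' (hV1 ω) (Finset.prod_le_one' fun k _ => ?_)
      have := hc0 k ω
      rw [ENNReal.ofReal_le_one]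
      exact (div_le_one (by positivity)).2 (by linarith)
    · filter_upwards [hsum] with ω hω
      refine ENNReal.Tendsto.const_mul ?_ (Or.inr ((hV1 ω).trans_lt ENNReal.one_lt_top).ne)
      have e : ∀ k, 1 / (1 + c k ω) = Real.exp (-Real.log (1 + c k ω)) := by
        intro k
        have := hc0 k ω
        rw [Real.exp_neg, Real.exp_log (by positivity), one_div]
      simp_rw [e, fun n => (ENNReal.ofReal_prod_of_nonneg (s := Finset.range n)
        (fun k _ => (Real.exp_pos (-Real.log (1 + c k ω))).le)).symm, ← Real.exp_sum,
        Finset.sum_neg_distrib]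
      refine ENNReal.tendsto_ofReal ((Real.continuous_exp.tendsto _).comp (Tendsto.neg ?_))
      have : Summable fun k => Real.log (1 + c k ω) := by
        refine Summable.of_nonneg_of_le (fun k => ?_) (fun k => ?_) hω.2.2
        · exact Real.log_nonneg (le_add_of_nonneg_right (hc0 k ω))
        · have := hc0 k ω
          have := Real.log_le_sub_one_of_pos (show 0 < 1 + c k ω by positivity)
          linarith
      exact this.hasSum.tendsto_sum_nat
  simp_rw [fun n => h.lintegral_prod_exp hc hc0 n hV] at s3
  have s5 := h.poisson.integral_ratio_weight h.lam_pos hα hy hx hx1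
  rw [show {ω | nthDist (φ ω) 0 / x < nthDist (φ ω) 1 ∧
      fadingSum α y (φ ω) (fun k => H k ω) ≤ H 0 ω} =
    {ω | nthDist (φ ω) 0 / x < nthDist (φ ω) 1 ∧ Z ω ≤ H 0 ω} from rfl, s1, s2,
    tendsto_nhds_unique s3 s4, ← s5, ofReal_integral_eq_lintegral_ofReal]
  · refine lintegral_congr fun ω => ?_
    by_cases h1 : nthDist (φ ω) 0 / x < nthDist (φ ω) 1 <;> simp [V, E, h1]
  · refine Integrable.of_bound (C := 1) (Measurable.aestronglyMeasurable ?_)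
      (ae_of_all _ fun ω => ?_)
    · exact Measurable.ite hE' (Real.measurable_exp.comp
        (h.poisson.measurable_logSum α y (hr' 0)).neg) measurable_const
    · have := Real.exp_le_one_iff.2 (neg_nonpos.2 (logSum_nonneg (α := α) hy
        (nthDist_nonneg (φ ω) 0) (φ ω)))
      split_ifs <;> simp [this]
  · refine ae_of_all _ fun ω => ?_
    simp only [Pi.zero_apply]
    split_ifs <;> positivity

/-! ### The law of the ratio of the two smallest distances -/

/-- At `y = 0` the fading condition is almost surely void and the rate is `1 / x²`. The path-loss
exponent then plays no role; `3` is any value above `2`. -/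
theorem IsRayleighCell.measure_lt_ratio (h : IsRayleighCell Pr φ H lam μ)
    (hx : 0 < x) (hx1 : x ≤ 1) :
    Pr {ω | 1 / x < nthDist (φ ω) 1 / nthDist (φ ω) 0} = ENNReal.ofReal (x ^ 2) := by
  have := h.measure_ratio_fadingSum (α := 3) (y := 0) (by norm_num) le_rfl hx hx1
  rw [cellRate, Real.zero_rpow (by norm_num), zero_mul, add_zero, one_div, inv_inv] at this
  rw [← this]
  refine measure_congr ?_
  filter_upwards [h.ae_regular (α := 3) (by norm_num)] with ω hω
  refine propext ?_
  change _ ↔ (_ ∧ _)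
  have h0 := hω.2.1 0
  have hH := (hω.1 0).le
  simp only [fadingSum, zero_mul, mul_zero, tsum_zero, hH, and_true]
  change 1 / x < _ ↔ _
  rw [div_lt_div_iff₀ hx h0, one_mul, div_lt_iff₀ hx]

/-- The ratio of the two smallest distances has no atoms. -/
theorem IsRayleighCell.measure_ratio_eq (h : IsRayleighCell Pr φ H lam μ) (r : ℝ) :
    Pr {ω | nthDist (φ ω) 1 / nthDist (φ ω) 0 = r} = 0 := by
  have hm : Measurable fun ω => nthDist (φ ω) 1 / nthDist (φ ω) 0 :=
    (h.measurable_nthDist 1).div (h.measurable_nthDist 0)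
  rcases le_or_gt r 1 with hr | hr
  · have h1 := h.measure_lt_ratio one_pos le_rfl
    simp only [div_one, one_pow, ENNReal.ofReal_one] at h1
    have h2 := (prob_compl_eq_zero_iff (measurableSet_lt measurable_const hm)).2 h1
    refine measure_mono_null (fun ω (hω : _ = r) => ?_) h2
    simp only [mem_compl_iff, mem_ofPred_eq, hω, not_lt]
    exact hr
  · have hr0 : 0 < r := by linarith
    have key : ∀ n : ℕ, Pr {ω | nthDist (φ ω) 1 / nthDist (φ ω) 0 = r} ≤
        ENNReal.ofReal ((1 / r + (1 - 1 / r) / ((n : ℝ) + 1)) ^ 2) - ENNReal.ofReal ((1 / r) ^ 2) := by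
      intro n
      -- These points decrease to `1 / r` and stay in the unit interval, so the atom is bounded by
      -- the increments `x'² - (1 / r)²`, which tend to zero.
      set x' : ℝ := 1 / r + (1 - 1 / r) / ((n : ℝ) + 1) with hx'
      have hr1 : 1 / r < 1 := by rw [div_lt_one hr0]; exact hr
      have hr2 : 0 < 1 / r := by positivity
      have hn : (1 - 1 / r) / ((n : ℝ) + 1) ≤ 1 - 1 / r :=
        div_le_self (by linarith) (by linarith [(n.cast_nonneg : (0 : ℝ) ≤ n)])
      have hn0 : 0 < (1 - 1 / r) / ((n : ℝ) + 1) := div_pos (by linarith) (by positivity)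
      have hxl : 1 / r < x' := by linarith
      have e1 := h.measure_lt_ratio (x := x') (by linarith) (by linarith)
      have e2 := h.measure_lt_ratio (x := 1 / r) hr2 hr1.le
      rw [one_div_one_div] at e2
      have hlt : 1 / x' < r := by
        rw [div_lt_iff₀ (by linarith)]
        rw [div_lt_iff₀ hr0] at hxl
        linarith
      rw [← e1, ← e2, ← measure_sdiff]
      · refine measure_mono fun ω (hω : _ = r) => ⟨?_, ?_⟩
        · simpa only [mem_ofPred_eq, hω] using hlt
        · simp only [mem_ofPred_eq, hω, lt_self_iff_false, not_false_eq_true]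
      · exact fun ω hω => hlt.trans hω
      · exact (measurableSet_lt measurable_const hm).nullMeasurableSet
      · exact measure_ne_top _ _
    have ht : Tendsto (fun n : ℕ => ENNReal.ofReal ((1 / r + (1 - 1 / r) / ((n : ℝ) + 1)) ^ 2) -
        ENNReal.ofReal ((1 / r) ^ 2)) atTop (𝓝 0) := by
      have t1 := (tendsto_one_div_add_atTop_nhds_zero_nat (𝕜 := ℝ)).const_mul (1 - 1 / r)
      have t2 := ENNReal.tendsto_ofReal (((t1.const_add (1 / r)).pow 2))
      have t3 := ENNReal.Tendsto.sub t2 (tendsto_const_nhds (x := ENNReal.ofReal ((1 / r) ^ 2)))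
        (Or.inl ENNReal.ofReal_ne_top)
      simpa [div_eq_mul_inv] using t3
    exact le_antisymm (ge_of_tendsto' ht key) zero_le

theorem IsRayleighCell.measure_le_ratio (h : IsRayleighCell Pr φ H lam μ)
    (hx : 0 < x) (hx1 : x ≤ 1) :
    Pr {ω | 1 / x ≤ nthDist (φ ω) 1 / nthDist (φ ω) 0} = ENNReal.ofReal (x ^ 2) := by
  rw [← h.measure_lt_ratio hx hx1]
  refine measure_congr ?_
  have h0 := h.measure_ratio_eq (1 / x)
  filter_upwards [measure_eq_zero_iff_ae_notMem.1 h0] with ω hω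
  exact propext ⟨fun hle => lt_of_le_of_ne hle fun he => hω he.symm, fun hlt => le_of_lt hlt⟩

theorem IsRayleighCell.measure_le_ratio_fadingSum (h : IsRayleighCell Pr φ H lam μ) (hα : 2 < α)
    (hy : 0 ≤ y) (hx : 0 < x) (hx1 : x ≤ 1) :
    Pr {ω | 1 / x ≤ nthDist (φ ω) 1 / nthDist (φ ω) 0 ∧
      fadingSum α y (φ ω) (fun k => H k ω) ≤ H 0 ω} = ENNReal.ofReal (cellRate α y x)⁻¹ := by
  rw [← h.measure_ratio_fadingSum hα hy hx hx1]
  refine measure_congr ?_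
  filter_upwards [measure_eq_zero_iff_ae_notMem.1 (h.measure_ratio_eq (1 / x)),
    h.ae_regular hα] with ω hω hreg
  have h0 := hreg.2.1 0
  refine propext (and_congr_left fun _ => ?_)
  have e : nthDist (φ ω) 0 / x < nthDist (φ ω) 1 ↔
      1 / x < nthDist (φ ω) 1 / nthDist (φ ω) 0 := by
    rw [div_lt_div_iff₀ hx h0, one_mul, div_lt_iff₀ hx]
  rw [e]
  exact ⟨fun hle => lt_of_le_of_ne hle fun he => hω he.symm, fun hlt => le_of_lt hlt⟩

end Cell

/-! ### The SIR and the network of independent technologies -/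

/-- The signal to interference ratio of the nearest point, for the path loss `r ^ (-α)`. -/
noncomputable def sir (α : ℝ) (S : Set Plane) (h : ℕ → ℝ) : ℝ :=
  h 0 * nthDist S 0 ^ (-α) / ∑' k, h (k + 1) * nthDist S (k + 1) ^ (-α)

/-- Positive interference allows multiplying out the quotient; factoring `r₁ ^ α` into the series
gives the relative distances. For zero interference Lean's quotient would be `0`, hence the
hypothesis. -/
theorem le_sir_iff {α y : ℝ} {S : Set Plane} {h : ℕ → ℝ} (hr : ∀ k, 0 < nthDist S k)
    (hI : 0 < ∑' k, h (k + 1) * nthDist S (k + 1) ^ (-α)) :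
    y ≤ sir α S h ↔ fadingSum α y S h ≤ h 0 := by
  have e : fadingSum α y S h =
      y * nthDist S 0 ^ α * ∑' k, h (k + 1) * nthDist S (k + 1) ^ (-α) := by
    rw [fadingSum, ← tsum_mul_left]
    refine tsum_congr fun k => ?_
    rw [Real.div_rpow (hr 0).le (hr _).le, Real.rpow_neg (hr _).le]
    ring
  have h0 : 0 < nthDist S 0 ^ α := Real.rpow_pos_of_pos (hr 0) _
  rw [sir, le_div_iff₀ hI, e, Real.rpow_neg (hr 0).le, ← div_eq_mul_inv, le_div_iff₀ h0]
  refine iff_of_eq (congrArg (· ≤ h 0) ?_)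
  ring

/-- Positive natural numbers as successors. -/
def succEquiv : ℕ ≃ {k : ℕ // k ≠ 0} where
  toFun n := ⟨n + 1, n.succ_ne_zero⟩
  invFun k := k.1 - 1
  left_inv n := by simp
  right_inv k := Subtype.ext (Nat.succ_pred_eq_of_ne_zero k.2)

section Network

variable {Ω : Type*} [mΩ : MeasurableSpace Ω] {Pr : Measure Ω} {T : ℕ} {φ : Fin T → Ω → Set Plane}
  {H : Fin T → ℕ → Ω → ℝ} {lam Pw N₀ : Fin T → ℝ} {l : Fin T → ℝ → ℝ} {μ α : ℝ}

/-- The independent sigma-algebras generating a network. -/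
@[reducible] noncomputable def netSigma (φ : Fin T → Ω → Set Plane) (H : Fin T → ℕ → Ω → ℝ) :
    Fin T ⊕ Fin T × ℕ → MeasurableSpace Ω :=
  Sum.elim (fun i : Fin T => pointSigma (φ i))
    (fun p : Fin T × ℕ => MeasurableSpace.comap (H p.1 p.2) inferInstance)

theorem IsRayleighPoissonNetwork.netSigma_le (h : IsRayleighPoissonNetwork Pr φ H lam μ)
    (p : Fin T ⊕ Fin T × ℕ) : netSigma φ H p ≤ mΩ := by
  rcases p with i | p
  · exact (h.poisson i).pointSigma_le
  · exact (h.measurable_fading p.1 p.2).comap_le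

theorem IsRayleighPoissonNetwork.cell (h : IsRayleighPoissonNetwork Pr φ H lam μ)
    (hlam : ∀ i, 0 < lam i) (hμ : 0 < μ) (i : Fin T) :
    IsRayleighCell Pr (φ i) (H i) (lam i) μ where
  lam_pos := hlam i
  rate_pos := hμ
  poisson := h.poisson i
  measurable_fading := h.measurable_fading i
  fading_law := h.fading_law i
  indep j := by
    have hd : Disjoint ({Sum.inr (i, j)} : Set (Fin T ⊕ Fin T × ℕ))
        ({Sum.inl i} ∪ {p | ∃ k, k ≠ j ∧ p = Sum.inr (i, k)}) := by
      rw [Set.disjoint_singleton_left]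
      rintro (hh | ⟨k, hk, hh⟩)
      · simp at hh
      · simp only [Sum.inr.injEq, Prod.mk.injEq, true_and] at hh
        exact hk hh.symm
    have hi := indep_iSup_of_disjoint h.netSigma_le h.indep hd
    refine indep_of_indep_of_le_left (indep_of_indep_of_le_right hi (sup_le ?_ ?_)) ?_
    · exact le_iSup₂_of_le (f := fun p _ => netSigma φ H p) (Sum.inl i) (Or.inl rfl) le_rfl
    · exact iSup₂_le fun k hk => le_iSup₂_of_le (f := fun p _ => netSigma φ H p) (Sum.inr (i, k))
        (Or.inr ⟨k, hk, rfl⟩) le_rfl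
    · exact le_iSup₂_of_le (f := fun p _ => netSigma φ H p) (Sum.inr (i, j)) rfl le_rfl

/-- The sigma-algebra of one technology. -/
@[reducible] noncomputable def techSigma (φ : Fin T → Ω → Set Plane) (H : Fin T → ℕ → Ω → ℝ) (i : Fin T) :
    MeasurableSpace Ω :=
  pointSigma (φ i) ⊔ ⨆ k, MeasurableSpace.comap (H i k) inferInstance

/-- The process and fadings of one technology and the processes of the others come from disjoint
index sets of the jointly independent family. The fadings of the others are not needed, since the
policy sees only ratios. -/
theorem IsRayleighPoissonNetwork.indep_techSigma (h : IsRayleighPoissonNetwork Pr φ H lam μ)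
    (i : Fin T) : Indep (techSigma φ H i) (⨆ j ∈ {j | j ≠ i}, pointSigma (φ j)) Pr := by
  have hd : Disjoint ({Sum.inl i} ∪ {p | ∃ k, p = Sum.inr (i, k)} : Set (Fin T ⊕ Fin T × ℕ))
      {p | ∃ j, j ≠ i ∧ p = Sum.inl j} := by
    rw [Set.disjoint_left]
    rintro p (rfl | ⟨k, rfl⟩) ⟨j, hj, hh⟩
    · exact hj (Sum.inl.inj hh).symm
    · simp at hh
  have hi := indep_iSup_of_disjoint h.netSigma_le h.indep hd
  refine indep_of_indep_of_le_left (indep_of_indep_of_le_right hi ?_) (sup_le ?_ ?_)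
  · exact iSup₂_le fun j hj => le_iSup₂_of_le (f := fun p _ => netSigma φ H p) (Sum.inl j)
      ⟨j, hj, rfl⟩ le_rfl
  · exact le_iSup₂_of_le (f := fun p _ => netSigma φ H p) (Sum.inl i) (Or.inl rfl) le_rfl
  · exact iSup_le fun k => le_iSup₂_of_le (f := fun p _ => netSigma φ H p) (Sum.inr (i, k))
      (Or.inr ⟨k, rfl⟩) le_rfl

theorem measurable_distRatio_pointSigma {Ω : Type*} {φ : Fin T → Ω → Set Plane} (i : Fin T)
    (hφ : ∀ ω, LocallyFiniteSet (φ i ω)) :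
    Measurable[pointSigma (φ i)] (distRatio φ i) :=
  (show Measurable fun p : ℝ × ℝ => p.1 / p.2 by fun_prop).comp
    ((measurable_nthDist_pointSigma hφ 1).prodMk (measurable_nthDist_pointSigma hφ 0))

theorem measurable_sir {Ω : Type*} {m : MeasurableSpace Ω} {φ : Ω → Set Plane}
    {H : ℕ → Ω → ℝ} (α : ℝ) (hφ : ∀ j, Measurable[m] fun ω => nthDist (φ ω) j)
    (hH : ∀ k, Measurable[m] (H k)) :
    Measurable[m] fun ω => sir α (φ ω) fun k => H k ω := by
  unfold sir
  refine Measurable.div (by fun_prop) (Measurable.tsum fun k => by fun_prop)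

theorem IsRayleighPoissonNetwork.measurable_sir_techSigma
    (h : IsRayleighPoissonNetwork Pr φ H lam μ) (i : Fin T) :
    Measurable[techSigma φ H i] fun ω => sir α (φ i ω) fun k => H i k ω :=
  measurable_sir α
    (fun j => (measurable_nthDist_pointSigma (h.poisson i).locallyFiniteSet j).mono
      le_sup_left le_rfl)
    (fun k => Measurable.of_comap_le (le_sup_of_le_right
      (le_iSup (fun k => MeasurableSpace.comap (H i k) inferInstance) k)))

theorem IsRayleighPoissonNetwork.techSigma_le (h : IsRayleighPoissonNetwork Pr φ H lam μ)
    (i : Fin T) : techSigma φ H i ≤ mΩ :=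
  sup_le (h.poisson i).pointSigma_le (iSup_le fun k => (h.measurable_fading i k).comap_le)

theorem IsRayleighPoissonNetwork.measurable_distRatio (h : IsRayleighPoissonNetwork Pr φ H lam μ)
    (i : Fin T) : Measurable (distRatio φ i) :=
  (measurable_distRatio_pointSigma i (h.poisson i).locallyFiniteSet).mono
    (h.poisson i).pointSigma_le le_rfl

theorem IsRayleighPoissonNetwork.measurable_sir_net (h : IsRayleighPoissonNetwork Pr φ H lam μ)
    (i : Fin T) : Measurable fun ω => sir α (φ i ω) fun k => H i k ω :=
  (h.measurable_sir_techSigma i).mono (h.techSigma_le i) le_rfl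

/-- The event that technology `i` has the largest ratio. -/
def bestSet (φ : Fin T → Ω → Set Plane) (i : Fin T) : Set Ω :=
  {ω | ∀ j, distRatio φ j ω ≤ distRatio φ i ω}

theorem IsRayleighPoissonNetwork.measurableSet_bestSet
    (h : IsRayleighPoissonNetwork Pr φ H lam μ) (i : Fin T) : MeasurableSet (bestSet φ i) := by
  have : bestSet φ i = ⋂ j, {ω | distRatio φ j ω ≤ distRatio φ i ω} := by
    ext ω; simp [bestSet]
  rw [this]
  exact MeasurableSet.iInter fun j =>
    measurableSet_le (h.measurable_distRatio j) (h.measurable_distRatio i)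

variable [IsProbabilityMeasure Pr]

/-- Where distances and fadings are positive and the received powers summable, every series is a
genuine sum; the transmit power factors out and cancels in the quotient. -/
theorem IsRayleighPoissonNetwork.ae_interference (h : IsRayleighPoissonNetwork Pr φ H lam μ)
    (hlam : ∀ i, 0 < lam i) (hμ : 0 < μ) (hα : 2 < α) (hPw : ∀ i, 0 < Pw i)
    (hl : ∀ i, ∀ r : ℝ, 0 < r → l i r = r ^ (-α)) (i : Fin T) :
    ∀ᵐ ω ∂Pr, Summable (fun k : {k : ℕ // k ≠ 0} => receivedPower φ H Pw l i k ω) ∧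
      0 < interference φ H Pw l i 0 ω ∧ 0 ≤ sir α (φ i ω) (fun k => H i k ω) ∧
      (∀ N₀ : Fin T → ℝ, N₀ i = 0 →
        sinr φ H Pw N₀ l i 0 ω = sir α (φ i ω) fun k => H i k ω) ∧
      ∀ y, y ≤ sir α (φ i ω) (fun k => H i k ω) ↔
        fadingSum α y (φ i ω) (fun k => H i k ω) ≤ H i 0 ω := by
  filter_upwards [(h.cell hlam hμ i).ae_regular hα] with ω ⟨hH, hr, hs, _⟩
  have hs1 := (summable_nat_add_iff 1).2 hs
  have hterm : ∀ k, 0 < H i k ω * nthDist (φ i ω) k ^ (-α) := fun k =>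
    mul_pos (hH k) (Real.rpow_pos_of_pos (hr k) _)
  have hI : 0 < ∑' k, H i (k + 1) ω * nthDist (φ i ω) (k + 1) ^ (-α) :=
    hs1.tsum_pos (fun k => (hterm _).le) 0 (hterm _)
  have e : ∀ k, receivedPower φ H Pw l i k ω =
      Pw i * (H i k ω * nthDist (φ i ω) k ^ (-α)) := fun k => by
    rw [receivedPower, hl i _ (hr k), mul_assoc]
  have hint : interference φ H Pw l i 0 ω =
      Pw i * ∑' k, H i (k + 1) ω * nthDist (φ i ω) (k + 1) ^ (-α) := by
    rw [interference, ← succEquiv.tsum_eq, ← tsum_mul_left]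
    exact tsum_congr fun k => e (k + 1)
  refine ⟨?_, ?_, ?_, fun N₀ hN => ?_, fun y => le_sir_iff hr hI⟩
  · rw [← succEquiv.summable_iff]
    exact (hs1.mul_left (Pw i)).congr fun k => (e (k + 1)).symm
  · rw [hint]; exact mul_pos (hPw i) hI
  · exact div_nonneg (hterm 0).le hI.le
  · rw [sinr, hN, zero_add, hint, e, mul_div_mul_left _ _ (hPw i).ne', sir]

/-- Two independent variables, one of them without atoms, almost surely differ. This makes the
tie-breaking rule irrelevant. -/
theorem IsRayleighPoissonNetwork.ae_distRatio_ne (h : IsRayleighPoissonNetwork Pr φ H lam μ)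
    (hlam : ∀ i, 0 < lam i) (hμ : 0 < μ) {i j : Fin T} (hij : i ≠ j) :
    ∀ᵐ ω ∂Pr, distRatio φ i ω ≠ distRatio φ j ω := by
  have mi := h.measurable_distRatio i
  have mj := h.measurable_distRatio j
  have hind : IndepFun (distRatio φ i) (distRatio φ j) Pr := by
    refine (IndepFun_iff_Indep _ _ _).2 (indep_of_indep_of_le_left (indep_of_indep_of_le_right
      (h.indep_techSigma i) ?_) ?_)
    · exact (measurable_distRatio_pointSigma j (h.poisson j).locallyFiniteSet).comap_le.trans
        (le_iSup₂_of_le (f := fun j _ => pointSigma (φ j)) j hij.symm le_rfl)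
    · exact (measurable_distRatio_pointSigma i (h.poisson i).locallyFiniteSet).comap_le.trans
        le_sup_left
  have hG : Measurable (Function.uncurry fun t v : ℝ => ({v} : Set ℝ).indicator (1 : ℝ → ℝ≥0∞) t) := by
    have : (Function.uncurry fun t v : ℝ => ({v} : Set ℝ).indicator (1 : ℝ → ℝ≥0∞) t) =
        {q : ℝ × ℝ | q.1 = q.2}.indicator 1 := by
      ext ⟨t, v⟩
      simp [indicator_apply]
    rw [this]
    exact measurable_one.indicator (measurableSet_eq_fun measurable_fst measurable_snd)
  have key := lintegral_of_indep mi mj hind hG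
  have hz : ∀ v, ∫⁻ t, ({v} : Set ℝ).indicator (1 : ℝ → ℝ≥0∞) t ∂Pr.map (distRatio φ i) = 0 := by
    intro v
    rw [lintegral_indicator_one (measurableSet_singleton v),
      Measure.map_apply mi (measurableSet_singleton v)]
    exact (h.cell hlam hμ i).measure_ratio_eq v
  simp_rw [hz, lintegral_zero] at key
  have e : ∀ ω, ({distRatio φ j ω} : Set ℝ).indicator (1 : ℝ → ℝ≥0∞) (distRatio φ i ω) =
      {ω | distRatio φ i ω = distRatio φ j ω}.indicator 1 ω := by
    intro ω
    simp [indicator_apply]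
  simp_rw [e] at key
  rw [lintegral_indicator_one (measurableSet_eq_fun mi mj)] at key
  exact measure_eq_zero_iff_ae_notMem.1 key

/-- Without ties exactly one indicator in the sum is nonzero, that of the selected technology. -/
theorem IsRayleighPoissonNetwork.experienced_ae_eq (h : IsRayleighPoissonNetwork Pr φ H lam μ)
    (hlam : ∀ i, 0 < lam i) (hμ : 0 < μ) (hα : 2 < α) (hPw : ∀ i, 0 < Pw i)
    (hl : ∀ i, ∀ r : ℝ, 0 < r → l i r = r ^ (-α)) (hN₀ : ∀ i, N₀ i = 0)
    {π : Ω → Fin T × ℕ} (hπ : IsMaxRatioPolicy φ Pr π) (p : Fin T → ℝ → ℝ) :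
    experienced φ H Pw N₀ l p π =ᵐ[Pr] fun ω =>
      ∑ i, (bestSet φ i).indicator (fun ω => p i (sir α (φ i ω) fun k => H i k ω)) ω := by
  have h1 : ∀ᵐ ω ∂Pr, ∀ i, sinr φ H Pw N₀ l i 0 ω = sir α (φ i ω) fun k => H i k ω := by
    rw [ae_all_iff]
    intro i
    filter_upwards [h.ae_interference hlam hμ hα hPw hl i] with ω hω
    exact hω.2.2.2.1 N₀ (hN₀ i)
  have h2 : ∀ᵐ ω ∂Pr, ∀ i j, i ≠ j → distRatio φ i ω ≠ distRatio φ j ω := by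
    simp_rw [ae_all_iff]
    exact fun i j hij => h.ae_distRatio_ne hlam hμ hij
  filter_upwards [h1, h2, hπ.argmax, hπ.nearest] with ω hs hne hmax hnear
  rw [Finset.sum_eq_single (π ω).1]
  · rw [indicator_of_mem (show ω ∈ bestSet φ (π ω).1 from hmax), experienced, hnear, hs]
  · intro i _ hi
    refine indicator_of_notMem (fun hmem => ?_) _
    exact hne i _ hi (le_antisymm (hmax i) (hmem _))
  · intro hn; exact absurd (Finset.mem_univ _) hn

end Network

/-! ### Coverage on the event that a given technology is selected -/

/-- The parameter-dependent lower limit is moved into an indicator, so that measurability of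
parametric integrals applies. -/
theorem stronglyMeasurable_phi (α : ℝ) :
    StronglyMeasurable fun p : ℝ × ℝ => phi α p.2 p.1 := by
  have hset : MeasurableSet {q : (ℝ × ℝ) × ℝ | q.1.2 ^ (-2 / α) ≤ q.2} :=
    measurableSet_le (by fun_prop) (by fun_prop)
  have hf : Measurable fun q : (ℝ × ℝ) × ℝ =>
      {q : (ℝ × ℝ) × ℝ | q.1.2 ^ (-2 / α) ≤ q.2}.indicator
        (fun q => 1 / (1 + q.1.1 ^ (-α) * q.2 ^ (α / 2))) q :=
    Measurable.indicator (by fun_prop) hset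
  have := hf.stronglyMeasurable.integral_prod_right' (ν := (volume : Measure ℝ))
  refine (congrArg StronglyMeasurable (funext fun p => ?_)).mp this
  rw [phi, ← integral_indicator measurableSet_Ici]
  rfl

/-- The integrand of the performance formulas. -/
noncomputable def kernel (α : ℝ) (T : ℕ) (x y : ℝ) : ℝ :=
  2 * ((T : ℝ) - 1) * x ^ 3 * (1 - x ^ 2) ^ (T - 2) / (1 + y ^ (2 / α) * phi α y x)

theorem measurable_kernel (α : ℝ) (T : ℕ) : Measurable fun p : ℝ × ℝ => kernel α T p.1 p.2 := by
  have := (stronglyMeasurable_phi α).measurable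
  unfold kernel
  fun_prop

theorem kernel_nonneg {α : ℝ} {T : ℕ} (hT : 2 ≤ T) {x y : ℝ} (hy : 0 ≤ y) (hx : 0 ≤ x)
    (hx1 : x ≤ 1) : 0 ≤ kernel α T x y := by
  have h1 := phi_nonneg (α := α) hy hx
  have h2 : 0 ≤ 1 - x ^ 2 := by nlinarith
  have h3 : (0 : ℝ) ≤ (T : ℝ) - 1 := by
    have : (2 : ℝ) ≤ T := by exact_mod_cast hT
    linarith
  unfold kernel
  positivity

/-- The density of the minimum of the variables `r₁ / r₂` of the other technologies. -/
noncomputable def minDensity (T : ℕ) (u : ℝ) : ℝ :=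
  2 * ((T : ℝ) - 1) * u * (1 - u ^ 2) ^ (T - 2)

theorem kernel_eq (α : ℝ) (T : ℕ) (x y : ℝ) :
    kernel α T x y = minDensity T x * (cellRate α y x)⁻¹ := by
  rw [kernel, minDensity, cellRate, inv_div]
  ring

theorem minDensity_nonneg {T : ℕ} (hT : 2 ≤ T) {u : ℝ} (hu : 0 ≤ u) (hu1 : u ≤ 1) :
    0 ≤ minDensity T u := by
  have h2 : 0 ≤ 1 - u ^ 2 := by nlinarith
  have h3 : (0 : ℝ) ≤ (T : ℝ) - 1 := by
    have : (2 : ℝ) ≤ T := by exact_mod_cast hT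
    linarith
  unfold minDensity
  positivity

theorem continuous_minDensity (T : ℕ) : Continuous (minDensity T) := by
  unfold minDensity; fun_prop

/-- An antiderivative is `-(1 - u²) ^ (T - 1)`. -/
theorem integral_minDensity {T : ℕ} (hT : 2 ≤ T) (b : ℝ) :
    ∫ u in (0 : ℝ)..b, minDensity T u = 1 - (1 - b ^ 2) ^ (T - 1) := by
  obtain ⟨n, rfl⟩ : ∃ n, T = n + 2 := ⟨T - 2, by omega⟩
  have hder : ∀ u : ℝ, HasDerivAt (fun u : ℝ => -(1 - u ^ 2) ^ (n + 1)) (minDensity (n + 2) u) u := by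
    intro u
    have h1 : HasDerivAt (fun u : ℝ => 1 - u ^ 2) (-(2 * u)) u := by
      simpa using (hasDerivAt_pow 2 u).const_sub 1
    have h2 := (h1.fun_pow (n + 1)).fun_neg
    refine h2.congr_deriv ?_
    rw [minDensity]
    simp only [Nat.add_sub_cancel]
    push_cast
    ring
  rw [intervalIntegral.integral_eq_sub_of_hasDerivAt (fun u _ => hder u)
    ((continuous_minDensity _).intervalIntegrable _ _)]
  simp only [show n + 2 - 1 = n + 1 from rfl]
  norm_num
  ring

/-- The law with density `minDensity` on the unit interval. -/
noncomputable def minLaw (T : ℕ) : Measure ℝ :=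
  (volume.restrict (Ioc 0 1)).withDensity fun u => ENNReal.ofReal (minDensity T u)

theorem minLaw_Iic {T : ℕ} (hT : 2 ≤ T) (u : ℝ) :
    minLaw T (Iic u) = ENNReal.ofReal (1 - (1 - (max 0 (min 1 u)) ^ 2) ^ (T - 1)) := by
  -- Clamping `u` to the unit interval gives one formula for the distribution function on the whole
  -- line.
  have hb0 : (0 : ℝ) ≤ max 0 (min 1 u) := le_max_left _ _
  have hb1 : max 0 (min 1 u) ≤ 1 := max_le zero_le_one (min_le_left _ _)
  have hset : Iic u ∩ Ioc 0 1 = Ioc 0 (max 0 (min 1 u)) := by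
    ext v
    simp only [mem_inter_iff, mem_Iic, mem_Ioc, le_max_iff, le_min_iff]
    constructor
    · rintro ⟨h1, h2, h3⟩; exact ⟨h2, Or.inr ⟨h3, h1⟩⟩
    · rintro ⟨h2, h3 | ⟨h3, h4⟩⟩
      · exact absurd h2 (not_lt.2 h3)
      · exact ⟨h4, h2, h3⟩
  rw [minLaw, withDensity_apply _ measurableSet_Iic, Measure.restrict_restrict measurableSet_Iic,
    hset, ← integral_minDensity hT, intervalIntegral.integral_of_le hb0,
    ofReal_integral_eq_lintegral_ofReal]
  · exact ((continuous_minDensity T).integrableOn_Icc).mono_set Ioc_subset_Icc_self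
  · filter_upwards [ae_restrict_mem measurableSet_Ioc] with v hv
    exact minDensity_nonneg hT hv.1.le (hv.2.trans hb1)

section Network

/-- The largest ratio among the technologies other than `i`. -/
noncomputable def maxOther {Ω : Type*} {T : ℕ} (φ : Fin T → Ω → Set Plane) (i : Fin T)
    (hne : (Finset.univ.erase i).Nonempty) (ω : Ω) : ℝ :=
  (Finset.univ.erase i).sup' hne fun j => distRatio φ j ω

theorem univ_erase_nonempty {T : ℕ} (hT : 2 ≤ T) (i : Fin T) :
    ((Finset.univ : Finset (Fin T)).erase i).Nonempty := by
  rw [← Finset.card_pos, Finset.card_erase_of_mem (Finset.mem_univ _), Finset.card_univ,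
    Fintype.card_fin]
  omega

theorem measurable_maxOther {Ω : Type*} {m : MeasurableSpace Ω} {T : ℕ}
    {φ : Fin T → Ω → Set Plane} {i : Fin T} (hne : (Finset.univ.erase i).Nonempty)
    (h : ∀ j, j ≠ i → Measurable[m] (distRatio φ j)) : Measurable[m] (maxOther φ i hne) := by
  have := Finset.measurable_sup' hne (f := fun j ω => distRatio φ j ω)
    (fun j hj => h j (Finset.ne_of_mem_erase hj))
  refine (congrArg (Measurable[m]) (funext fun ω => ?_)).mp this
  simp [maxOther]

theorem mem_bestSet_iff {Ω : Type*} {T : ℕ} {φ : Fin T → Ω → Set Plane} {i : Fin T}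
    (hne : (Finset.univ.erase i).Nonempty) (ω : Ω) :
    ω ∈ bestSet φ i ↔ maxOther φ i hne ω ≤ distRatio φ i ω := by
  rw [maxOther, Finset.sup'_le_iff]
  refine ⟨fun h j _ => h j, fun h j => ?_⟩
  by_cases hj : j = i
  · rw [hj]
  · exact h j (Finset.mem_erase.2 ⟨hj, Finset.mem_univ _⟩)

variable {Ω : Type*} [mΩ : MeasurableSpace Ω] {Pr : Measure Ω} {T : ℕ} {φ : Fin T → Ω → Set Plane}
  {H : Fin T → ℕ → Ω → ℝ} {lam : Fin T → ℝ} {μ α : ℝ} [IsProbabilityMeasure Pr]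

theorem IsRayleighPoissonNetwork.ae_one_lt_distRatio (h : IsRayleighPoissonNetwork Pr φ H lam μ)
    (hlam : ∀ i, 0 < lam i) (hμ : 0 < μ) (i : Fin T) : ∀ᵐ ω ∂Pr, 1 < distRatio φ i ω := by
  have := (h.cell hlam hμ i).measure_lt_ratio one_pos le_rfl
  simp only [div_one, one_pow, ENNReal.ofReal_one] at this
  exact (prob_compl_eq_zero_iff (measurableSet_lt measurable_const (h.measurable_distRatio i))).2
    this

/-- The maximum stays below `1 / u` when each of the `T - 1` independent ratios does, each with
probability `1 - u²`; the reciprocal of the maximum thus has the distribution function of `minLaw`.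
-/
theorem IsRayleighPoissonNetwork.map_maxOther (h : IsRayleighPoissonNetwork Pr φ H lam μ)
    (hlam : ∀ i, 0 < lam i) (hμ : 0 < μ) (hT : 2 ≤ T) (i : Fin T)
    (hne : (Finset.univ.erase i).Nonempty) :
    Pr.map (fun ω => 1 / maxOther φ i hne ω) = minLaw T := by
  have hm := measurable_maxOther hne fun j _ => h.measurable_distRatio j
  have hmi : Measurable fun ω => 1 / maxOther φ i hne ω := by fun_prop
  have hgt : ∀ᵐ ω ∂Pr, 1 < maxOther φ i hne ω := by
    obtain ⟨j, hj⟩ := hne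
    filter_upwards [h.ae_one_lt_distRatio hlam hμ j] with ω hω
    exact (Finset.lt_sup'_iff _).2 ⟨j, hj, hω⟩
  have hlt : ∀ u : ℝ, 0 < u → u ≤ 1 →
      Pr {ω | maxOther φ i hne ω < 1 / u} = ENNReal.ofReal ((1 - u ^ 2) ^ (T - 1)) := by
    intro u hu hu1
    have hind : iIndepFun (fun j => distRatio φ j) Pr := by
      have h1 := h.indep.precomp (g := fun j : Fin T => (Sum.inl j : Fin T ⊕ Fin T × ℕ))
        Sum.inl_injective
      rw [iIndepFun_iff_iIndep]
      refine iIndep_of_iIndep_of_le h1 fun j => ?_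
      exact (measurable_distRatio_pointSigma j (h.poisson j).locallyFiniteSet).comap_le
    have e : {ω | maxOther φ i hne ω < 1 / u} =
        ⋂ j ∈ Finset.univ.erase i, distRatio φ j ⁻¹' Iio (1 / u) := by
      ext ω
      simp only [maxOther, mem_ofPred_eq, Finset.sup'_lt_iff, mem_iInter, mem_preimage, mem_Iio]
    rw [e, hind.measure_inter_preimage_eq_mul _ (fun _ _ => measurableSet_Iio)]
    have e2 : ∀ j, Pr (distRatio φ j ⁻¹' Iio (1 / u)) = ENNReal.ofReal (1 - u ^ 2) := by
      intro j
      have h1 := (h.cell hlam hμ j).measure_le_ratio hu hu1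
      have h2 : distRatio φ j ⁻¹' Iio (1 / u) =
          {ω | 1 / u ≤ nthDist (φ j ω) 1 / nthDist (φ j ω) 0}ᶜ := by
        ext ω
        simp only [mem_preimage, mem_Iio, mem_compl_iff, mem_ofPred_eq, not_le]
        rfl
      rw [h2, prob_compl_eq_one_sub, h1, ← ENNReal.ofReal_one, ENNReal.ofReal_sub _ (by positivity)]
      exact measurableSet_le measurable_const (h.measurable_distRatio j)
    simp_rw [e2]
    rw [Finset.prod_const, Finset.card_erase_of_mem (Finset.mem_univ _), Finset.card_univ,
      Fintype.card_fin, ENNReal.ofReal_pow]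
    nlinarith
  have p1 : IsProbabilityMeasure (Pr.map fun ω => 1 / maxOther φ i hne ω) :=
    Measure.isProbabilityMeasure_map hmi.aemeasurable
  refine Measure.ext_of_Iic _ _ fun u => ?_
  rw [minLaw_Iic hT, Measure.map_apply hmi measurableSet_Iic]
  have hT1 : T - 1 ≠ 0 := by omega
  rcases le_or_gt u 0 with hu | hu
  · rw [max_eq_left ((min_le_right _ _).trans hu)]
    simp only [ne_eq, OfNat.ofNat_ne_zero, not_false_eq_true, zero_pow, sub_zero, one_pow,
      sub_self, ENNReal.ofReal_zero]
    rw [measure_eq_zero_iff_ae_notMem]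
    filter_upwards [hgt] with ω hω hmem
    have : 0 < 1 / maxOther φ i hne ω := by positivity
    exact absurd (lt_of_lt_of_le this (hmem.trans hu)) (lt_irrefl _)
  · rw [max_eq_right (le_min zero_le_one hu.le)]
    have hset : (fun ω => 1 / maxOther φ i hne ω) ⁻¹' Iic u =ᵐ[Pr]
        ({ω | maxOther φ i hne ω < 1 / min 1 u}ᶜ : Set Ω) := by
      filter_upwards [hgt] with ω hω
      change (ω ∈ (fun ω => 1 / maxOther φ i hne ω) ⁻¹' Iic u) =
        (ω ∈ ({ω | maxOther φ i hne ω < 1 / min 1 u}ᶜ : Set Ω))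
      rw [eq_iff_iff, mem_preimage, mem_Iic, mem_compl_iff, mem_ofPred_eq]
      have hY : 0 < maxOther φ i hne ω := by linarith
      rw [not_lt, one_div_le hY hu]
      rcases le_total u 1 with h1 | h1
      · rw [min_eq_right h1]
      · rw [min_eq_left h1, div_one]
        refine iff_of_true (le_trans ?_ hω.le) hω.le
        rw [div_le_one hu]; exact h1
    have hu0 : 0 < min 1 u := lt_min one_pos hu
    rw [measure_congr hset, prob_compl_eq_one_sub (measurableSet_lt hm measurable_const),
      hlt _ hu0 (min_le_left _ _), ← ENNReal.ofReal_one, ENNReal.ofReal_sub]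
    refine pow_nonneg ?_ _
    have := min_le_left 1 u
    nlinarith

/-- The probability that technology `i` is chosen and its signal to interference ratio is at least
`y`. -/
theorem IsRayleighPoissonNetwork.measure_bestSet_sir (h : IsRayleighPoissonNetwork Pr φ H lam μ)
    (hlam : ∀ i, 0 < lam i) (hμ : 0 < μ) (hα : 2 < α) (hT : 2 ≤ T) (i : Fin T) {y : ℝ}
    (hy : 0 ≤ y) :
    Pr ({ω | y ≤ sir α (φ i ω) fun k => H i k ω} ∩ bestSet φ i) =
      ∫⁻ x in Ioc (0 : ℝ) 1, ENNReal.ofReal (kernel α T x y) := by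
  have hne := univ_erase_nonempty hT i
  set Y := maxOther φ i hne with hY
  have hYs : Measurable[⨆ j ∈ {j | j ≠ i}, pointSigma (φ j)] Y :=
    measurable_maxOther hne fun j hj =>
      (measurable_distRatio_pointSigma j (h.poisson j).locallyFiniteSet).mono
        (le_iSup₂_of_le (f := fun j _ => pointSigma (φ j)) j hj le_rfl) le_rfl
  have hYm : Measurable Y := measurable_maxOther hne fun j _ => h.measurable_distRatio j
  have hXs : Measurable[techSigma φ H i] fun ω =>
      (distRatio φ i ω, sir α (φ i ω) fun k => H i k ω) :=
    ((measurable_distRatio_pointSigma i (h.poisson i).locallyFiniteSet).mono le_sup_left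
      le_rfl).prodMk (h.measurable_sir_techSigma i)
  have hXm := hXs.mono (h.techSigma_le i) le_rfl
  have hind : IndepFun (fun ω => (distRatio φ i ω, sir α (φ i ω) fun k => H i k ω))
      (fun ω => 1 / Y ω) Pr := by
    refine IndepFun.comp (φ := id) (ψ := fun t : ℝ => 1 / t) ?_ measurable_id (by fun_prop)
    exact (IndepFun_iff_Indep _ _ _).2 (indep_of_indep_of_le_left (indep_of_indep_of_le_right
      (h.indep_techSigma i) hYs.comap_le) hXs.comap_le)
  have hG : Measurable (Function.uncurry fun (p : ℝ × ℝ) (u : ℝ) =>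
      {p : ℝ × ℝ | 1 / u ≤ p.1 ∧ y ≤ p.2}.indicator (1 : ℝ × ℝ → ℝ≥0∞) p) := by
    have : (Function.uncurry fun (p : ℝ × ℝ) (u : ℝ) =>
        {p : ℝ × ℝ | 1 / u ≤ p.1 ∧ y ≤ p.2}.indicator (1 : ℝ × ℝ → ℝ≥0∞) p) =
        {q : (ℝ × ℝ) × ℝ | 1 / q.2 ≤ q.1.1 ∧ y ≤ q.1.2}.indicator 1 := by
      ext ⟨t, v⟩
      simp [indicator_apply]
    rw [this]
    refine measurable_one.indicator ((measurableSet_le (f := fun q : (ℝ × ℝ) × ℝ => 1 / q.2)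
      (g := fun q : (ℝ × ℝ) × ℝ => q.1.1) (by fun_prop) (by fun_prop)).inter (measurableSet_le measurable_const
        (measurable_snd.comp measurable_fst)))
  have key := lintegral_of_indep hXm (by fun_prop : Measurable fun ω => 1 / Y ω) hind hG
  have hL : ∀ ω, {p : ℝ × ℝ | 1 / (1 / Y ω) ≤ p.1 ∧ y ≤ p.2}.indicator (1 : ℝ × ℝ → ℝ≥0∞)
      (distRatio φ i ω, sir α (φ i ω) fun k => H i k ω) =
      ({ω | y ≤ sir α (φ i ω) fun k => H i k ω} ∩ bestSet φ i).indicator 1 ω := by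
    intro ω
    have hiff : ω ∈ {ω | y ≤ sir α (φ i ω) fun k => H i k ω} ∩ bestSet φ i ↔
        (distRatio φ i ω, sir α (φ i ω) fun k => H i k ω) ∈
          {p : ℝ × ℝ | 1 / (1 / Y ω) ≤ p.1 ∧ y ≤ p.2} := by
      rw [mem_inter_iff, mem_bestSet_iff hne, and_comm, one_div_one_div]
      rfl
    by_cases hω : ω ∈ {ω | y ≤ sir α (φ i ω) fun k => H i k ω} ∩ bestSet φ i
    · rw [indicator_of_mem hω, indicator_of_mem (hiff.1 hω)]; rfl
    · rw [indicator_of_notMem hω, indicator_of_notMem (fun hh => hω (hiff.2 hh))]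
  simp_rw [hL] at key
  rw [lintegral_indicator_one ((measurableSet_le measurable_const (h.measurable_sir_net i)).inter
    (h.measurableSet_bestSet i))] at key
  rw [key]
  have hsm : ∀ u : ℝ, MeasurableSet {p : ℝ × ℝ | 1 / u ≤ p.1 ∧ y ≤ p.2} := fun u =>
    (measurableSet_le measurable_const measurable_fst).inter
      (measurableSet_le measurable_const measurable_snd)
  simp_rw [fun u : ℝ => lintegral_indicator_one
    (μ := Pr.map fun ω => (distRatio φ i ω, sir α (φ i ω) fun k => H i k ω)) (hsm u)]
  have hF : Measurable fun u : ℝ =>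
      Pr.map (fun ω => (distRatio φ i ω, sir α (φ i ω) fun k => H i k ω))
        {p : ℝ × ℝ | 1 / u ≤ p.1 ∧ y ≤ p.2} := by
    have p1 := Measure.isProbabilityMeasure_map (μ := Pr) hXm.aemeasurable
    have := hG.lintegral_prod_left'
      (μ := Pr.map fun ω => (distRatio φ i ω, sir α (φ i ω) fun k => H i k ω))
    refine (congrArg Measurable (funext fun u => ?_)).mp this
    exact lintegral_indicator_one (hsm u)
  have hd : Measurable fun u => ENNReal.ofReal (minDensity T u) :=
    (continuous_minDensity T).measurable.ennreal_ofReal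
  rw [← lintegral_map (f := fun u : ℝ =>
      Pr.map (fun ω => (distRatio φ i ω, sir α (φ i ω) fun k => H i k ω))
        {p : ℝ × ℝ | 1 / u ≤ p.1 ∧ y ≤ p.2}) hF (by fun_prop),
    h.map_maxOther hlam hμ hT i hne, minLaw, lintegral_withDensity_eq_lintegral_mul _ hd hF]
  -- Given the value `u` of the minimum over the others, technology `i` is selected when its ratio
  -- is at least `1 / u`; the one-technology identity supplies this joint probability with the SIR
  -- condition.
  refine setLIntegral_congr_fun measurableSet_Ioc fun u hu => ?_
  simp only [Pi.mul_apply]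
  rw [kernel_eq, ENNReal.ofReal_mul (minDensity_nonneg hT hu.1.le hu.2),
    Measure.map_apply hXm (hsm u),
    ← (h.cell hlam hμ i).measure_le_ratio_fadingSum hα hy hu.1 hu.2]
  congr 1
  refine measure_congr ?_
  filter_upwards [h.ae_interference (Pw := fun _ => 1) (l := fun _ r => r ^ (-α)) hlam hμ hα
    (fun _ => one_pos) (fun _ _ _ => rfl) i] with ω hω
  exact propext (and_congr_right fun _ => hω.2.2.2.2 y)

theorem IsRayleighPoissonNetwork.measure_le_distRatio_sir
    (h : IsRayleighPoissonNetwork Pr φ H lam μ)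
    (hlam : ∀ i, 0 < lam i) (hμ : 0 < μ) (hα : 2 < α) (i : Fin T) {x y : ℝ}
    (hy : 0 ≤ y) (hx : 0 < x) (hx1 : x ≤ 1) :
    Pr {ω | 1 / x ≤ distRatio φ i ω ∧ y ≤ sir α (φ i ω) fun k => H i k ω} =
      ENNReal.ofReal (cellRate α y x)⁻¹ := by
  rw [← (h.cell hlam hμ i).measure_le_ratio_fadingSum hα hy hx hx1]
  refine measure_congr ?_
  filter_upwards [h.ae_interference (Pw := fun _ => 1) (l := fun _ r => r ^ (-α)) hlam hμ hα
    (fun _ => one_pos) (fun _ _ _ => rfl) i] with ω hω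
  exact propext (and_congr_right fun _ => hω.2.2.2.2 y)

theorem IsRayleighPoissonNetwork.measure_le_sir
    (h : IsRayleighPoissonNetwork Pr φ H lam μ)
    (hlam : ∀ i, 0 < lam i) (hμ : 0 < μ) (hα : 2 < α) (i : Fin T) {y : ℝ} (hy : 0 ≤ y) :
    Pr {ω | y ≤ sir α (φ i ω) fun k => H i k ω} =
      ENNReal.ofReal (1 / (1 + y ^ (2 / α) * phi α y 1)) := by
  have := h.measure_le_distRatio_sir hlam hμ hα i hy one_pos le_rfl
  simp only [cellRate, one_pow, div_one] at this
  rw [one_div, ← this]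
  refine measure_congr ?_
  filter_upwards [h.ae_one_lt_distRatio hlam hμ i] with ω hω
  exact propext (and_iff_right hω.le).symm

end Network

/-! ### Integrability and mean of the rate -/

/-- A lower bound for `phi` at `x = 1`. -/
theorem le_phi_one {α y : ℝ} (hα : 2 < α) (hy : 1 ≤ y) :
    1 / (1 + (2 : ℝ) ^ (α / 2)) ≤ phi α y 1 := by
  have hy0 : 0 < y := by linarith
  set L : ℝ := y ^ (-2 / α) with hL
  have hL0 : 0 < L := Real.rpow_pos_of_pos hy0 _
  have hL1 : L ≤ 1 := Real.rpow_le_one_of_one_le_of_nonpos hy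
    (div_nonpos_of_nonpos_of_nonneg (by norm_num) (by linarith))
  have hint : IntegrableOn (fun u : ℝ => 1 / (1 + (1 : ℝ) ^ (-α) * u ^ (α / 2))) (Ici L) := by
    rw [integrableOn_Ici_iff_integrableOn_Ioi]
    refine Integrable.mono' (integrableOn_Ioi_rpow_of_lt (a := -(α / 2)) (by linarith) hL0)
      (Measurable.aestronglyMeasurable (by fun_prop)) ?_
    filter_upwards [ae_restrict_mem measurableSet_Ioi] with u hu
    have hu0 : 0 < u := hL0.trans hu
    have hp := Real.rpow_pos_of_pos hu0 (α / 2)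
    rw [Real.one_rpow, one_mul, Real.norm_of_nonneg (by positivity), Real.rpow_neg hu0.le,
      ← one_div]
    exact one_div_le_one_div_of_le hp (by linarith)
  -- Since `L ≤ 1`, this interval of length one lies in the domain of integration; on it the
  -- integrand is at least its value at `u = 2`.
  have hsub : Ioc (1 : ℝ) 2 ⊆ Ici L := fun u hu => hL1.trans hu.1.le
  have h1 : ∫ _ in Ioc (1 : ℝ) 2, 1 / (1 + (2 : ℝ) ^ (α / 2)) ≤
      ∫ u in Ioc (1 : ℝ) 2, 1 / (1 + (1 : ℝ) ^ (-α) * u ^ (α / 2)) := by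
    refine setIntegral_mono_on (integrableOn_const (by simp)) (hint.mono_set hsub)
      measurableSet_Ioc fun u hu => ?_
    have hu0 : 0 < u := by linarith [hu.1]
    rw [Real.one_rpow, one_mul]
    have : u ^ (α / 2) ≤ (2 : ℝ) ^ (α / 2) := Real.rpow_le_rpow hu0.le hu.2 (by linarith)
    have := Real.rpow_pos_of_pos hu0 (α / 2)
    exact one_div_le_one_div_of_le (by linarith) (by linarith)
  have h2 := setIntegral_mono_set hint (by
    filter_upwards [ae_restrict_mem measurableSet_Ici] with u hu
    have hu0 : 0 < u := hL0.trans_le hu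
    simp only [Pi.zero_apply]
    positivity) hsub.eventuallyLE
  rw [setIntegral_const, Measure.real, Real.volume_Ioc] at h1
  norm_num at h1
  rw [phi]
  refine le_trans (le_of_eq ?_) (h1.trans ?_)
  · rw [one_div]
  · simpa using h2

/-- Exponential decay of the distribution of the rate. -/
theorem rate_tail_le {α t : ℝ} (hα : 2 < α) (ht : 0 < t) :
    1 / (1 + ((2 : ℝ) ^ t - 1) ^ (2 / α) * phi α ((2 : ℝ) ^ t - 1) 1) ≤
      (1 + (2 : ℝ) ^ (α / 2)) * (2 : ℝ) ^ (2 / α) * Real.exp (-(2 / α * Real.log 2) * t) := by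
  have hα0 : 0 < α := by linarith
  have h2t : (1 : ℝ) ≤ (2 : ℝ) ^ t := Real.one_le_rpow one_le_two ht.le
  have hexp : Real.exp (-(2 / α * Real.log 2) * t) = ((2 : ℝ) ^ t) ^ (-(2 / α)) := by
    rw [← Real.rpow_mul zero_le_two, Real.rpow_def_of_pos two_pos]
    congr 1; ring
  have hc : 0 < (2 : ℝ) ^ (α / 2) := Real.rpow_pos_of_pos two_pos _
  have hR : (2 : ℝ) ^ (2 / α) * Real.exp (-(2 / α * Real.log 2) * t) =
      ((2 : ℝ) ^ t / 2) ^ (-(2 / α)) := by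
    rw [hexp, Real.div_rpow (by positivity) zero_le_two, Real.rpow_neg zero_le_two (2 / α),
      div_inv_eq_mul, mul_comm]
  have hphi := phi_nonneg (α := α) (sub_nonneg.2 h2t) zero_le_one
  have hyp : 0 ≤ ((2 : ℝ) ^ t - 1) ^ (2 / α) := Real.rpow_nonneg (sub_nonneg.2 h2t) _
  rw [mul_assoc, hR]
  have h2pos : (0 : ℝ) < (2 : ℝ) ^ t / 2 := by positivity
  have hpow : 0 < ((2 : ℝ) ^ t / 2) ^ (-(2 / α)) := Real.rpow_pos_of_pos h2pos _
  -- For `2 ^ t ≤ 2` the bound exceeds `1` and is trivial. Otherwise the threshold is at least `1`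
  -- and at least `2 ^ t / 2`, so the lower bound on `phi` applies.
  rcases le_or_gt ((2 : ℝ) ^ t) 2 with h | h
  · have h1 : 1 ≤ ((2 : ℝ) ^ t / 2) ^ (-(2 / α)) :=
      Real.one_le_rpow_of_pos_of_le_one_of_nonpos h2pos (by linarith)
        (neg_nonpos.2 (by positivity))
    have h3 : 1 / (1 + ((2 : ℝ) ^ t - 1) ^ (2 / α) * phi α ((2 : ℝ) ^ t - 1) 1) ≤ 1 := by
      rw [div_le_one (by positivity)]
      exact le_add_of_nonneg_right (by positivity)
    nlinarith
  · have hle := le_phi_one hα (show 1 ≤ (2 : ℝ) ^ t - 1 by linarith)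
    have h1 : ((2 : ℝ) ^ t / 2) ^ (2 / α) ≤ ((2 : ℝ) ^ t - 1) ^ (2 / α) :=
      Real.rpow_le_rpow h2pos.le (by linarith) (by positivity)
    have hq : 0 < ((2 : ℝ) ^ t / 2) ^ (2 / α) := Real.rpow_pos_of_pos h2pos _
    have h3 : ((2 : ℝ) ^ t / 2) ^ (2 / α) * (1 / (1 + (2 : ℝ) ^ (α / 2))) ≤
        1 + ((2 : ℝ) ^ t - 1) ^ (2 / α) * phi α ((2 : ℝ) ^ t - 1) 1 :=
      (mul_le_mul h1 hle (by positivity) hyp).trans (le_add_of_nonneg_left zero_le_one)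
    refine (one_div_le_one_div_of_le (by positivity) h3).trans (le_of_eq ?_)
    rw [Real.rpow_neg h2pos.le]
    field_simp

theorem le_logb_one_add_iff {s t : ℝ} (hs : 0 ≤ s) :
    t ≤ Real.logb 2 (1 + s) ↔ (2 : ℝ) ^ t - 1 ≤ s := by
  rw [Real.le_logb_iff_rpow_le one_lt_two (by positivity), sub_le_iff_le_add']

section Network

variable {Ω : Type*} [mΩ : MeasurableSpace Ω] {Pr : Measure Ω} {T : ℕ} {φ : Fin T → Ω → Set Plane}
  {H : Fin T → ℕ → Ω → ℝ} {lam : Fin T → ℝ} {μ α : ℝ}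

theorem IsRayleighPoissonNetwork.measurable_rate (h : IsRayleighPoissonNetwork Pr φ H lam μ)
    (i : Fin T) : Measurable fun ω => Real.logb 2 (1 + sir α (φ i ω) fun k => H i k ω) :=
  (show Measurable fun s : ℝ => Real.logb 2 (1 + s) by unfold Real.logb; fun_prop).comp
    (h.measurable_sir_net i)

variable [IsProbabilityMeasure Pr]

theorem IsRayleighPoissonNetwork.ae_sir_nonneg (h : IsRayleighPoissonNetwork Pr φ H lam μ)
    (hlam : ∀ i, 0 < lam i) (hμ : 0 < μ) (hα : 2 < α) (i : Fin T) :
    ∀ᵐ ω ∂Pr, 0 ≤ sir α (φ i ω) fun k => H i k ω := by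
  filter_upwards [h.ae_interference (Pw := fun _ => 1) (l := fun _ r => r ^ (-α)) hlam hμ hα
    (fun _ => one_pos) (fun _ _ _ => rfl) i] with ω hω
  exact hω.2.2.1

theorem IsRayleighPoissonNetwork.ae_rate_nonneg (h : IsRayleighPoissonNetwork Pr φ H lam μ)
    (hlam : ∀ i, 0 < lam i) (hμ : 0 < μ) (hα : 2 < α) (i : Fin T) :
    ∀ᵐ ω ∂Pr, 0 ≤ Real.logb 2 (1 + sir α (φ i ω) fun k => H i k ω) := by
  filter_upwards [h.ae_sir_nonneg hlam hμ hα i] with ω hω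
  exact Real.logb_nonneg one_lt_two (by linarith)

/-- By the layer cake formula the mean is the integral of the tail, which decays exponentially. -/
theorem IsRayleighPoissonNetwork.integrable_rate (h : IsRayleighPoissonNetwork Pr φ H lam μ)
    (hlam : ∀ i, 0 < lam i) (hμ : 0 < μ) (hα : 2 < α) (i : Fin T) :
    Integrable (fun ω => Real.logb 2 (1 + sir α (φ i ω) fun k => H i k ω)) Pr := by
  have hm := h.measurable_rate (α := α) i
  have h0 := h.ae_rate_nonneg hlam hμ hα i
  have hs := h.ae_sir_nonneg hlam hμ hα i
  rw [← lintegral_ofReal_ne_top_iff_integrable hm.aestronglyMeasurable h0,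
    lintegral_eq_lintegral_meas_le Pr h0 hm.aemeasurable]
  have hle : ∀ t ∈ Ioi (0 : ℝ),
      Pr {ω | t ≤ Real.logb 2 (1 + sir α (φ i ω) fun k => H i k ω)} ≤
      ENNReal.ofReal ((1 + (2 : ℝ) ^ (α / 2)) * (2 : ℝ) ^ (2 / α) *
        Real.exp (-(2 / α * Real.log 2) * t)) := by
    intro t ht
    have ht0 : (0 : ℝ) < t := ht
    have h2t : (1 : ℝ) ≤ (2 : ℝ) ^ t := Real.one_le_rpow one_le_two ht0.le
    refine le_trans (le_of_eq ?_) (ENNReal.ofReal_le_ofReal (rate_tail_le hα ht0))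
    rw [← h.measure_le_sir hlam hμ hα i (sub_nonneg.2 h2t)]
    refine measure_congr ?_
    filter_upwards [hs] with ω hω
    exact propext (le_logb_one_add_iff hω)
  refine ((setLIntegral_mono (by fun_prop) hle).trans_lt ?_).ne
  have hlog : 0 < 2 / α * Real.log 2 := mul_pos (by positivity) (Real.log_pos one_lt_two)
  exact ((integrableOn_exp_mul_Ioi (neg_lt_zero.2 hlog) 0).const_mul _).lintegral_lt_top

theorem IsRayleighPoissonNetwork.integral_bestSet_coverage
    (h : IsRayleighPoissonNetwork Pr φ H lam μ) (hlam : ∀ i, 0 < lam i) (hμ : 0 < μ) (hα : 2 < α)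
    (hT : 2 ≤ T) (i : Fin T) {y : ℝ} (hy : 0 ≤ y) :
    Pr.real ({ω | y ≤ sir α (φ i ω) fun k => H i k ω} ∩ bestSet φ i) =
      ∫ x in (0 : ℝ)..1, kernel α T x y := by
  rw [Measure.real, h.measure_bestSet_sir hlam hμ hα hT i hy,
    intervalIntegral.integral_of_le zero_le_one, integral_eq_lintegral_of_nonneg_ae]
  · filter_upwards [ae_restrict_mem measurableSet_Ioc] with x hx
    exact kernel_nonneg hT hy hx.1.le hx.2
  · exact ((measurable_kernel α T).comp (measurable_id.prodMk
      measurable_const)).aestronglyMeasurable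

/-- The layer cake formula produces the integral over `t` outside and over `x` inside, so the stated
order requires Fubini. -/
theorem IsRayleighPoissonNetwork.integral_bestSet_rate
    (h : IsRayleighPoissonNetwork Pr φ H lam μ) (hlam : ∀ i, 0 < lam i) (hμ : 0 < μ) (hα : 2 < α)
    (hT : 2 ≤ T) (i : Fin T) :
    ∫ ω in bestSet φ i, Real.logb 2 (1 + sir α (φ i ω) fun k => H i k ω) ∂Pr =
      ∫ x in (0 : ℝ)..1, ∫ t in Ioi (0 : ℝ), kernel α T x ((2 : ℝ) ^ t - 1) := by
  have hm := h.measurable_rate (α := α) i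
  have h0 := h.ae_rate_nonneg hlam hμ hα i
  have hs := h.ae_sir_nonneg hlam hμ hα i
  have hint := (h.integrable_rate hlam hμ hα i).integrableOn (s := bestSet φ i)
  have hy : ∀ t : ℝ, t ∈ Ioi (0 : ℝ) → 0 ≤ (2 : ℝ) ^ t - 1 := fun t ht =>
    sub_nonneg.2 (Real.one_le_rpow one_le_two (le_of_lt ht))
  have hset : ∀ t : ℝ, (Pr.restrict (bestSet φ i))
      {ω | t ≤ Real.logb 2 (1 + sir α (φ i ω) fun k => H i k ω)} =
      Pr ({ω | (2 : ℝ) ^ t - 1 ≤ sir α (φ i ω) fun k => H i k ω} ∩ bestSet φ i) := by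
    intro t
    rw [Measure.restrict_apply (measurableSet_le measurable_const hm)]
    refine measure_congr ?_
    filter_upwards [hs] with ω hω
    exact propext (and_congr_left fun _ => le_logb_one_add_iff hω)
  have hK : Measurable fun p : ℝ × ℝ => kernel α T p.1 ((2 : ℝ) ^ p.2 - 1) :=
    (measurable_kernel α T).comp (by fun_prop : Measurable fun p : ℝ × ℝ => (p.1, (2 : ℝ) ^ p.2 - 1))
  rw [hint.integral_eq_integral_meas_le (ae_restrict_of_ae h0)]
  have e1 : ∀ t ∈ Ioi (0 : ℝ), (Pr.restrict (bestSet φ i)).real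
      {ω | t ≤ Real.logb 2 (1 + sir α (φ i ω) fun k => H i k ω)} =
      ∫ x in Ioc (0 : ℝ) 1, kernel α T x ((2 : ℝ) ^ t - 1) := by
    intro t ht
    rw [Measure.real, hset, ← Measure.real, h.integral_bestSet_coverage hlam hμ hα hT i (hy t ht),
      intervalIntegral.integral_of_le zero_le_one]
  rw [setIntegral_congr_fun measurableSet_Ioi e1, intervalIntegral.integral_of_le zero_le_one]
  refine (integral_integral_swap
    (f := fun x t => kernel α T x ((2 : ℝ) ^ t - 1)) ?_).symm
  have hnn : 0 ≤ᵐ[(volume.restrict (Ioc (0 : ℝ) 1)).prod (volume.restrict (Ioi (0 : ℝ)))]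
      fun p : ℝ × ℝ => kernel α T p.1 ((2 : ℝ) ^ p.2 - 1) := by
    rw [Measure.prod_restrict]
    filter_upwards [ae_restrict_mem (measurableSet_Ioc.prod measurableSet_Ioi)] with p hp
    exact kernel_nonneg hT (hy p.2 hp.2) hp.1.1.le hp.1.2
  change Integrable (fun p : ℝ × ℝ => kernel α T p.1 ((2 : ℝ) ^ p.2 - 1)) _
  rw [← lintegral_ofReal_ne_top_iff_integrable hK.aestronglyMeasurable hnn,
    lintegral_prod_symm _ hK.ennreal_ofReal.aemeasurable]
  -- Joint integrability of the kernel comes from reading the layer cake formula backwards: its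
  -- iterated integral is the mean of the rate on the selection event, already known to be finite.
  have e2 : ∀ t ∈ Ioi (0 : ℝ),
      ∫⁻ x in Ioc (0 : ℝ) 1, ENNReal.ofReal (kernel α T x ((2 : ℝ) ^ t - 1)) =
      (Pr.restrict (bestSet φ i)) {ω | t ≤ Real.logb 2 (1 + sir α (φ i ω) fun k => H i k ω)} := by
    intro t ht
    rw [hset, h.measure_bestSet_sir hlam hμ hα hT i (hy t ht)]
  rw [setLIntegral_congr_fun measurableSet_Ioi e2, ← lintegral_eq_lintegral_meas_le _
    (ae_restrict_of_ae h0) hm.aemeasurable]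
  exact hint.lintegral_lt_top.ne

theorem IsRayleighPoissonNetwork.integral_rate
    (h : IsRayleighPoissonNetwork Pr φ H lam μ) (hlam : ∀ i, 0 < lam i) (hμ : 0 < μ) (hα : 2 < α)
    (i : Fin T) :
    ∫ ω, Real.logb 2 (1 + sir α (φ i ω) fun k => H i k ω) ∂Pr =
      ∫ t in Ioi (0 : ℝ), 1 / (1 + ((2 : ℝ) ^ t - 1) ^ (2 / α) * phi α ((2 : ℝ) ^ t - 1) 1) := by
  rw [(h.integrable_rate hlam hμ hα i).integral_eq_integral_meas_le
    (h.ae_rate_nonneg hlam hμ hα i)]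
  refine setIntegral_congr_fun measurableSet_Ioi fun t ht => ?_
  have hy : 0 ≤ (2 : ℝ) ^ t - 1 := sub_nonneg.2 (Real.one_le_rpow one_le_two (le_of_lt ht))
  have hphi := phi_nonneg (α := α) hy zero_le_one
  have e : Pr {ω | t ≤ Real.logb 2 (1 + sir α (φ i ω) fun k => H i k ω)} =
      Pr {ω | (2 : ℝ) ^ t - 1 ≤ sir α (φ i ω) fun k => H i k ω} := by
    refine measure_congr ?_
    filter_upwards [h.ae_sir_nonneg hlam hμ hα i] with ω hω
    exact propext (le_logb_one_add_iff hω)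
  simp only [Measure.real]
  rw [e, h.measure_le_sir hlam hμ hα i hy, ENNReal.toReal_ofReal (by positivity)]

end Network

theorem bestSet_eq_univ_of_eq_one {Ω : Type*} {T : ℕ} (φ : Fin T → Ω → Set Plane) (hT : T = 1)
    (i : Fin T) : bestSet φ i = univ := by
  subst hT
  refine eq_univ_of_forall fun ω j => ?_
  rw [Subsingleton.elim j i]

end MaxRatio

/-! ### Assembling the coverage, rate and conditional statements -/

theorem mainTheorem4 {Ω : Type*} [MeasurableSpace Ω] (Pr : Measure Ω) [IsProbabilityMeasure Pr]
    {T : ℕ} (φ : Fin T → Ω → Set MaxRatio.Plane) (H : Fin T → ℕ → Ω → ℝ)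
    (lam Pw β : Fin T → ℝ) (μ α : ℝ)
    (hlam : ∀ i, 0 < lam i) (hPw : ∀ i, 0 < Pw i) (hβ : ∀ i, 0 < β i) (hμ : 0 < μ) (hα : 2 < α)
    (hnet : MaxRatio.IsRayleighPoissonNetwork Pr φ H lam μ)
    (N₀ : Fin T → ℝ) (hN₀ : ∀ i, N₀ i = 0)
    (l : Fin T → ℝ → ℝ) (hl : ∀ i, ∀ r : ℝ, 0 < r → l i r = r ^ (-α))
    (π : Ω → Fin T × ℕ) (hπ : MaxRatio.IsMaxRatioPolicy φ Pr π) :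
    -- the interference at the user is almost surely a convergent positive series
    (∀ i, ∀ᵐ ω ∂Pr,
      Summable (fun k : {k : ℕ // k ≠ 0} => MaxRatio.receivedPower φ H Pw l i k ω) ∧
      0 < MaxRatio.interference φ H Pw l i 0 ω) ∧
    -- coverage probability
    Integrable (MaxRatio.experienced φ H Pw N₀ l (MaxRatio.coverageMetric β) π) Pr ∧
    (2 ≤ T →
      MaxRatio.performance φ H Pw N₀ l Pr (MaxRatio.coverageMetric β) π =
        ∑ i, ∫ x in (0 : ℝ)..1,
          2 * ((T : ℝ) - 1) * x ^ 3 * (1 - x ^ 2) ^ (T - 2) /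
            (1 + β i ^ (2 / α) * MaxRatio.phi α (β i) x)) ∧
    (∀ i₁ : Fin T, T = 1 →
      MaxRatio.performance φ H Pw N₀ l Pr (MaxRatio.coverageMetric β) π =
        1 / (1 + β i₁ ^ (2 / α) * MaxRatio.phi α (β i₁) 1)) ∧
    -- average achievable rate
    Integrable (MaxRatio.experienced φ H Pw N₀ l MaxRatio.rateMetric π) Pr ∧
    (2 ≤ T →
      MaxRatio.performance φ H Pw N₀ l Pr MaxRatio.rateMetric π =
        ∑ _i : Fin T, ∫ x in (0 : ℝ)..1, ∫ t in Set.Ioi (0 : ℝ),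
          2 * ((T : ℝ) - 1) * x ^ 3 * (1 - x ^ 2) ^ (T - 2) /
            (1 + ((2 : ℝ) ^ t - 1) ^ (2 / α) * MaxRatio.phi α ((2 : ℝ) ^ t - 1) x)) ∧
    (T = 1 →
      MaxRatio.performance φ H Pw N₀ l Pr MaxRatio.rateMetric π =
        ∫ t in Set.Ioi (0 : ℝ),
          1 / (1 + ((2 : ℝ) ^ t - 1) ^ (2 / α) * MaxRatio.phi α ((2 : ℝ) ^ t - 1) 1)) ∧
    -- conditional coverage given that the ratio of the two smallest distances is at least `1 / x`
    (∀ i, ∀ x : ℝ, 0 < x → x ≤ 1 →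
      (ProbabilityTheory.cond Pr {ω | 1 / x ≤ MaxRatio.distRatio φ i ω}).real
          {ω | β i ≤ MaxRatio.sinr φ H Pw N₀ l i 0 ω} =
        1 / (1 + β i ^ (2 / α) * MaxRatio.phi α (β i) x)) := by
  have hint := hnet.ae_interference hlam hμ hα hPw hl
  have hbest := fun i => hnet.measurableSet_bestSet i
  have hcovset : ∀ i, MeasurableSet
      ({ω | β i ≤ MaxRatio.sir α (φ i ω) fun k => H i k ω} ∩ MaxRatio.bestSet φ i) := fun i =>
    (measurableSet_le measurable_const (hnet.measurable_sir_net i)).inter (hbest i)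
  have hcov : MaxRatio.experienced φ H Pw N₀ l (MaxRatio.coverageMetric β) π =ᵐ[Pr]
      fun ω => ∑ i, ({ω | β i ≤ MaxRatio.sir α (φ i ω) fun k => H i k ω} ∩
        MaxRatio.bestSet φ i).indicator (1 : Ω → ℝ) ω := by
    refine (hnet.experienced_ae_eq hlam hμ hα hPw hl hN₀ hπ _).trans
      (Filter.Eventually.of_forall fun ω => Finset.sum_congr rfl fun i _ => ?_)
    rw [Set.inter_comm, ← Set.indicator_indicator]
    rfl
  have hcovint : ∀ i ∈ (Finset.univ : Finset (Fin T)), Integrable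
      (fun ω => ({ω | β i ≤ MaxRatio.sir α (φ i ω) fun k => H i k ω} ∩
        MaxRatio.bestSet φ i).indicator (1 : Ω → ℝ) ω) Pr := fun i _ =>
    (integrable_const (1 : ℝ)).indicator (hcovset i)
  have hcovperf : MaxRatio.performance φ H Pw N₀ l Pr (MaxRatio.coverageMetric β) π =
      ∑ i, Pr.real ({ω | β i ≤ MaxRatio.sir α (φ i ω) fun k => H i k ω} ∩
        MaxRatio.bestSet φ i) := by
    rw [MaxRatio.performance, integral_congr_ae hcov, integral_finsetSum _ hcovint]
    exact Finset.sum_congr rfl fun i _ => integral_indicator_one (hcovset i)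
  have hrate := hnet.experienced_ae_eq hlam hμ hα hPw hl hN₀ hπ MaxRatio.rateMetric
  have hrateint : ∀ i ∈ (Finset.univ : Finset (Fin T)), Integrable
      (fun ω => (MaxRatio.bestSet φ i).indicator
        (fun ω => MaxRatio.rateMetric i (MaxRatio.sir α (φ i ω) fun k => H i k ω)) ω) Pr :=
    fun i _ => (hnet.integrable_rate hlam hμ hα i).indicator (hbest i)
  have hrateperf : MaxRatio.performance φ H Pw N₀ l Pr MaxRatio.rateMetric π =
      ∑ i, ∫ ω in MaxRatio.bestSet φ i,
        Real.logb 2 (1 + MaxRatio.sir α (φ i ω) fun k => H i k ω) ∂Pr := by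
    rw [MaxRatio.performance, integral_congr_ae hrate, integral_finsetSum _ hrateint]
    exact Finset.sum_congr rfl fun i _ => integral_indicator (hbest i)
  refine ⟨fun i => (hint i).mono fun ω hω => ⟨hω.1, hω.2.1⟩,
    (integrable_finsetSum _ hcovint).congr hcov.symm, fun hT => ?_, fun i₁ hT => ?_,
    (integrable_finsetSum _ hrateint).congr hrate.symm, fun hT => ?_, fun hT => ?_,
    fun i x hx hx1 => ?_⟩
  · rw [hcovperf]
    exact Finset.sum_congr rfl fun i _ =>
      hnet.integral_bestSet_coverage hlam hμ hα hT i (hβ i).le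
  · have : Subsingleton (Fin T) := by rw [hT]; infer_instance
    have hphi := MaxRatio.phi_nonneg (α := α) (hβ i₁).le zero_le_one
    have hb := (hβ i₁).le
    rw [hcovperf, Fintype.sum_subsingleton _ i₁, MaxRatio.bestSet_eq_univ_of_eq_one φ hT,
      Set.inter_univ, Measure.real, hnet.measure_le_sir hlam hμ hα i₁ hb,
      ENNReal.toReal_ofReal (by positivity)]
  · rw [hrateperf]
    exact Finset.sum_congr rfl fun i _ => hnet.integral_bestSet_rate hlam hμ hα hT i
  · have : Subsingleton (Fin T) := by rw [hT]; infer_instance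
    have i₁ : Fin T := ⟨0, by omega⟩
    rw [hrateperf, Fintype.sum_subsingleton _ i₁, MaxRatio.bestSet_eq_univ_of_eq_one φ hT,
      Measure.restrict_univ, hnet.integral_rate hlam hμ hα i₁]
  · have hb := (hβ i).le
    have hphi := MaxRatio.phi_nonneg (α := α) hb hx.le
    have hE : MeasurableSet {ω | 1 / x ≤ MaxRatio.distRatio φ i ω} :=
      measurableSet_le measurable_const (hnet.measurable_distRatio i)
    have hsets : ({ω | 1 / x ≤ MaxRatio.distRatio φ i ω} ∩
        {ω | β i ≤ MaxRatio.sinr φ H Pw N₀ l i 0 ω} : Set Ω) =ᵐ[Pr]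
        {ω | 1 / x ≤ MaxRatio.distRatio φ i ω ∧
          β i ≤ MaxRatio.sir α (φ i ω) fun k => H i k ω} := by
      filter_upwards [hint i] with ω hω
      refine propext (and_congr_right fun _ => ?_)
      change β i ≤ MaxRatio.sinr φ H Pw N₀ l i 0 ω ↔ _
      rw [hω.2.2.2.1 N₀ (hN₀ i)]
    -- Dividing the joint probability by this `x²` cancels the `x²` in the inverse of `cellRate`.
    have hPE : Pr {ω | 1 / x ≤ MaxRatio.distRatio φ i ω} = ENNReal.ofReal (x ^ 2) :=
      (hnet.cell hlam hμ i).measure_le_ratio hx hx1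
    rw [Measure.real, cond_apply hE, measure_congr hsets,
      hnet.measure_le_distRatio_sir hlam hμ hα i hb hx hx1, hPE, ENNReal.toReal_mul,
      ENNReal.toReal_inv, ENNReal.toReal_ofReal (by positivity),
      ENNReal.toReal_ofReal (inv_nonneg.2 (MaxRatio.cellRate_pos hb hx).le), MaxRatio.cellRate]
    field_simp
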